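/- **Setting.** Let $N,n,p\in\mathbb N$. Consider agents $i=1,\dots,N$ with Euler–Lagrange dynamics $$M_i(q_i)\ddot q_i+C_i(q_i,\dot q_i)\dot q_i+G_i(q_i)=\tau_i+d_i,\qquad q_i\in\mathbb R^n ,$$ where $M_i$ is differentiable, symmetric and $k_1I\le M_i(q)\le k_2I$ with $k_1,k_2>0$; $\|C_i(q,v)\|\le k_c\|v\|$, $\|G_i(q)\|\le k_g$; $\dot M_i-2C_i$ is skew-symmetric, where $\dot M_i=DM_i(q)[v]$; and $M_i(q)x+C_i(q,v)y+G_i(q)=Y_i(q,v,x,y)\Theta_i$ for all $q,v,x,y$, with a known locally Lipschitz regression matrix $Y_i$ and an unknown constant vector $\Theta_i\in\mathbb R^p$. The components of the disturbances are $d_{is}(t)=\psi_{is,0}+\sum_{k=1}^{m_{is}}\psi_{is,k}\sin(\sigma_{is,k}t+\phi_{is,k})$ with unknown biases, amplitudes, phases and frequencies $\sigma_{is,k}>0$. The agents communicate over a directed graph with weights $a_{ij}\ge 0$ ($a_{ij}>0$ iff there is an edge from $j$ to $i$) and Laplacian $\mathcal L$, which contains a spanning tree. **Controller.** Let $M_{is}\in\mathbb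 R^{r_{is}\times r_{is}}$ be Hurwitz, $(M_{is},N_{is})$ controllable, $r_{is}\ge1$, $\Psi_{is}=(1,0,\dots,0)$, and let $\mathbf M_i,\mathbf N_i,\Psi_i$ be the block diagonal matrices formed from these over $s=1,\dots,n$; let $A_i=\Psi_i(T_i^0)^{-1}$ with $T_i^0$ nonsingular, $K_i$ positive definite, $\Lambda_i$ positive definite diagonal, $\alpha>0$. Let $E_{i1},\dots,E_{il_i}$ be constant matrices and let $P_i,Q_i,L_i$ be locally Lipschitz regression matrices with, for $s=v-y$, $$P_i(q,v,x,y)\Theta_i=\mathbf M_i\mathbf N_iM_i(q)s+\mathbf N_iC_i(q,v)s-\mathbf N_i\dot M_i s+\mathbf N_iY_i(q,v,x,y)\Theta_i,$$ $$Q_i(q,v,x,y)\Theta_i=A_i\mathbf N_iM_i(q)s-Y_i(q,v,x,y)\Theta_i,\qquad L_i(q,s)\Theta_i=M_i(q)s .$$ The control law is $$\dot S_i=\mu_1\sum_j a_{ij}(S_j-S_i),\qquad \dot\eta_i=S_i\eta_i+\mu_2\sum_j a_{ij}(\eta_j-\eta_i),$$ $$\dot\xi_i=\mathbf M_i\xi_i+\mathbf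 N_i\tau_i,\qquad \dot\zeta_i=\mathbf M_i\zeta_i+P_i,\qquad \tau_i=-K_is_i-\rho_i\hat\omega_i+A_i\xi_i,\qquad \dot{\hat\omega}_i=\Lambda_i^{-1}\rho_i^{T}s_i,$$ where $\dot q_{ri}=S_i\eta_i-\alpha(q_i-\eta_i)$, $\ddot q_{ri}=\dot S_i\eta_i+S_i\dot\eta_i-\alpha(\dot q_i-\dot\eta_i)$, $s_i=\dot q_i-\dot q_{ri}$, $P_i,Q_i$ are evaluated at $(q_i,\dot q_i,\ddot q_{ri},\dot q_{ri})$, and $$\rho_i=\big[\,A_i\zeta_i+Q_i\ \big|\ E_{i1}(\zeta_i+\mathbf N_iL_i(q_i,s_i)),\dots,E_{il_i}(\zeta_i+\mathbf N_iL_i(q_i,s_i))\ \big|\ E_{i1}\xi_i,\dots,E_{il_i}\xi_i\,\big].$$ The internal model is said to *fit* the disturbance if there are coefficients such that $d_{is}^{(r_{is})}=c_{is,1}d_{is}+\dots+c_{is,r_{is}}d_{is}^{(r_{is}-1)}$ for every $s$, the companion matrix $\Phi_{is}$ of each of these equations has its spectrum on the imaginary axis, and $A_i-\Psi_i(T_i)^{-1}$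 is in the linear span of the $E_{ij}$, where $T_i=\operatorname{diag}(T_{i1},\dots,T_{in})$ is the nonsingular solution of $T_{is}\Phi_{is}-M_{is}T_{is}=N_{is}\Psi_{is}$. **Theorem.** (1) For given $Y_i$ and numbers $m_{is}$, there is such a choice of $(M_{is},N_{is},T^0_i,E_{ij},P_i,Q_i,L_i,K_i,\Lambda_i)$, independent of the plants and the disturbances, for which the three regression identities hold for every plant with regression matrix $Y_i$ and the internal model fits every disturbance with $m_{is}$ sinusoids. (2) For all initial values $S_i(0)$ there is $\mu_0>0$ such that for all $\mu_1,\mu_2\ge\mu_0$, all controllers, plants and disturbances as above that satisfy the regression identities and the fit, and arbitrary initial values of $q_i,\dot q_i,\eta_i,\xi_i,\zeta_i,\hat\omega_i$, the closed loop has a solution on $[0,\infty)$. For every such solution, let $S^*=\sum_iu_iS_i(0)$ and $\chi^*=\lim_{t\to\infty}e^{-S^*t}\sum_iu_i\eta_i(t)$, where $u^T\mathcal L=0$, $\sum_iu_i=1$; these exist, and: * (a) If the consensus trajectory $e^{S^*t}\chi^*$ is bounded on $[0,\infty)$, then all $q_i$ and $\dot q_i$ are bounded on $[0,\infty)$, and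 $q_i-q_j\to0$, $\dot q_i-\dot q_j\to0$ as $t\to\infty$ for all $i,j$. * (b) If only its derivative $S^*e^{S^*t}\chi^*$ is bounded on $[0,\infty)$, and the matrices $P_i,Q_i,L_i$ are bounded uniformly in $q$ as long as their other arguments stay in a bounded set, then all $q_i-e^{S^*t}\chi^*$ and $\dot q_i$ are bounded on $[0,\infty)$, and again $q_i-q_j\to0$, $\dot q_i-\dot q_j\to0$ for all $i,j$. -/

import Mathlib

open Filter Topology
open scoped Matrix

noncomputable section

namespace EulerLagrangeConsensus

/-! ### The communication graph -/

/-- Laplacian of the weighted digraph with weights `a i j` (positive iff there is an edge from `j`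
to `i`, zero otherwise). -/
def laplacian {N : ℕ} (a : Matrix (Fin N) (Fin N) ℝ) : Matrix (Fin N) (Fin N) ℝ :=
  Matrix.diagonal (fun i => ∑ j, a i j) - a

/-- The digraph contains a (directed) spanning tree: some node reaches every node by a directed
path. -/
def HasSpanningTree {N : ℕ} (a : Matrix (Fin N) (Fin N) ℝ) : Prop :=
  ∃ root, ∀ i, Relation.ReflTransGen (fun j k => 0 < a k j) root i

/-! ### The agents -/

/-- A regression matrix `Y (q, q̇, x, y)`. -/
abbrev Regressor (ι : Type) (n p : ℕ) : Type :=
  (Fin n → ℝ) → (Fin n → ℝ) → (Fin n → ℝ) → (Fin n → ℝ) → Matrix ι (Fin p) ℝ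

/-- Every entry is locally Lipschitz, jointly in the four arguments. -/
def Regressor.IsLocLipschitz {ι : Type} {n p : ℕ} (Y : Regressor ι n p) : Prop :=
  ∀ i j, LocallyLipschitz
    (fun z : (Fin n → ℝ) × (Fin n → ℝ) × (Fin n → ℝ) × (Fin n → ℝ) =>
      Y z.1 z.2.1 z.2.2.1 z.2.2.2 i j)

/-- The data of `M(q) q̈ + C(q, q̇) q̇ + G(q) = τ + d` and its parameter vector `Θ`. -/
structure Plant (n p : ℕ) where
  inertia : (Fin n → ℝ) → Matrix (Fin n) (Fin n) ℝ
  coriolis : (Fin n → ℝ) → (Fin n → ℝ) → Matrix (Fin n) (Fin n) ℝ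
  gravity : (Fin n → ℝ) → Fin n → ℝ
  param : Fin p → ℝ

/-- `Ṁ(q)`: the derivative of the inertia matrix at `q` in the direction `v = q̇`. -/
def Plant.inertiaRate {n p : ℕ} (P : Plant n p) (q v : Fin n → ℝ) : Matrix (Fin n) (Fin n) ℝ :=
  Matrix.of fun i j => fderiv ℝ (fun z => P.inertia z i j) q v

/-- The standard properties of an Euler-Lagrange system whose known regression matrix is `Y`.
(The choice of the norm on `ℝⁿ` only affects the existentially quantified constants.) -/
structure Plant.IsEulerLagrange {n p : ℕ} (P : Plant n p) (Y : Regressor (Fin n) n p) : Prop where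
  inertia_differentiable : ∀ i j, Differentiable ℝ (fun q => P.inertia q i j)
  inertia_symm : ∀ q, (P.inertia q).IsSymm
  inertia_bounds : ∃ k₁ k₂ : ℝ, 0 < k₁ ∧ 0 < k₂ ∧ ∀ q x : Fin n → ℝ,
    k₁ * (x ⬝ᵥ x) ≤ x ⬝ᵥ (P.inertia q *ᵥ x) ∧ x ⬝ᵥ (P.inertia q *ᵥ x) ≤ k₂ * (x ⬝ᵥ x)
  coriolis_bound : ∃ k : ℝ, 0 < k ∧ ∀ q v x : Fin n → ℝ, ‖P.coriolis q v *ᵥ x‖ ≤ k * ‖v‖ * ‖x‖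
  gravity_bound : ∃ k : ℝ, 0 < k ∧ ∀ q, ‖P.gravity q‖ ≤ k
  regression : ∀ q v x y,
    P.inertia q *ᵥ x + P.coriolis q v *ᵥ y + P.gravity q = Y q v x y *ᵥ P.param
  skew : ∀ q v, (P.inertiaRate q v - (2 : ℝ) • P.coriolis q v)ᵀ =
    -(P.inertiaRate q v - (2 : ℝ) • P.coriolis q v)

/-- Bias, amplitudes, frequencies and phases of a disturbance whose `s`-th component has `m s`
sinusoidal terms. -/
structure Disturbance {n : ℕ} (m : Fin n → ℕ) where
  bias : Fin n → ℝ
  amp : ∀ s, Fin (m s) → ℝ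
  freq : ∀ s, Fin (m s) → ℝ
  phase : ∀ s, Fin (m s) → ℝ
  freq_pos : ∀ s k, 0 < freq s k

/-- The `s`-th component of the disturbance, as a function of time. -/
def Disturbance.value {n : ℕ} {m : Fin n → ℕ} (d : Disturbance m) (s : Fin n) (t : ℝ) : ℝ :=
  d.bias s + ∑ k, d.amp s k * Real.sin (d.freq s k * t + d.phase s k)

/-! ### The internal model -/

/-- All complex eigenvalues have negative real part. -/
def IsHurwitz {r : ℕ} (M : Matrix (Fin r) (Fin r) ℝ) : Prop :=
  ∀ z ∈ spectrum ℂ (M.map (algebraMap ℝ ℂ)), z.re < 0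

/-- The pair `(M, b)` is controllable: `b, M b, …, M ^ (r - 1) b` form a nonsingular matrix. -/
def IsControllable {r : ℕ} (M : Matrix (Fin r) (Fin r) ℝ) (b : Fin r → ℝ) : Prop :=
  (Matrix.of fun i k : Fin r => ((M ^ (k : ℕ)) *ᵥ b) i).rank = r

/-- The matrix with rows `(0 | I)` and `(c₁, …, c_r)`. -/
def companion {r : ℕ} (c : Fin r → ℝ) : Matrix (Fin r) (Fin r) ℝ :=
  Matrix.of fun i j =>
    if (i : ℕ) + 1 = r then c j else if (j : ℕ) = (i : ℕ) + 1 then 1 else 0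

/-- The row `(1, 0, …, 0)`. -/
def firstRow (r : ℕ) : Fin r → ℝ := fun k => if (k : ℕ) = 0 then 1 else 0

/-! ### The controller of one agent -/

/-- Everything the controller of one agent is built from (all of it known to the designer, none of
it depending on the unknown parameters of the plant or of the disturbance):
dimensions `r s` and matrices `M s`, `N s` of the internal model, the nominal matrix `T₀`,
the matrices `E j` that parametrize the uncertainty of the internal model, the regression matrices
`P`, `Q` (as functions of `q, q̇, q̈_r, q̇_r`) and `L` (as a function of `q, s`), and the gains `K`
and `Λ` (the diagonal of the update-rate matrix). -/
structure Design (n p : ℕ) where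
  r : Fin n → ℕ
  l : ℕ
  M : ∀ s, Matrix (Fin (r s)) (Fin (r s)) ℝ
  N : ∀ s, Fin (r s) → ℝ
  T₀ : Matrix ((s : Fin n) × Fin (r s)) ((s : Fin n) × Fin (r s)) ℝ
  E : Fin l → Matrix (Fin n) ((s : Fin n) × Fin (r s)) ℝ
  P : Regressor ((s : Fin n) × Fin (r s)) n p
  Q : Regressor (Fin n) n p
  L : (Fin n → ℝ) → (Fin n → ℝ) → Matrix (Fin n) (Fin p) ℝ
  K : Matrix (Fin n) (Fin n) ℝ
  Λ : Fin p ⊕ (Fin l × Fin p) ⊕ Fin l → ℝ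

namespace Design

variable {n p : ℕ} (D : Design n p)

/-- Index type of the stacked internal model, of cardinality `∑ s, r s`. -/
abbrev Idx : Type := (s : Fin n) × Fin (D.r s)

/-- Index type of the estimate of `(Θ, ϱ ⊗ Θ, ϱ)`. -/
abbrev Par : Type := Fin p ⊕ (Fin D.l × Fin p) ⊕ Fin D.l

/-- `block diag (M₁, …, M_n)`. -/
def bigM : Matrix D.Idx D.Idx ℝ := Matrix.blockDiagonal' D.M

/-- `block diag (N₁, …, N_n)`. -/
def bigN : Matrix D.Idx (Fin n) ℝ := Matrix.of fun k s => if k.1 = s then D.N k.1 k.2 else 0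

/-- `Ψ = block diag (Ψ₁, …, Ψ_n)`. -/
def bigΨ : Matrix (Fin n) D.Idx ℝ :=
  Matrix.of fun s k => if k.1 = s then firstRow (D.r k.1) k.2 else 0

/-- `A = Ψ T₀⁻¹`. -/
def A : Matrix (Fin n) D.Idx ℝ := D.bigΨ * D.T₀⁻¹

/-- The conditions on the controller that do not involve the plant or the disturbance. -/
structure Admissible : Prop where
  r_pos : ∀ s, 0 < D.r s
  hurwitz : ∀ s, IsHurwitz (D.M s)
  controllable : ∀ s, IsControllable (D.M s) (D.N s)
  T₀_nonsing : IsUnit D.T₀.det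
  K_posDef : D.K.PosDef
  Λ_pos : ∀ k, 0 < D.Λ k
  P_lip : D.P.IsLocLipschitz
  Q_lip : D.Q.IsLocLipschitz
  L_lip : ∀ i j, LocallyLipschitz (fun z : (Fin n → ℝ) × (Fin n → ℝ) => D.L z.1 z.2 i j)

/-- `P`, `Q`, `L` are regression matrices for the plant; here `x = q̈_r`, `y = q̇_r` and
`s = q̇ - q̇_r = v - y`. -/
structure Regresses (Y : Regressor (Fin n) n p) (Pl : Plant n p) : Prop where
  P_eq : ∀ q v x y,
    D.P q v x y *ᵥ Pl.param =
      D.bigM *ᵥ (D.bigN *ᵥ (Pl.inertia q *ᵥ (v - y))) + D.bigN *ᵥ (Pl.coriolis q v *ᵥ (v - y))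
        - D.bigN *ᵥ (Pl.inertiaRate q v *ᵥ (v - y)) + D.bigN *ᵥ (Y q v x y *ᵥ Pl.param)
  Q_eq : ∀ q v x y,
    D.Q q v x y *ᵥ Pl.param =
      D.A *ᵥ (D.bigN *ᵥ (Pl.inertia q *ᵥ (v - y))) - Y q v x y *ᵥ Pl.param
  L_eq : ∀ q s, D.L q s *ᵥ Pl.param = Pl.inertia q *ᵥ s

/-- The internal model fits the disturbance: each component `d_s` solves a homogeneous linear
differential equation of order `r s` with constant coefficients `c s`, all of whose characteristic
roots are on the imaginary axis, and the matrix `Ψ T₀⁻¹ - Ψ T⁻¹` is a linear combination of the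
`E j`, where `T` is the nonsingular block diagonal solution of the Sylvester equations
`T_s Φ_s - M_s T_s = N_s Ψ_s`. -/
def Models {m : Fin n → ℕ} (d : Disturbance m) : Prop :=
  ∃ c : ∀ s, Fin (D.r s) → ℝ,
    (∀ s t, iteratedDeriv (D.r s) (d.value s) t =
      ∑ k, c s k * iteratedDeriv (k : ℕ) (d.value s) t) ∧
    (∀ s, ∀ z ∈ spectrum ℂ ((companion (c s)).map (algebraMap ℝ ℂ)), z.re = 0) ∧
    ∀ T : ∀ s, Matrix (Fin (D.r s)) (Fin (D.r s)) ℝ,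
      (∀ s, IsUnit (T s).det ∧
        T s * companion (c s) - D.M s * T s = Matrix.vecMulVec (D.N s) (firstRow (D.r s))) →
      ∃ ϱ : Fin D.l → ℝ, D.A - D.bigΨ * (Matrix.blockDiagonal' T)⁻¹ = ∑ j, ϱ j • D.E j

/-- The regression matrices are bounded uniformly in the position `q` as long as their other
arguments stay in a bounded set. -/
def UniformlyBounded : Prop :=
  ∀ R : ℝ, ∃ B : ℝ, ∀ q v x y : Fin n → ℝ, ‖v‖ ≤ R → ‖x‖ ≤ R → ‖y‖ ≤ R →
    (∀ i j, |D.P q v x y i j| ≤ B) ∧ (∀ i j, |D.Q q v x y i j| ≤ B) ∧ ∀ i j, |D.L q v i j| ≤ B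

/-- The state of one agent (position `q`, velocity `v`) and of its controller: observer `(S, η)`,
compensator `ξ`, auxiliary filter `ζ`, parameter estimate `ω`. -/
structure State where
  q : Fin n → ℝ
  v : Fin n → ℝ
  S : Matrix (Fin n) (Fin n) ℝ
  η : Fin n → ℝ
  ξ : D.Idx → ℝ
  ζ : Matrix D.Idx (Fin p) ℝ
  ω : D.Par → ℝ

variable {D}

/-- `q̇_r = S η - α (q - η)`. -/
def State.refVel (α : ℝ) (x : D.State) : Fin n → ℝ := x.S *ᵥ x.η - α • (x.q - x.η)

/-- `q̈_r = Ṡ η + S η̇ - α (q̇ - η̇)`, for given `Ṡ` and `η̇`. -/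
def State.refAcc (α : ℝ) (x : D.State) (dS : Matrix (Fin n) (Fin n) ℝ) (dη : Fin n → ℝ) :
    Fin n → ℝ :=
  dS *ᵥ x.η + x.S *ᵥ dη - α • (x.v - dη)

/-- `s = q̇ - q̇_r`. -/
def State.slide (α : ℝ) (x : D.State) : Fin n → ℝ := x.v - x.refVel α

/-- `ρ`, with the three blocks `A ζ + Q`, `(E₁ (ζ + N L), …, E_l (ζ + N L))` and
`(E₁ ξ, …, E_l ξ)` side by side. -/
def State.rho (α : ℝ) (x : D.State) (dS : Matrix (Fin n) (Fin n) ℝ) (dη : Fin n → ℝ) :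
    Matrix (Fin n) D.Par ℝ :=
  Matrix.fromCols (D.A * x.ζ + D.Q x.q x.v (x.refAcc α dS dη) (x.refVel α))
    (Matrix.fromCols
      (Matrix.of fun i jk => (D.E jk.1 * (x.ζ + D.bigN * D.L x.q (x.slide α))) i jk.2)
      (Matrix.of fun i j => (D.E j *ᵥ x.ξ) i))

/-- The torque `τ = τ̃ + A ξ` with `τ̃ = - K s - ρ ω̂`. -/
def State.torque (α : ℝ) (x : D.State) (dS : Matrix (Fin n) (Fin n) ℝ) (dη : Fin n → ℝ) :
    Fin n → ℝ :=
  -(D.K *ᵥ x.slide α) - x.rho α dS dη *ᵥ x.ω + D.A *ᵥ x.ξ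

end Design

/-! ### The closed loop -/

section ClosedLoop

variable {N n p : ℕ} (a : Matrix (Fin N) (Fin N) ℝ) (μ₁ μ₂ α : ℝ) {D : Fin N → Design n p}

/-- Right-hand side of the observer equation for `S_i`. -/
def dS (x : ∀ i, (D i).State) (i : Fin N) : Matrix (Fin n) (Fin n) ℝ :=
  μ₁ • ∑ j, a i j • ((x j).S - (x i).S)

/-- Right-hand side of the observer equation for `η_i`. -/
def dη (x : ∀ i, (D i).State) (i : Fin N) : Fin n → ℝ :=
  (x i).S *ᵥ (x i).η + μ₂ • ∑ j, a i j • ((x j).η - (x i).η)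

/-- The torque applied to agent `i`. -/
def torque (x : ∀ i, (D i).State) (i : Fin N) : Fin n → ℝ :=
  (x i).torque α (dS a μ₁ x i) (dη a μ₂ x i)

/-- `x` is a solution on `[0, ∞)` of the closed-loop equations of the network. -/
structure IsSolution (Pl : Fin N → Plant n p) {m : Fin N → Fin n → ℕ}
    (d : ∀ i, Disturbance (m i)) (x : ℝ → ∀ i, (D i).State) : Prop where
  position : ∀ i, ∀ t ≥ 0,
    HasDerivWithinAt (fun t => (x t i).q) (x t i).v (Set.Ici 0) t
  velocity : ∀ i, ∀ t ≥ 0, ∃ acc : Fin n → ℝ,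
    HasDerivWithinAt (fun t => (x t i).v) acc (Set.Ici 0) t ∧
    (Pl i).inertia (x t i).q *ᵥ acc + (Pl i).coriolis (x t i).q (x t i).v *ᵥ (x t i).v
      + (Pl i).gravity (x t i).q = torque a μ₁ μ₂ α (x t) i + fun s => (d i).value s t
  observer_S : ∀ i, ∀ t ≥ 0, ∀ j k,
    HasDerivWithinAt (fun t => (x t i).S j k) (dS a μ₁ (x t) i j k) (Set.Ici 0) t
  observer_η : ∀ i, ∀ t ≥ 0,
    HasDerivWithinAt (fun t => (x t i).η) (dη a μ₂ (x t) i) (Set.Ici 0) t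
  compensator : ∀ i, ∀ t ≥ 0,
    HasDerivWithinAt (fun t => (x t i).ξ)
      ((D i).bigM *ᵥ (x t i).ξ + (D i).bigN *ᵥ torque a μ₁ μ₂ α (x t) i) (Set.Ici 0) t
  auxiliary : ∀ i, ∀ t ≥ 0, ∀ j k,
    HasDerivWithinAt (fun t => (x t i).ζ j k)
      (((D i).bigM * (x t i).ζ + (D i).P (x t i).q (x t i).v
        ((x t i).refAcc α (dS a μ₁ (x t) i) (dη a μ₂ (x t) i)) ((x t i).refVel α)) j k)
      (Set.Ici 0) t
  estimator : ∀ i, ∀ t ≥ 0,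
    HasDerivWithinAt (fun t => (x t i).ω)
      (fun k => ((D i).Λ k)⁻¹ *
        (((x t i).rho α (dS a μ₁ (x t) i) (dη a μ₂ (x t) i))ᵀ *ᵥ (x t i).slide α) k)
      (Set.Ici 0) t

/-- `S* = ∑ uᵢ Sᵢ(0)` and `χ* = lim e^{-S* t} ∑ uᵢ ηᵢ(t)`, where `u` is the left null vector of the
Laplacian whose entries sum to one: the system matrix and the initial state of the autonomous
system on which the observers agree. With `η̂ = e^{Qt} η`, `Q = μ₂ L ⊗ I - I ⊗ S*`, one has
`∑ uᵢ η̂ᵢ(t) = e^{-S* t} ∑ uᵢ ηᵢ(t)`. -/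
def IsGroupModel (x : ℝ → ∀ i, (D i).State) (Sstar : Matrix (Fin n) (Fin n) ℝ)
    (χ : Fin n → ℝ) : Prop :=
  ∃ u : Fin N → ℝ, u ᵥ* laplacian a = 0 ∧ ∑ i, u i = 1 ∧ Sstar = ∑ i, u i • (x 0 i).S ∧
    Tendsto (fun t : ℝ => NormedSpace.exp (-(t • Sstar)) *ᵥ ∑ i, u i • (x t i).η) atTop (𝓝 χ)

end ClosedLoop

/-- The consensus trajectory `e^{S* t} χ*`. -/
def groupTrajectory {n : ℕ} (Sstar : Matrix (Fin n) (Fin n) ℝ) (χ : Fin n → ℝ) (t : ℝ) :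
    Fin n → ℝ :=
  NormedSpace.exp (t • Sstar) *ᵥ χ

/-- Bounded on `[0, ∞)`. -/
def BoundedForward {n : ℕ} (f : ℝ → Fin n → ℝ) : Prop := ∃ B : ℝ, ∀ t ≥ 0, ‖f t‖ ≤ B

/-- Positions and velocities of any two agents approach each other. -/
def ReachesConsensus {N n p : ℕ} {D : Fin N → Design n p} (x : ℝ → ∀ i, (D i).State) : Prop :=
  ∀ i j, Tendsto (fun t => (x t i).q - (x t j).q) atTop (𝓝 0) ∧
    Tendsto (fun t => (x t i).v - (x t j).v) atTop (𝓝 0)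

end EulerLagrangeConsensus

end

/-! The closed loop is a cascade: the observers (S_i, η_i) are autonomous, and each agent is driven
only by its own observer.

Observers. A normalized left null vector u of the Laplacian annihilates the coupling, so ∑ u_i S_i
is conserved. The matrix L + 1uᵀ has its spectrum in the open right half-plane (Gershgorin and the
spanning tree), hence disagreement decays at a rate proportional to the gain
(`HasSpanningTree.exists_rate`). A maximum principle bounds the growth rate of η_i independently of
the gain (`IsTimeInterval.isBigO_of_coupled`). For large gains decay beats growth: in the frame
moving with e^{-tS*} the η_i solve a diffusion equation with exponentially small forcing, so they
converge to a common χ*, fast enough that η_i - e^{S*t}χ* decays as well (`IsObserver.converges`).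

One agent. The Sylvester equation (`exists_sylvester`) puts the exosystem into the coordinates of
the internal model: θ' = Mθ + Nd and d = Bθ, where B = ΨT⁻¹ and A - B = ∑ ϱ_j E_j. The regression
matrix P is chosen so that ε = ξ + θ - N M(q)s - ζΘ solves ε' = Mε with M Hurwitz. The blocks of ρ
are chosen so that, with ω* = (Θ, -ϱ⊗Θ, ϱ), which treats products of unknowns as further unknowns,
M(q)s' = -Cs - Ks - ρ(ω̂ - ω*) + Bε (`IsAgentSolution.deriv_slide_eq`). The energy ½ s·M(q)s + ½ (ω̂
- ω*)·Λ(ω̂ - ω*), corrected by an exponential for Bε, decreases (`IsAgentSolution.exists_lyapunov`).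
Thus s and ω̂ are bounded before anything is known about the other signals, and q - η is the output
of a stable filter driven by s and the coupling term.

Conclusion. On a bounded interval these estimates bound the entire state, so no solution escapes in
finite time and the locally Lipschitz closed loop has global solutions (`exists_isSolution`). On [0,
∞), boundedness of S*e^{S*t}χ* bounds every argument of the regression matrices except q. Their
values are bounded either because q is (a) or by assumption (b). Then ζ, ξ and s' are bounded, a
Barbalat argument gives s → 0 (`IsAgentSolution.slide_tendsto`), hence q_i - η_i → 0 and q̇_i -
S_iη_i → 0, and the observers agree.

A design exists because Ṁ = C + Cᵀ turns Cs - Ṁs into -Cᵀs, which is linear in Θ through Y, and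
because all matrix units may serve as the E_j. -/

namespace EulerLagrangeConsensus

open Asymptotics Set

/-! ### Differential inequalities on a time interval -/

/-- A time interval starting at zero, bounded or not. -/
structure IsTimeInterval (J : Set ℝ) : Prop where
  convex : Convex ℝ J
  zero_mem : (0 : ℝ) ∈ J
  nonneg : ∀ t ∈ J, 0 ≤ t

theorem isTimeInterval_Ici : IsTimeInterval (Ici 0) :=
  ⟨convex_Ici 0, self_mem_Ici, fun _ h => h⟩

theorem isTimeInterval_Ico {T : ℝ} (hT : 0 < T) : IsTimeInterval (Ico 0 T) :=
  ⟨convex_Ico 0 T, ⟨le_rfl, hT⟩, fun _ h => h.1⟩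

theorem IsTimeInterval.antitoneOn {J : Set ℝ} (hJ : IsTimeInterval J) {f f' : ℝ → ℝ}
    (hf : ∀ t ∈ J, HasDerivWithinAt f (f' t) J t) (hf' : ∀ t ∈ J, f' t ≤ 0) : AntitoneOn f J :=
  antitoneOn_of_hasDerivWithinAt_nonpos hJ.convex
    (fun t ht => (hf t ht).continuousWithinAt)
    (fun t ht => (hf t (interior_subset ht)).mono interior_subset)
    (fun t ht => hf' t (interior_subset ht))

theorem IsTimeInterval.le_of_deriv_nonpos {J : Set ℝ} (hJ : IsTimeInterval J) {f f' : ℝ → ℝ}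
    (hf : ∀ t ∈ J, HasDerivWithinAt f (f' t) J t) (hf' : ∀ t ∈ J, f' t ≤ 0) :
    ∀ t ∈ J, f t ≤ f 0 :=
  fun t ht => hJ.antitoneOn hf hf' hJ.zero_mem ht (hJ.nonneg t ht)

theorem hasDerivAt_exp_mul (b t : ℝ) :
    HasDerivAt (fun t => Real.exp (b * t)) (b * Real.exp (b * t)) t := by
  simpa [mul_comm] using ((hasDerivAt_id t).const_mul b).exp

/-- Linear differential inequality `f' ≤ b f`. -/
theorem IsTimeInterval.le_exp_mul {J : Set ℝ} (hJ : IsTimeInterval J) {f f' : ℝ → ℝ} {b : ℝ}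
    (hf : ∀ t ∈ J, HasDerivWithinAt f (f' t) J t) (hf' : ∀ t ∈ J, f' t ≤ b * f t) :
    ∀ t ∈ J, f t ≤ Real.exp (b * t) * f 0 := by
  intro t ht
  have h := hJ.le_of_deriv_nonpos (f := fun t => Real.exp (-b * t) * f t)
    (fun t ht => ((hasDerivAt_exp_mul (-b) t).hasDerivWithinAt.mul (hf t ht)))
    (fun t ht => by
      have := hf' t ht
      have := Real.exp_pos (-b * t)
      nlinarith) t ht
  simp only [mul_zero, Real.exp_zero, one_mul] at h
  have h2 : Real.exp (b * t) * Real.exp (-b * t) = 1 := by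
    rw [← Real.exp_add]; simp
  calc f t = Real.exp (b * t) * (Real.exp (-b * t) * f t) := by rw [← mul_assoc, h2, one_mul]
    _ ≤ _ := by gcongr

/-- Linear differential inequality `f' ≤ -γ f + c`. -/
theorem IsTimeInterval.le_add_of_deriv_le {J : Set ℝ} (hJ : IsTimeInterval J) {f f' : ℝ → ℝ}
    {γ c : ℝ} (hγ : 0 < γ)
    (hf : ∀ t ∈ J, HasDerivWithinAt f (f' t) J t) (hf' : ∀ t ∈ J, f' t ≤ -γ * f t + c) :
    ∀ t ∈ J, f t ≤ c / γ + Real.exp (-γ * t) * (f 0 - c / γ) := by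
  intro t ht
  have := hJ.le_exp_mul (f := fun t => f t - c / γ) (b := -γ)
    (fun t ht => (hf t ht).sub_const (c / γ))
    (fun t ht => by
      have := hf' t ht
      have h : -γ * (f t - c / γ) = -γ * f t + c := by field_simp; ring
      linarith) t ht
  linarith

/-- With the principal filter of `J`, `=O` is a uniform bound on all of `J` rather than an
asymptotic one. The same calculus then serves bounded intervals, where finite escape must be
excluded, and the half-line. -/
theorem isBigO_exp_iff {E : Type*} [NormedAddCommGroup E] {J : Set ℝ} {f : ℝ → E} {b : ℝ} :
    f =O[𝓟 J] (fun t => Real.exp (b * t)) ↔ ∃ C, 0 ≤ C ∧ ∀ t ∈ J, ‖f t‖ ≤ C * Real.exp (b * t) := by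
  rw [isBigO_principal]
  constructor
  · rintro ⟨c, hc⟩
    refine ⟨max c 0, le_max_right _ _, fun t ht => (hc t ht).trans ?_⟩
    rw [Real.norm_eq_abs, Real.abs_exp]
    gcongr
    exact le_max_left _ _
  · rintro ⟨C, -, hC⟩
    exact ⟨C, fun t ht => by simpa using hC t ht⟩

theorem isBigO_one_iff_bound {E : Type*} [NormedAddCommGroup E] {J : Set ℝ} {f : ℝ → E} :
    f =O[𝓟 J] (fun _ => (1 : ℝ)) ↔ ∃ C, 0 ≤ C ∧ ∀ t ∈ J, ‖f t‖ ≤ C := by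
  simpa using isBigO_exp_iff (f := f) (J := J) (b := 0)

theorem IsTimeInterval.exp_isBigO_exp {J : Set ℝ} (hJ : IsTimeInterval J) {b c : ℝ} (h : b ≤ c) :
    (fun t => Real.exp (b * t)) =O[𝓟 J] (fun t => Real.exp (c * t)) := by
  refine isBigO_exp_iff.2 ⟨1, zero_le_one, fun t ht => ?_⟩
  rw [Real.norm_eq_abs, Real.abs_exp, one_mul]
  exact Real.exp_le_exp.2 (mul_le_mul_of_nonneg_right h (hJ.nonneg t ht))

theorem hasDerivWithinAt_normSq {y : ℝ → ℂ} {y' : ℂ} {J : Set ℝ} {t : ℝ}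
    (hy : HasDerivWithinAt y y' J t) :
    HasDerivWithinAt (fun t => Complex.normSq (y t))
      (2 * ((y t).re * y'.re + (y t).im * y'.im)) J t := by
  have hre : HasDerivWithinAt (fun t => (y t).re) y'.re J t :=
    Complex.reCLM.hasFDerivAt.comp_hasDerivWithinAt t hy
  have him : HasDerivWithinAt (fun t => (y t).im) y'.im J t :=
    Complex.imCLM.hasFDerivAt.comp_hasDerivWithinAt t hy
  simp only [Complex.normSq_apply]
  exact ((hre.mul hre).add (him.mul him)).congr_deriv (by ring)

/-- A stable scalar equation `y' = z y + h` inherits the decay rate of its input. -/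
theorem IsTimeInterval.isBigO_of_scalar {J : Set ℝ} (hJ : IsTimeInterval J) {y h : ℝ → ℂ} {z : ℂ}
    {b : ℝ} (hz : z.re < b) (hy : ∀ t ∈ J, HasDerivWithinAt y (z * y t + h t) J t)
    (hh : h =O[𝓟 J] fun t => Real.exp (b * t)) : y =O[𝓟 J] fun t => Real.exp (b * t) := by
  obtain ⟨H, hH0, hH⟩ := isBigO_exp_iff.1 hh
  set γ := b - z.re with hγ
  have hγ0 : 0 < γ := sub_pos.2 hz
  -- The weight e^{-2bt} reduces the claim to boundedness of e^{-2bt}|y|². Its damping rate is 2γ;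
  -- Young's inequality spends one γ on the input and leaves the constant H²/γ.
  have key := hJ.le_add_of_deriv_le hγ0 (c := H ^ 2 / γ)
    (f := fun t => Real.exp ((-2 * b) * t) * Complex.normSq (y t))
    (fun t ht => (hasDerivAt_exp_mul (-2 * b) t).hasDerivWithinAt.mul
      (hasDerivWithinAt_normSq (hy t ht)))
    (fun t ht => by
      set E := Real.exp ((-2 * b) * t) with hE
      have hE0 : 0 < E := Real.exp_pos _
      have h1 : (y t).re * (z * y t + h t).re + (y t).im * (z * y t + h t).im =
          z.re * Complex.normSq (y t) + ((y t).re * (h t).re + (y t).im * (h t).im) := by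
        simp [Complex.normSq_apply]; ring
      have h2 : (y t).re * (h t).re + (y t).im * (h t).im ≤ ‖y t‖ * ‖h t‖ := by
        have := Complex.abs_re_le_norm (y t * (starRingEnd ℂ) (h t))
        rw [norm_mul, Complex.norm_conj] at this
        have h3 := (le_abs_self _).trans this
        simpa using h3
      have h3 : Complex.normSq (y t) = ‖y t‖ ^ 2 := Complex.normSq_eq_norm_sq _
      have h4 := hH t ht
      set F := Real.exp (b * t) with hF
      have hEF : E * F * F = 1 := by
        rw [hE, hF, ← Real.exp_add, ← Real.exp_add]; ring_nf; simp
      have hF0 : 0 < F := Real.exp_pos _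
      rw [h1, h3]
      have h5 : ‖y t‖ * ‖h t‖ ≤ ‖y t‖ * (H * F) := by gcongr
      have h6 : 2 * ‖y t‖ * (H * F) ≤ γ * ‖y t‖ ^ 2 + H ^ 2 / γ * F ^ 2 := by
        have : 0 ≤ (γ * ‖y t‖ - H * F) ^ 2 / γ := by positivity
        have e : (γ * ‖y t‖ - H * F) ^ 2 / γ =
          γ * ‖y t‖ ^ 2 + H ^ 2 / γ * F ^ 2 - 2 * ‖y t‖ * (H * F) := by field_simp; ring
        linarith
      have h7 : E * (2 * (‖y t‖ * ‖h t‖)) ≤ E * (γ * ‖y t‖ ^ 2 + H ^ 2 / γ * F ^ 2) := by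
        gcongr; linarith
      have h8 : E * (H ^ 2 / γ * F ^ 2) = H ^ 2 / γ := by
        calc _ = H ^ 2 / γ * (E * F * F) := by ring
          _ = _ := by rw [hEF, mul_one]
      have h9 : E * (2 * ((y t).re * (h t).re + (y t).im * (h t).im)) ≤
        E * (2 * (‖y t‖ * ‖h t‖)) := by gcongr
      rw [hγ] at h7 h8 ⊢
      nlinarith)
  set K := Complex.normSq (y 0) + H ^ 2 / γ / γ with hK
  have hK0 : 0 ≤ K := add_nonneg (Complex.normSq_nonneg _) (by positivity)
  refine isBigO_exp_iff.2 ⟨√K, Real.sqrt_nonneg _, fun t ht => ?_⟩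
  have h1 := key t ht
  have h2 : Real.exp (-γ * t) ≤ 1 := Real.exp_le_one_iff.2 (by nlinarith [hJ.nonneg t ht])
  have h3 : Real.exp ((-2 * b) * t) * Complex.normSq (y t) ≤ K := by
    simp only [mul_zero, Real.exp_zero, one_mul] at h1
    have : 0 ≤ H ^ 2 / γ / γ := by positivity
    have := Complex.normSq_nonneg (y 0)
    have := Real.exp_pos (-γ * t)
    nlinarith
  have h4 : Complex.normSq (y t) ≤ (√K * Real.exp (b * t)) ^ 2 := by
    rw [mul_pow, Real.sq_sqrt hK0, ← Real.exp_nat_mul]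
    have e : Real.exp ((-2 * b) * t) * Real.exp ((2 : ℕ) * (b * t)) = 1 := by
      rw [← Real.exp_add]; push_cast; ring_nf; simp
    calc Complex.normSq (y t) =
        (Real.exp ((-2 * b) * t) * Complex.normSq (y t)) * Real.exp ((2 : ℕ) * (b * t)) := by
          rw [mul_right_comm, e, one_mul]
      _ ≤ _ := by gcongr
  rw [Complex.normSq_eq_norm_sq] at h4
  exact (sq_le_sq₀ (norm_nonneg _) (by positivity)).1 h4

/-! ### Calculus of matrices depending on time -/

section MatrixCalculus

variable {ι κ 𝕜 : Type*} [Fintype κ] [RCLike 𝕜] {J : Set ℝ} {t : ℝ}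

theorem hasDerivWithinAt_mulVec [Fintype ι] {A : ℝ → Matrix ι κ 𝕜} {A' : Matrix ι κ 𝕜} {x : ℝ → κ → 𝕜}
    {x' : κ → 𝕜} (hA : ∀ i j, HasDerivWithinAt (fun t => A t i j) (A' i j) J t)
    (hx : HasDerivWithinAt x x' J t) :
    HasDerivWithinAt (fun t => A t *ᵥ x t) (A' *ᵥ x t + A t *ᵥ x') J t := by
  rw [hasDerivWithinAt_pi] at hx ⊢
  intro i
  simp only [Matrix.mulVec, dotProduct, Pi.add_apply, ← Finset.sum_add_distrib]
  exact HasDerivWithinAt.fun_sum fun j _ => (hA i j).mul (hx j)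

theorem hasDerivWithinAt_const_mulVec [Fintype ι] (A : Matrix ι κ 𝕜) {x : ℝ → κ → 𝕜}
    {x' : κ → 𝕜} (hx : HasDerivWithinAt x x' J t) :
    HasDerivWithinAt (fun t => A *ᵥ x t) (A *ᵥ x') J t := by
  have := hasDerivWithinAt_mulVec (A := fun _ => A) (A' := 0)
    (fun i j => by simpa using hasDerivWithinAt_const t J (A i j)) hx
  simpa using this

theorem hasDerivWithinAt_dotProduct {x y : ℝ → κ → 𝕜} {x' y' : κ → 𝕜}
    (hx : HasDerivWithinAt x x' J t) (hy : HasDerivWithinAt y y' J t) :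
    HasDerivWithinAt (fun t => x t ⬝ᵥ y t) (x' ⬝ᵥ y t + x t ⬝ᵥ y') J t := by
  rw [hasDerivWithinAt_pi] at hx hy
  simp only [dotProduct, ← Finset.sum_add_distrib]
  exact HasDerivWithinAt.fun_sum fun j _ => (hx j).mul (hy j)

theorem isBigO_mulVec [Fintype ι] {l : Filter ℝ} {A : ℝ → Matrix ι κ 𝕜} {x : ℝ → κ → 𝕜} {f g : ℝ → ℝ}
    (hA : ∀ i j, (fun t => A t i j) =O[l] f) (hx : x =O[l] g) :
    (fun t => A t *ᵥ x t) =O[l] fun t => f t * g t := by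
  rw [isBigO_pi] at hx ⊢
  intro i
  simp only [Matrix.mulVec, dotProduct]
  exact IsBigO.fun_sum fun j _ => (hA i j).mul (hx j)

theorem isBigO_const_mulVec [Fintype ι] {l : Filter ℝ} (A : Matrix ι κ 𝕜) {x : ℝ → κ → 𝕜} {g : ℝ → ℝ}
    (hx : x =O[l] g) : (fun t => A *ᵥ x t) =O[l] g := by
  have := isBigO_mulVec (A := fun _ => A) (f := fun _ => (1 : ℝ))
    (fun i j => isBigO_const_const _ one_ne_zero l) hx
  simpa using this

end MatrixCalculus

/-! ### Linear systems with stable matrices -/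

section Stable

variable {ι : Type*} [Fintype ι] [DecidableEq ι] {J : Set ℝ} {b : ℝ}

/-- This replaces the Jordan form by induction on linear factors. Since A commutes with A - z, the
vector (A - z)x solves an equation of the same kind with input (A - z)g, and one factor fewer is
left. Once (A - z)x is estimated, x' = zx + ((A - z)x + g) splits into scalar equations. -/
theorem IsTimeInterval.isBigO_of_prod_mulVec (hJ : IsTimeInterval J) (A : Matrix ι ι ℂ)
    (s : Multiset ℂ) (hs : ∀ z ∈ s, z.re < b) {x g : ℝ → ι → ℂ}
    (hx : ∀ t ∈ J, HasDerivWithinAt x (A *ᵥ x t + g t) J t)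
    (hg : g =O[𝓟 J] fun t => Real.exp (b * t))
    (h0 : (fun t => Polynomial.aeval A (s.map fun z => Polynomial.X - Polynomial.C z).prod *ᵥ x t)
      =O[𝓟 J] fun t => Real.exp (b * t)) :
    x =O[𝓟 J] fun t => Real.exp (b * t) := by
  induction s using Multiset.induction generalizing x g with
  | empty => simpa using h0
  | cons z s ih =>
    have hy : (fun t => (A - Matrix.scalar ι z) *ᵥ x t) =O[𝓟 J] fun t => Real.exp (b * t) := by
      refine ih (fun w hw => hs w (Multiset.mem_cons_of_mem hw))
        (g := fun t => (A - Matrix.scalar ι z) *ᵥ g t) (fun t ht => ?_)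
        (isBigO_const_mulVec _ hg) ?_
      · convert hasDerivWithinAt_const_mulVec (A - Matrix.scalar ι z) (hx t ht) using 1
        rw [Matrix.mulVec_add, Matrix.mulVec_mulVec, Matrix.mulVec_mulVec, Matrix.mul_sub,
          Matrix.sub_mul, (Matrix.scalar_commute z (fun _ => mul_comm _ _) A).eq]
      · convert h0 using 2 with t
        rw [Matrix.mulVec_mulVec, Multiset.map_cons, Multiset.prod_cons, mul_comm, map_mul]
        simp [Algebra.algebraMap_eq_smul_one, Matrix.smul_one_eq_diagonal]
    have hsum := hy.add hg
    rw [isBigO_pi] at hsum ⊢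
    intro i
    refine hJ.isBigO_of_scalar (hs z (Multiset.mem_cons_self z s)) (fun t ht => ?_) (hsum i)
    exact (hasDerivWithinAt_pi.1 (hx t ht) i).congr_deriv (by simp [Matrix.sub_mulVec]; ring)

/-- A linear system `x' = A x + g` inherits the decay rate of its input if the spectrum of `A`
lies to the left of that rate. -/
theorem IsTimeInterval.isBigO_of_spectrum_complex (hJ : IsTimeInterval J) (A : Matrix ι ι ℂ)
    (hA : ∀ z ∈ spectrum ℂ A, z.re < b) {x g : ℝ → ι → ℂ}
    (hx : ∀ t ∈ J, HasDerivWithinAt x (A *ᵥ x t + g t) J t)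
    (hg : g =O[𝓟 J] fun t => Real.exp (b * t)) :
    x =O[𝓟 J] fun t => Real.exp (b * t) := by
  -- By Cayley–Hamilton the product over all roots of the characteristic polynomial annihilates x,
  -- which starts the induction.
  refine hJ.isBigO_of_prod_mulVec A A.charpoly.roots (fun z hz => hA z ?_) hx hg ?_
  · exact Matrix.mem_spectrum_of_isRoot_charpoly (Polynomial.isRoot_of_mem_roots hz)
  · rw [← (IsAlgClosed.splits A.charpoly).eq_prod_roots_of_monic A.charpoly_monic,
      Matrix.aeval_self_charpoly]
    simp only [Matrix.zero_mulVec]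
    exact isBigO_zero _ _

theorem IsTimeInterval.isBigO_of_spectrum (hJ : IsTimeInterval J) (A : Matrix ι ι ℝ)
    (hA : ∀ z ∈ spectrum ℂ (A.map (algebraMap ℝ ℂ)), z.re < b) {x g : ℝ → ι → ℝ}
    (hx : ∀ t ∈ J, HasDerivWithinAt x (A *ᵥ x t + g t) J t)
    (hg : g =O[𝓟 J] fun t => Real.exp (b * t)) :
    x =O[𝓟 J] fun t => Real.exp (b * t) := by
  have hof : ∀ {y : ℝ → ι → ℝ}, (fun t i => ((y t i : ℝ) : ℂ)) =O[𝓟 J] (fun t => Real.exp (b * t))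
      ↔ y =O[𝓟 J] fun t => Real.exp (b * t) := by
    intro y
    simp only [isBigO_pi]
    refine forall_congr' fun i => ?_
    rw [← isBigO_norm_left, ← isBigO_norm_left (f' := fun t => y t i)]
    simp
  refine hof.1 (hJ.isBigO_of_spectrum_complex _ hA
    (g := fun t i => ((g t i : ℝ) : ℂ)) (fun t ht => ?_) (hof.2 hg))
  have h := hasDerivWithinAt_pi.1 (hx t ht)
  refine hasDerivWithinAt_pi.2 fun i => ?_
  exact (h i).ofReal_comp.congr_deriv (by simp [Matrix.mulVec, dotProduct])

/-- The finitely many eigenvalues of a matrix leave a gap to a line on their right. -/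
theorem eventually_gap_of_spectrum (A : Matrix ι ι ℂ) {c : ℝ}
    (hA : ∀ z ∈ spectrum ℂ A, z.re < c) :
    ∀ᶠ l in 𝓝[>] (0 : ℝ), ∀ z ∈ spectrum ℂ A, z.re < c - l := by
  rw [A.finite_spectrum.eventually_all]
  intro z hz
  have : ∀ᶠ l in 𝓝 (0 : ℝ), l < c - z.re := Iio_mem_nhds (sub_pos.2 (hA z hz))
  filter_upwards [nhdsWithin_le_nhds this] with l hl
  linarith

theorem exists_gap_of_spectrum (A : Matrix ι ι ℂ) {c : ℝ} (hA : ∀ z ∈ spectrum ℂ A, z.re < c) :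
    ∃ l > 0, ∀ z ∈ spectrum ℂ A, z.re < c - l := by
  obtain ⟨l, hl, hl0⟩ := ((eventually_gap_of_spectrum A hA).and self_mem_nhdsWithin).exists
  exact ⟨l, hl0, hl⟩

theorem exists_eigenvector_of_mem_spectrum {K : Type*} [Field K] {A : Matrix ι ι K} {z : K}
    (hz : z ∈ spectrum K A) : ∃ v ≠ 0, A *ᵥ v = z • v := by
  rw [Matrix.mem_spectrum_iff_isRoot_charpoly, Polynomial.IsRoot, Matrix.eval_charpoly] at hz
  obtain ⟨v, hv, h⟩ := Matrix.exists_mulVec_eq_zero_iff.2 hz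
  refine ⟨v, hv, ?_⟩
  rw [Matrix.sub_mulVec, sub_eq_zero] at h
  rw [← h]
  ext i; simp

theorem mem_spectrum_of_mulVec_eq {K : Type*} [Field K] {A : Matrix ι ι K} {z : K} {v : ι → K}
    (hv : v ≠ 0) (h : A *ᵥ v = z • v) : z ∈ spectrum K A := by
  rw [Matrix.mem_spectrum_iff_isRoot_charpoly, Polynomial.IsRoot, Matrix.eval_charpoly]
  refine Matrix.exists_mulVec_eq_zero_iff.1 ⟨v, hv, ?_⟩
  rw [Matrix.sub_mulVec, h, sub_eq_zero]
  ext i; simp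

end Stable

/-! ### Convergence -/

section Convergence

/-- A stable scalar equation with vanishing input. -/
theorem tendsto_zero_of_deriv_eq {y h : ℝ → ℝ} {α : ℝ} (hα : 0 < α)
    (hy : ∀ t ∈ Ici (0 : ℝ), HasDerivWithinAt y (-α * y t + h t) (Ici 0) t)
    (hh : Tendsto h atTop (𝓝 0)) : Tendsto y atTop (𝓝 0) := by
  -- An eventual upper bound suffices, because -y solves the same equation with input -h.
  have aux : ∀ (y h : ℝ → ℝ),
      (∀ t ∈ Ici (0 : ℝ), HasDerivWithinAt y (-α * y t + h t) (Ici 0) t) →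
      Tendsto h atTop (𝓝 0) → ∀ ε > 0, ∀ᶠ t in atTop, y t < ε := by
    intro y h hy hh ε hε
    obtain ⟨T, hT⟩ := eventually_atTop.1
      ((hh.eventually (gt_mem_nhds (show (0 : ℝ) < α * (ε / 2) by positivity))))
    set S := max T 0
    have hS0 : 0 ≤ S := le_max_right _ _
    -- Time is shifted to the moment S after which h < αε/2; the stationary level of the inequality
    -- is then ε/2.
    have key := isTimeInterval_Ici.le_add_of_deriv_le hα (c := α * (ε / 2))
      (f := fun t => y (S + t)) (f' := fun t => -α * y (S + t) + h (S + t))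
      (fun t ht => by
        have h1 := hy (S + t) (add_nonneg hS0 ht)
        have h2 : HasDerivWithinAt (fun t => S + t) 1 (Ici 0) t :=
          ((hasDerivAt_id t).const_add S).hasDerivWithinAt
        exact (h1.scomp t h2 (fun u hu => add_nonneg hS0 hu)).congr_deriv (by simp))
      (fun t ht => by
        have := (hT (S + t) (by have := le_max_left T 0; have : 0 ≤ t := ht; linarith)).le
        linarith)
    have hlim : Tendsto (fun t => ε / 2 + Real.exp (-α * t) * (y S - ε / 2)) atTop
        (𝓝 (ε / 2 + 0 * (y S - ε / 2))) := by
      refine tendsto_const_nhds.add (Tendsto.mul_const _ ?_)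
      refine Real.tendsto_exp_atBot.comp ?_
      exact tendsto_id.const_mul_atTop_of_neg (neg_lt_zero.2 hα)
    have h3 := hlim.eventually (gt_mem_nhds (show ε / 2 + 0 * (y S - ε / 2) < ε by linarith))
    have h4 : ∀ᶠ t in atTop, y (S + t) < ε := by
      filter_upwards [h3, eventually_ge_atTop 0] with t ht ht0
      have := key t ht0
      rw [mul_div_cancel_left₀ _ hα.ne', add_zero] at this
      linarith
    have h5 := (tendsto_atTop_add_const_left atTop (-S) tendsto_id).eventually h4
    filter_upwards [h5] with t ht
    simpa using ht
  rw [Metric.tendsto_nhds]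
  intro ε hε
  filter_upwards [aux y h hy hh ε hε, aux (fun t => -y t) (fun t => -h t)
    (fun t ht => (hy t ht).neg.congr_deriv (by ring)) (by simpa using hh.neg) ε hε] with t h1 h2
  rw [Real.dist_eq, sub_zero, abs_lt]
  constructor <;> linarith

/-- Barbalat's lemma in the form needed for Lyapunov functions. -/
theorem tendsto_zero_of_lyapunov {W f W' f' : ℝ → ℝ} {k B : ℝ} (hk : 0 < k)
    (hW : ∀ t ∈ Ici (0 : ℝ), HasDerivWithinAt W (W' t) (Ici 0) t)
    (hW' : ∀ t ∈ Ici (0 : ℝ), W' t ≤ -k * f t) (hW0 : ∀ t ∈ Ici (0 : ℝ), 0 ≤ W t)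
    (hf0 : ∀ t ∈ Ici (0 : ℝ), 0 ≤ f t)
    (hf : ∀ t ∈ Ici (0 : ℝ), HasDerivWithinAt f (f' t) (Ici 0) t)
    (hf' : ∀ t ∈ Ici (0 : ℝ), f' t ≤ B) : Tendsto f atTop (𝓝 0) := by
  have hanti : AntitoneOn W (Ici 0) := isTimeInterval_Ici.antitoneOn hW fun t ht => by
    have := hW' t ht
    have := hf0 t ht
    nlinarith
  -- `W` drops by a fixed amount before every time at which `f` is not small
  have drop : ∀ ε > 0, ∃ δ > 0, ∃ c > 0, ∀ t ≥ δ, ε ≤ f t → W t ≤ W (t - δ) - c := by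
    intro ε hε
    -- A slope of at most B' lets f rise by at most ε/2 within δ = ε/(2B'). So if f t ≥ ε, then f ≥
    -- ε/2 on the whole window before t, and W loses k(ε/2)δ there. Looking backwards makes a
    -- one-sided bound on `f'` sufficient; the maximum with 1 keeps δ well defined.
    set B' := max B 1
    have hB' : 0 < B' := lt_of_lt_of_le one_pos (le_max_right _ _)
    refine ⟨ε / (2 * B'), by positivity, k * (ε / 2) * (ε / (2 * B')), by positivity, ?_⟩
    intro t ht hft
    set δ := ε / (2 * B') with hδ
    have hδ0 : 0 < δ := by positivity
    have hsub : Icc (t - δ) t ⊆ Ici 0 := fun u hu => by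
      have := hu.1; simp only [mem_Ici]; linarith
    have hlow : ∀ u ∈ Icc (t - δ) t, ε / 2 ≤ f u := by
      intro u hu
      have hsub' : Icc u t ⊆ Ici 0 := fun v hv => (hsub hu).out.trans hv.1
      have h1 : AntitoneOn (fun v => f v - B' * v) (Icc u t) :=
        antitoneOn_of_hasDerivWithinAt_nonpos (convex_Icc u t)
          (f' := fun v => f' v - B')
          (fun v hv => (((hf v (hsub' hv)).continuousWithinAt).mono hsub').sub
            (by fun_prop))
          (fun v hv => by
            exact (((hf v (hsub' (interior_subset hv))).mono
              (interior_subset.trans hsub')).sub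
              ((hasDerivAt_id v).const_mul B').hasDerivWithinAt).congr_deriv (by simp))
          (fun v hv => by
            have := hf' v (hsub' (interior_subset hv))
            have := le_max_left B 1
            linarith)
      have h2 := h1 (left_mem_Icc.2 hu.2) (right_mem_Icc.2 hu.2) hu.2
      simp only at h2
      have h3 : B' * (t - u) ≤ B' * δ := by
        have := hu.1
        gcongr; linarith
      have h4 : B' * δ = ε / 2 := by rw [hδ]; field_simp
      nlinarith
    have h1 : AntitoneOn (fun v => W v + k * (ε / 2) * v) (Icc (t - δ) t) :=
      antitoneOn_of_hasDerivWithinAt_nonpos (convex_Icc _ t)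
        (f' := fun v => W' v + k * (ε / 2))
        (fun v hv => (((hW v (hsub hv)).continuousWithinAt).mono hsub).add
          (by fun_prop))
        (fun v hv => by
          exact (((hW v (hsub (interior_subset hv))).mono
            (interior_subset.trans hsub)).add
            ((hasDerivAt_id v).const_mul (k * (ε / 2))).hasDerivWithinAt).congr_deriv (by simp))
        (fun v hv => by
          have h5 := hW' v (hsub (interior_subset hv))
          have h6 := hlow v (interior_subset hv)
          have : k * (ε / 2) ≤ k * f v := by gcongr
          linarith)
    have h2 := h1 (left_mem_Icc.2 (by linarith)) (right_mem_Icc.2 (by linarith)) (by linarith)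
    simp only at h2
    linarith
  obtain ⟨w, hw⟩ : ∃ w, Tendsto W atTop (𝓝 w) := by
    have hmono : Antitone (fun t => W (max t 0)) := fun a b hab =>
      hanti (mem_Ici.2 (le_max_right _ _)) (mem_Ici.2 (le_max_right _ _)) (max_le_max_right 0 hab)
    have hbdd : BddBelow (range fun t => W (max t 0)) :=
      ⟨0, by rintro _ ⟨t, rfl⟩; exact hW0 _ (mem_Ici.2 (le_max_right t 0))⟩
    refine ⟨_, (tendsto_atTop_ciInf hmono hbdd).congr' ?_⟩
    filter_upwards [eventually_ge_atTop 0] with t ht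
    simp only [max_eq_left ht]
  rw [Metric.tendsto_nhds]
  intro ε hε
  obtain ⟨δ, hδ, c, hc, hdrop⟩ := drop ε hε
  -- W is nonincreasing and bounded below, so its losses over windows of length δ tend to zero and
  -- eventually fall below the fixed amount c.
  have hlim : Tendsto (fun t => W (t - δ) - W t) atTop (𝓝 (w - w)) :=
    (hw.comp (tendsto_atTop_add_const_right atTop (-δ) tendsto_id)).sub hw
  rw [sub_self] at hlim
  filter_upwards [hlim.eventually (gt_mem_nhds hc), eventually_ge_atTop δ] with t h1 h2
  have h0 := hf0 t (mem_Ici.2 (hδ.le.trans h2))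
  rw [Real.dist_eq, sub_zero, abs_of_nonneg h0]
  by_contra h3
  have := hdrop t h2 (not_lt.1 h3)
  linarith

end Convergence

/-! ### The Laplacian of a digraph with a spanning tree -/

section Laplacian

variable {N : ℕ} {a : Matrix (Fin N) (Fin N) ℝ}

theorem laplacian_mulVec_apply (a : Matrix (Fin N) (Fin N) ℝ) (x : Fin N → ℝ) (i : Fin N) :
    (laplacian a *ᵥ x) i = ∑ j, a i j * (x i - x j) := by
  rw [laplacian, Matrix.sub_mulVec, Pi.sub_apply, Matrix.mulVec_diagonal, Matrix.mulVec, dotProduct,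
    Finset.sum_mul, ← Finset.sum_sub_distrib]
  exact Finset.sum_congr rfl fun j _ => by ring

/-- At a maximizer k all terms a_kl (z_k - z_l) are nonnegative while their sum is not positive, so
every in-neighbour of k is a maximizer too. Following a path from the root to a maximizer backwards,
the root is one. -/
theorem HasSpanningTree.le_of_laplacian_mulVec_nonneg (ha : ∀ i j, 0 ≤ a i j) {r : Fin N}
    (hr : ∀ i, Relation.ReflTransGen (fun j k => 0 < a k j) r i) {z : Fin N → ℝ}
    (hz : ∀ i, (laplacian a *ᵥ z) i ≤ 0) : ∀ i, z i ≤ z r := by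
  have : Nonempty (Fin N) := ⟨r⟩
  obtain ⟨m, hm⟩ := Finite.exists_max z
  suffices h : ∀ i, Relation.ReflTransGen (fun j k => 0 < a k j) i m → z i = z m from
    fun i => (hm i).trans_eq (h r (hr m)).symm
  intro i hi
  induction hi using Relation.ReflTransGen.head_induction_on with
  | refl => rfl
  | @head j k hjk _ ih =>
    refine le_antisymm (hm j) ?_
    have h1 := hz k
    rw [laplacian_mulVec_apply] at h1
    have h2 : a k j * (z k - z j) ≤ ∑ l, a k l * (z k - z l) :=
      Finset.single_le_sum (f := fun l => a k l * (z k - z l))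
        (fun l _ => mul_nonneg (ha k l) (by rw [ih]; exact sub_nonneg.2 (hm l)))
        (Finset.mem_univ j)
    rw [ih] at h1 h2
    nlinarith

/-- Only constant vectors are mapped to constant vectors by the Laplacian. -/
theorem HasSpanningTree.const_of_laplacian_mulVec (ha : ∀ i j, 0 ≤ a i j) {r : Fin N}
    (hr : ∀ i, Relation.ReflTransGen (fun j k => 0 < a k j) r i) {z : Fin N → ℝ} {c : ℝ}
    (hz : laplacian a *ᵥ z = fun _ => c) : c = 0 ∧ ∀ i, z i = z r := by
  have : Nonempty (Fin N) := ⟨r⟩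
  -- The row of a minimizer gives `c ≤ 0`, the row of a maximizer `0 ≤ c`.
  have hc : c = 0 := by
    obtain ⟨m, hm⟩ := Finite.exists_max z
    obtain ⟨m', hm'⟩ := Finite.exists_min z
    refine le_antisymm ?_ ?_
    · rw [← congrFun hz m', laplacian_mulVec_apply]
      exact Finset.sum_nonpos fun j _ =>
        mul_nonpos_of_nonneg_of_nonpos (ha _ j) (sub_nonpos.2 (hm' j))
    · rw [← congrFun hz m, laplacian_mulVec_apply]
      exact Finset.sum_nonneg fun j _ => mul_nonneg (ha _ j) (sub_nonneg.2 (hm j))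
  refine ⟨hc, fun i => le_antisymm ?_ ?_⟩
  · exact HasSpanningTree.le_of_laplacian_mulVec_nonneg ha hr (by simp [hz, hc]) i
  · have := HasSpanningTree.le_of_laplacian_mulVec_nonneg ha hr (z := -z)
      (by simp [Matrix.mulVec_neg, hz, hc]) i
    simpa using this

/-- The left null vector of the Laplacian, normalized to sum one, exists and is unique. -/
theorem HasSpanningTree.existsUnique_leftNull (ha : ∀ i j, 0 ≤ a i j) (h : HasSpanningTree a) :
    ∃ u : Fin N → ℝ, (u ᵥ* laplacian a = 0 ∧ ∑ i, u i = 1) ∧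
      ∀ w : Fin N → ℝ, w ᵥ* laplacian a = 0 → ∑ i, w i = 1 → w = u := by
  obtain ⟨r, hr⟩ := h
  -- With e_r the unit row vector at the root, B = L + 1e_r. If Bz = 0, then Lz is the constant
  -- -z_r, so z_r = 0 and z is constant, hence zero. As B fixes the all-ones vector, the normalized
  -- left null vectors of L are the solutions of uB = e_r.
  set B := laplacian a + Matrix.vecMulVec (fun _ => 1) (Pi.single r 1) with hB
  have hBz : ∀ z, B *ᵥ z = laplacian a *ᵥ z + fun _ => z r := by
    intro z
    rw [hB, Matrix.add_mulVec, Matrix.vecMulVec_mulVec]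
    ext i; simp
  have hzB : ∀ w : Fin N → ℝ, w ᵥ* B = w ᵥ* laplacian a + (∑ i, w i) • Pi.single r 1 := by
    intro w
    rw [hB, Matrix.vecMul_add, Matrix.vecMul_vecMulVec]
    ext i; simp [dotProduct]
  have hdet : IsUnit B.det := by
    rw [isUnit_iff_ne_zero]
    intro h0
    obtain ⟨z, hz, h⟩ := Matrix.exists_mulVec_eq_zero_iff.2 h0
    rw [hBz, add_eq_zero_iff_eq_neg] at h
    obtain ⟨h1, h2⟩ := HasSpanningTree.const_of_laplacian_mulVec (c := -z r) ha hr h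
    exact hz (funext fun i => by rw [h2 i]; simpa using h1)
  have hinj : ∀ w w' : Fin N → ℝ, w ᵥ* B = w' ᵥ* B → w = w' := by
    intro w w' hw
    have := congrArg (· ᵥ* B⁻¹) hw
    simpa [Matrix.vecMul_vecMul, Matrix.mul_nonsing_inv _ hdet] using this
  set u := Pi.single r 1 ᵥ* B⁻¹ with hu
  have huB : u ᵥ* B = Pi.single r 1 := by
    rw [hu, Matrix.vecMul_vecMul, Matrix.nonsing_inv_mul _ hdet, Matrix.vecMul_one]
  have hsum : ∑ i, u i = 1 := by
    have h1 : u ᵥ* B ⬝ᵥ (fun _ => (1 : ℝ)) = 1 := by rw [huB]; simp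
    have h2 : B *ᵥ (fun _ => (1 : ℝ)) = fun _ => 1 := by
      rw [hBz]; ext i; simp [laplacian_mulVec_apply]
    rw [← Matrix.dotProduct_mulVec, h2] at h1
    simpa [dotProduct] using h1
  refine ⟨u, ⟨?_, hsum⟩, fun w hw hw1 => hinj _ _ ?_⟩
  · have := hzB u
    rw [huB, hsum, one_smul] at this
    simpa using this.symm
  · rw [huB, hzB, hw, hw1]; simp

/-- The Laplacian, made nonsingular by moving its zero eigenvalue to one. -/
theorem HasSpanningTree.re_pos_of_mem_spectrum (ha : ∀ i j, 0 ≤ a i j) (h : HasSpanningTree a)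
    {u : Fin N → ℝ} (hu : u ᵥ* laplacian a = 0) (hu1 : ∑ i, u i = 1) :
    ∀ z ∈ spectrum ℂ ((laplacian a + Matrix.vecMulVec (fun _ => 1) u).map (algebraMap ℝ ℂ)),
      0 < z.re := by
  intro z hz
  obtain ⟨v, hv, hvz⟩ := exists_eigenvector_of_mem_spectrum hz
  obtain ⟨r, hr⟩ := h
  set w := ∑ i, (u i : ℂ) * v i with hw
  have hsplit : ∀ i, ((laplacian a).map (algebraMap ℝ ℂ) *ᵥ v) i + w = z * v i := by
    intro i
    have := congrFun hvz i
    simp only [Pi.smul_apply, smul_eq_mul] at this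
    rw [← this, hw]
    simp [Matrix.mulVec, dotProduct, Matrix.vecMulVec, add_mul, Finset.sum_add_distrib]
  have hleft : ∑ i, (u i : ℂ) * ((laplacian a).map (algebraMap ℝ ℂ) *ᵥ v) i = 0 := by
    have h0 : ∀ j, ∑ i, (u i : ℂ) * (laplacian a i j : ℂ) = 0 := by
      intro j
      have := congrFun hu j
      simp only [Matrix.vecMul, dotProduct, Pi.zero_apply] at this
      exact_mod_cast this
    simp only [Matrix.mulVec, dotProduct, Finset.mul_sum]
    rw [Finset.sum_comm]
    refine Finset.sum_eq_zero fun j _ => ?_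
    have := congrArg (· * v j) (h0 j)
    simp only [Finset.sum_mul, zero_mul] at this
    rw [← this]
    exact Finset.sum_congr rfl fun i _ => by simp [mul_assoc]
  -- Pairing the eigenvalue equation with u removes the Laplacian and leaves w = zw. So either z =
  -- 1, or w = 0 and v is an eigenvector of the Laplacian itself.
  have hw1 : w = z * w := by
    have h1 : ∑ i, (u i : ℂ) * (((laplacian a).map (algebraMap ℝ ℂ) *ᵥ v) i + w) =
        ∑ i, (u i : ℂ) * (z * v i) := Finset.sum_congr rfl fun i _ => by rw [hsplit i]
    have h2 : (∑ i, (u i : ℂ)) = 1 := by exact_mod_cast hu1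
    simp only [mul_add, Finset.sum_add_distrib, hleft, ← Finset.sum_mul, h2] at h1
    rw [zero_add, one_mul] at h1
    conv_lhs => rw [h1]
    rw [hw, Finset.mul_sum]
    exact Finset.sum_congr rfl fun i _ => by ring
  by_cases hw0 : w = 0
  swap
  · have : z = 1 := mul_right_cancel₀ hw0 (by rw [one_mul]; exact hw1.symm)
    simp [this]
  have hLv : (laplacian a).map (algebraMap ℝ ℂ) *ᵥ v = z • v := by
    ext i
    simpa [hw0] using hsplit i
  -- Gershgorin: the disc has centre d ≥ 0 and radius d, so it meets the closed left half-plane only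
  -- at 0.
  have hev : Module.End.HasEigenvalue
      (Matrix.toLin' ((laplacian a).map (algebraMap ℝ ℂ))) z :=
    Module.End.hasEigenvalue_of_hasEigenvector
      (Module.End.hasEigenvector_iff.2 ⟨Module.End.mem_eigenspace_iff.2 (by simpa using hLv), hv⟩)
  obtain ⟨k, hk⟩ := eigenvalue_mem_ball hev
  set d := ∑ j ∈ Finset.univ.erase k, a k j with hd
  have hkk : laplacian a k k = d := by
    rw [laplacian, Matrix.sub_apply, Matrix.diagonal_apply_eq, hd,
      ← Finset.add_sum_erase _ _ (Finset.mem_univ k)]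
    ring
  have hoff : ∑ j ∈ Finset.univ.erase k, ‖(laplacian a).map (algebraMap ℝ ℂ) k j‖ = d := by
    refine Finset.sum_congr rfl fun j hj => ?_
    rw [Matrix.map_apply, laplacian, Matrix.sub_apply,
      Matrix.diagonal_apply_ne' _ (Finset.ne_of_mem_erase hj)]
    simp [abs_of_nonneg (ha k j)]
  have hd0 : 0 ≤ d := Finset.sum_nonneg fun j _ => ha k j
  rw [hoff, Metric.mem_closedBall, dist_eq_norm, Matrix.map_apply, hkk] at hk
  have hsq : (z.re - d) ^ 2 + z.im ^ 2 ≤ d ^ 2 := by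
    have h1 : Complex.normSq (z - algebraMap ℝ ℂ d) ≤ d ^ 2 := by
      rw [Complex.normSq_eq_norm_sq]; gcongr
    rw [Complex.normSq_apply] at h1
    simp at h1
    nlinarith
  by_contra hre
  have hre : z.re ≤ 0 := not_lt.1 hre
  have hz0 : z = 0 := by
    have h1 : z.re ^ 2 + z.im ^ 2 ≤ 0 := by nlinarith
    refine Complex.ext ?_ ?_
    · simp only [Complex.zero_re]; nlinarith [sq_nonneg z.re, sq_nonneg z.im]
    · simp only [Complex.zero_im]; nlinarith [sq_nonneg z.re, sq_nonneg z.im]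
  rw [hz0, zero_smul] at hLv
  -- For z = 0 the real and imaginary parts of v are null vectors of the Laplacian, hence constant;
  -- w = 0 and ∑ u_i = 1 then force v = 0.
  have hre0 : laplacian a *ᵥ (fun i => (v i).re) = fun _ => 0 := by
    ext i
    have := congrArg Complex.re (congrFun hLv i)
    simpa [Matrix.mulVec, dotProduct] using this
  have him0 : laplacian a *ᵥ (fun i => (v i).im) = fun _ => 0 := by
    ext i
    have := congrArg Complex.im (congrFun hLv i)
    simpa [Matrix.mulVec, dotProduct] using this
  have h1 := (HasSpanningTree.const_of_laplacian_mulVec ha hr hre0).2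
  have h2 := (HasSpanningTree.const_of_laplacian_mulVec ha hr him0).2
  have hconst : ∀ i, v i = v r := fun i => Complex.ext (h1 i) (h2 i)
  have hvr : v r = 0 := by
    have h3 : (∑ i, (u i : ℂ)) = 1 := by exact_mod_cast hu1
    rw [hw] at hw0
    simp_rw [hconst, ← Finset.sum_mul, h3, one_mul] at hw0
    exact hw0
  exact hv (funext fun i => by rw [hconst, hvr]; rfl)

/-- Decay of the disagreement of a diffusively coupled network, at a rate proportional to the
coupling gain. -/
theorem HasSpanningTree.exists_rate (ha : ∀ i j, 0 ≤ a i j) (h : HasSpanningTree a)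
    {u : Fin N → ℝ} (hu : u ᵥ* laplacian a = 0) (hu1 : ∑ i, u i = 1) :
    ∃ l > 0, ∀ (J : Set ℝ), IsTimeInterval J → ∀ (μ b : ℝ), 0 < μ → -(μ * l) ≤ b →
      ∀ x g : ℝ → Fin N → ℝ,
        (∀ t ∈ J, ∀ i, HasDerivWithinAt (fun t => x t i)
          (μ * ∑ j, a i j * (x t j - x t i) + g t i) J t) →
        (∀ t ∈ J, ∑ i, u i * x t i = 0) →
        g =O[𝓟 J] (fun t => Real.exp (b * t)) → x =O[𝓟 J] fun t => Real.exp (b * t) := by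
  -- On vectors with u·x = 0 the rank-one term is invisible, so x' = -μBx + g. The spectral gap l of
  -- B is fixed before μ; scaling the matrix by μ scales the gap.
  set B := laplacian a + Matrix.vecMulVec (fun _ => 1) u with hB
  have hspec : ∀ z ∈ spectrum ℂ (-(B.map (algebraMap ℝ ℂ))), z.re < 0 := by
    intro z hz
    obtain ⟨v, hv, hvz⟩ := exists_eigenvector_of_mem_spectrum hz
    have := h.re_pos_of_mem_spectrum ha hu hu1 (-z) (mem_spectrum_of_mulVec_eq hv (by
      rw [Matrix.neg_mulVec] at hvz; rw [neg_smul, ← hvz, neg_neg]))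
    simpa using this
  obtain ⟨l, hl, hgap⟩ := exists_gap_of_spectrum _ hspec
  refine ⟨l, hl, fun J hJ μ b hμ hb x g hx hux hg => ?_⟩
  refine hJ.isBigO_of_spectrum (-(μ • B)) (fun z hz => ?_) (fun t ht => ?_) hg
  · obtain ⟨v, hv, hvz⟩ := exists_eigenvector_of_mem_spectrum hz
    have hμ' : (μ : ℂ) ≠ 0 := by exact_mod_cast hμ.ne'
    have hm : (-(μ • B)).map (algebraMap ℝ ℂ) = (μ : ℂ) • -(B.map (algebraMap ℝ ℂ)) := by
      ext i j; simp
    rw [hm, Matrix.smul_mulVec] at hvz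
    have := hgap (z / μ) (mem_spectrum_of_mulVec_eq hv (by
      rw [div_eq_inv_mul, mul_smul, ← hvz, smul_smul, inv_mul_cancel₀ hμ', one_smul]))
    rw [Complex.div_ofReal_re, div_lt_iff₀ hμ] at this
    linarith
  · rw [hasDerivWithinAt_pi]
    intro i
    refine (hx t ht i).congr_deriv ?_
    have h1 : (B *ᵥ x t) i = ∑ j, a i j * (x t i - x t j) := by
      rw [hB, Matrix.add_mulVec, Matrix.vecMulVec_mulVec, Pi.add_apply, laplacian_mulVec_apply]
      have : u ⬝ᵥ x t = 0 := hux t ht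
      simp [this]
    simp only [Pi.add_apply, Matrix.neg_mulVec, Matrix.smul_mulVec, Pi.neg_apply, Pi.smul_apply,
      h1, smul_eq_mul]
    rw [← mul_neg, ← Finset.sum_neg_distrib]
    congr 2
    exact Finset.sum_congr rfl fun j _ => by ring

end Laplacian

/-! ### A maximum principle -/

section MaximumPrinciple

variable {N : ℕ} {a : Matrix (Fin N) (Fin N) ℝ} {J : Set ℝ}

/-- The squared positive part is a differentiable measure of excess, as the maximum principle
requires; its first-order remainder is at most (y - x)². -/
theorem hasDerivAt_max_zero_sq (x : ℝ) : HasDerivAt (fun x => max x 0 ^ 2) (2 * max x 0) x := by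
  have h : HasDerivAt (fun y => max y 0 ^ 2 - max x 0 ^ 2 - 2 * max x 0 * (y - x)) 0 x := by
    suffices hF : HasFDerivAt (fun y => max y 0 ^ 2 - max x 0 ^ 2 - 2 * max x 0 * (y - x))
        (0 : ℝ →L[ℝ] ℝ) x by simpa using hF.hasDerivAt
    refine IsBigO.hasFDerivAt (n := 2) ?_ one_lt_two
    refine IsBigO.of_bound 1 (Eventually.of_forall fun y => ?_)
    rw [one_mul, norm_pow, norm_norm, Real.norm_eq_abs, Real.norm_eq_abs, sq_abs, abs_le]
    rcases le_total x 0 with hx | hx <;> rcases le_total y 0 with hy | hy <;>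
      simp only [max_eq_left, max_eq_right, hx, hy] <;> constructor <;> nlinarith
  have h2 := (h.add (((hasDerivAt_id x).sub_const x).const_mul (2 * max x 0))).add_const
    (max x 0 ^ 2)
  refine (h2.congr_deriv (by simp)).congr_of_eventuallyEq (Eventually.of_forall fun y => ?_)
  simp

/-- The sum of the squared positive parts of g_i - c vanishes at time zero and satisfies f' ≤ bf, so
it stays zero. This avoids differentiating the maximum over i. -/
theorem IsTimeInterval.le_of_diffusion (hJ : IsTimeInterval J) (ha : ∀ i j, 0 ≤ a i j) {μ : ℝ}
    (hμ : 0 ≤ μ) {g g' : ℝ → Fin N → ℝ}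
    (hg : ∀ t ∈ J, ∀ i, HasDerivWithinAt (fun t => g t i) (g' t i) J t)
    (hg' : ∀ t ∈ J, ∀ i, g' t i ≤ μ * ∑ j, a i j * (g t j - g t i)) {c : ℝ}
    (hc : ∀ i, g 0 i ≤ c) : ∀ t ∈ J, ∀ i, g t i ≤ c := by
  set A := ∑ i, ∑ j, a i j with hA
  have hA0 : ∀ i j, a i j ≤ A := fun i j =>
    (Finset.single_le_sum (f := fun j => a i j) (fun j _ => ha i j) (Finset.mem_univ j)).trans
      (Finset.single_le_sum (f := fun i => ∑ j, a i j)
        (fun i _ => Finset.sum_nonneg fun j _ => ha i j) (Finset.mem_univ i))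
  have key := hJ.le_exp_mul (b := μ * A * (2 * N))
    (f := fun t => ∑ i, max (g t i - c) 0 ^ 2)
    (f' := fun t => ∑ i, 2 * max (g t i - c) 0 * g' t i)
    (fun t ht => HasDerivWithinAt.fun_sum fun i _ =>
      ((hasDerivAt_max_zero_sq (g t i - c)).comp_hasDerivWithinAt t ((hg t ht i).sub_const c)))
    (fun t ht => by
      have h1 : ∀ i, 2 * max (g t i - c) 0 * g' t i ≤
          ∑ j, μ * A * (max (g t i - c) 0 ^ 2 + max (g t j - c) 0 ^ 2) := by
        intro i
        have hm : 0 ≤ max (g t i - c) 0 := le_max_right _ _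
        calc 2 * max (g t i - c) 0 * g' t i
            ≤ 2 * max (g t i - c) 0 * (μ * ∑ j, a i j * (g t j - g t i)) := by
              gcongr; exact hg' t ht i
          _ = ∑ j, μ * a i j * (2 * (max (g t i - c) 0 * ((g t j - c) - (g t i - c)))) := by
              rw [Finset.mul_sum, Finset.mul_sum]
              exact Finset.sum_congr rfl fun j _ => by ring
          _ ≤ _ := by
              refine Finset.sum_le_sum fun j _ => ?_
              have hm' : 0 ≤ max (g t j - c) 0 := le_max_right _ _
              have h2 : 2 * (max (g t i - c) 0 * ((g t j - c) - (g t i - c))) ≤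
                  max (g t i - c) 0 ^ 2 + max (g t j - c) 0 ^ 2 := by
                have h3 : max (g t i - c) 0 * (g t j - c) ≤
                    max (g t i - c) 0 * max (g t j - c) 0 := by gcongr; exact le_max_left _ _
                have h4 : 0 ≤ max (g t i - c) 0 * (g t i - c) := by
                  rcases le_total (g t i - c) 0 with h | h
                  · simp [h]
                  · exact mul_nonneg hm h
                nlinarith [sq_nonneg (max (g t i - c) 0 - max (g t j - c) 0)]
              calc _ ≤ μ * a i j * (max (g t i - c) 0 ^ 2 + max (g t j - c) 0 ^ 2) :=
                    mul_le_mul_of_nonneg_left h2 (mul_nonneg hμ (ha i j))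
                _ ≤ _ := by gcongr; exact hA0 i j
      refine (Finset.sum_le_sum fun i _ => h1 i).trans_eq ?_
      simp only [← Finset.mul_sum, Finset.sum_add_distrib, Finset.sum_const, Finset.card_univ,
        Fintype.card_fin, nsmul_eq_mul]
      ring)
  intro t ht i
  have h0 : ∑ i, max (g 0 i - c) 0 ^ 2 = 0 :=
    Finset.sum_eq_zero fun i _ => by simp [hc i]
  have h1 := key t ht
  rw [h0, mul_zero] at h1
  have h2 := (Finset.single_le_sum (f := fun i => max (g t i - c) 0 ^ 2)
    (fun i _ => sq_nonneg _) (Finset.mem_univ i)).trans h1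
  have h3 : max (g t i - c) 0 = 0 := pow_eq_zero_iff two_ne_zero |>.1 (le_antisymm h2 (sq_nonneg _))
  have := le_max_left (g t i - c) 0
  linarith

theorem dotProduct_mulVec_le {n : ℕ} (S : Matrix (Fin n) (Fin n) ℝ) {c : ℝ}
    (hS : ∀ j k, |S j k| ≤ c) (x : Fin n → ℝ) : x ⬝ᵥ (S *ᵥ x) ≤ c * n * (x ⬝ᵥ x) := by
  have h : ∀ j k, x j * (S j k * x k) ≤ c * ((x j ^ 2 + x k ^ 2) / 2) := by
    intro j k
    calc x j * (S j k * x k) ≤ |x j * (S j k * x k)| := le_abs_self _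
      _ = |S j k| * (|x j| * |x k|) := by rw [abs_mul, abs_mul]; ring
      _ ≤ c * ((x j ^ 2 + x k ^ 2) / 2) := by
        have h1 : |x j| * |x k| ≤ (x j ^ 2 + x k ^ 2) / 2 := by
          nlinarith [sq_nonneg (|x j| - |x k|), sq_abs (x j), sq_abs (x k)]
        exact mul_le_mul (hS j k) h1 (by positivity) ((abs_nonneg _).trans (hS j k))
  calc x ⬝ᵥ (S *ᵥ x) = ∑ j, ∑ k, x j * (S j k * x k) := by
        simp [dotProduct, Matrix.mulVec, Finset.mul_sum]
    _ ≤ ∑ j, ∑ k, c * ((x j ^ 2 + x k ^ 2) / 2) :=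
        Finset.sum_le_sum fun j _ => Finset.sum_le_sum fun k _ => h j k
    _ = _ := by
        simp only [← Finset.mul_sum, ← Finset.sum_div, Finset.sum_add_distrib, Finset.sum_const,
          Finset.card_univ, Fintype.card_fin, nsmul_eq_mul, dotProduct, ← pow_two]
        ring

theorem norm_sq_le_dotProduct {ι : Type*} [Fintype ι] (x : ι → ℝ) : ‖x‖ ^ 2 ≤ x ⬝ᵥ x := by
  have h : ‖x‖ ≤ √(x ⬝ᵥ x) := by
    refine (pi_norm_le_iff_of_nonneg (Real.sqrt_nonneg _)).2 fun i => ?_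
    refine Real.abs_le_sqrt ?_
    rw [pow_two]
    exact Finset.single_le_sum (f := fun i => x i * x i) (fun i _ => mul_self_nonneg _)
      (Finset.mem_univ i)
  have h0 : 0 ≤ x ⬝ᵥ x := Finset.sum_nonneg fun i _ => mul_self_nonneg _
  calc ‖x‖ ^ 2 ≤ √(x ⬝ᵥ x) ^ 2 := by gcongr
    _ = _ := Real.sq_sqrt h0

/-- Growth of diffusively coupled linear systems, at a rate independent of the coupling gain. -/
theorem IsTimeInterval.isBigO_of_coupled {n : ℕ} (hJ : IsTimeInterval J) (ha : ∀ i j, 0 ≤ a i j)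
    {μ c : ℝ} (hμ : 0 ≤ μ) {S : ℝ → Fin N → Matrix (Fin n) (Fin n) ℝ}
    (hS : ∀ t ∈ J, ∀ i j k, |S t i j k| ≤ c) {η : ℝ → Fin N → Fin n → ℝ}
    (hη : ∀ t ∈ J, ∀ i, HasDerivWithinAt (fun t => η t i)
      (S t i *ᵥ η t i + μ • ∑ j, a i j • (η t j - η t i)) J t) (i : Fin N) :
    (fun t => η t i) =O[𝓟 J] fun t => Real.exp (c * n * t) := by
  set C := ∑ i, η 0 i ⬝ᵥ η 0 i with hC
  have hpos : ∀ x : Fin n → ℝ, 0 ≤ x ⬝ᵥ x := fun x =>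
    Finset.sum_nonneg fun i _ => mul_self_nonneg _
  -- The quantities e^{-2cnt}|η_i|² obey the scalar diffusion inequality: η·Sη ≤ cn|η|², and |η_j -
  -- η_i|² ≥ 0 gives η_i·(η_j - η_i) ≤ (|η_j|² - |η_i|²)/2. The coupling is thus absorbed by the
  -- maximum principle and its gain does not affect the rate.
  have key := hJ.le_of_diffusion ha hμ (c := C)
    (g := fun t i => Real.exp (-(2 * (c * n)) * t) * (η t i ⬝ᵥ η t i))
    (fun t ht i => (hasDerivAt_exp_mul (-(2 * (c * n))) t).hasDerivWithinAt.mul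
      (hasDerivWithinAt_dotProduct (hη t ht i) (hη t ht i)))
    (fun t ht i => by
      set E := Real.exp (-(2 * (c * n)) * t) with hE
      have hE0 : 0 < E := Real.exp_pos _
      have h1 := dotProduct_mulVec_le (S t i) (hS t ht i) (η t i)
      have h2 : η t i ⬝ᵥ ∑ j, a i j • (η t j - η t i) ≤
          ∑ j, a i j * ((η t j ⬝ᵥ η t j - η t i ⬝ᵥ η t i) / 2) := by
        rw [dotProduct_sum]
        refine Finset.sum_le_sum fun j _ => ?_
        rw [dotProduct_smul, smul_eq_mul]
        refine mul_le_mul_of_nonneg_left ?_ (ha i j)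
        have h3 := hpos (η t j - η t i)
        simp only [sub_dotProduct, dotProduct_sub, dotProduct_comm (η t j) (η t i)] at h3 ⊢
        linarith
      have h4 : μ * ∑ j, a i j * (E * (η t j ⬝ᵥ η t j) - E * (η t i ⬝ᵥ η t i)) =
          E * (μ * (2 * ∑ j, a i j * ((η t j ⬝ᵥ η t j - η t i ⬝ᵥ η t i) / 2))) := by
        simp only [Finset.mul_sum]
        exact Finset.sum_congr rfl fun j _ => by ring
      rw [h4, dotProduct_comm (_ + _) (η t i), dotProduct_add, dotProduct_smul, smul_eq_mul]
      have h5 := mul_le_mul_of_nonneg_left h2 hμ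
      have h6 := mul_le_mul_of_nonneg_left (add_le_add h1 h5) hE0.le
      linarith)
    (fun i => by
      simp only [mul_zero, Real.exp_zero, one_mul]
      exact Finset.single_le_sum (f := fun i => η 0 i ⬝ᵥ η 0 i) (fun i _ => hpos _)
        (Finset.mem_univ i))
  have hC0 : 0 ≤ C := Finset.sum_nonneg fun i _ => hpos _
  refine isBigO_exp_iff.2 ⟨√C, Real.sqrt_nonneg _, fun t ht => ?_⟩
  refine (sq_le_sq₀ (norm_nonneg _) (by positivity)).1 ?_
  rw [mul_pow, Real.sq_sqrt hC0, ← Real.exp_nat_mul]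
  have e : Real.exp ((2 : ℕ) * (c * n * t)) * Real.exp (-(2 * (c * n)) * t) = 1 := by
    rw [← Real.exp_add]; push_cast; ring_nf; simp
  calc ‖η t i‖ ^ 2 ≤ η t i ⬝ᵥ η t i := norm_sq_le_dotProduct _
    _ = Real.exp ((2 : ℕ) * (c * n * t)) *
        (Real.exp (-(2 * (c * n)) * t) * (η t i ⬝ᵥ η t i)) := by rw [← mul_assoc, e, one_mul]
    _ ≤ Real.exp ((2 : ℕ) * (c * n * t)) * C := by gcongr; exact key t ht i
    _ = _ := mul_comm _ _

end MaximumPrinciple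

/-! ### The matrix exponential -/

section Exponential

attribute [local instance] Matrix.linftyOpNormedRing Matrix.linftyOpNormedAlgebra

variable {n : ℕ} (S : Matrix (Fin n) (Fin n) ℝ)

theorem hasDerivAt_exp_smul_apply (t : ℝ) (j k : Fin n) :
    HasDerivAt (fun t : ℝ => NormedSpace.exp (t • S) j k) ((NormedSpace.exp (t • S) * S) j k) t :=
  (LinearMap.toContinuousLinearMap (Matrix.entryLinearMap ℝ ℝ j k)).hasFDerivAt.comp_hasDerivAt t
    (hasDerivAt_exp_smul_const (𝕂 := ℝ) S t)

theorem exp_smul_mul_comm (t : ℝ) :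
    NormedSpace.exp (t • S) * S = S * NormedSpace.exp (t • S) :=
  ((Commute.refl S).smul_left t).exp_left.eq

end Exponential

section Exponential

variable {n : ℕ} (S : Matrix (Fin n) (Fin n) ℝ)

theorem exp_smul_mul_exp_neg_smul (t : ℝ) :
    NormedSpace.exp (t • S) * NormedSpace.exp (-(t • S)) = 1 := by
  rw [← Matrix.exp_add_of_commute (t • S) (-(t • S)) (Commute.refl _).neg_right, add_neg_cancel,
    NormedSpace.exp_zero]

/-- Each column of the exponential solves x' = Sx, a network with a single agent and no edges, so
the growth estimate for coupled systems applies. -/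
theorem isBigO_exp_smul_apply {c : ℝ} (hS : ∀ j k, |S j k| ≤ c) {J : Set ℝ}
    (hJ : IsTimeInterval J) (j k : Fin n) :
    (fun t : ℝ => NormedSpace.exp (t • S) j k) =O[𝓟 J] fun t => Real.exp (c * n * t) := by
  have h := hJ.isBigO_of_coupled (N := 1) (a := 0) (fun _ _ => le_rfl) (μ := 0) le_rfl
    (S := fun _ _ => S) (fun _ _ _ => hS)
    (η := fun t _ i => NormedSpace.exp (t • S) i k) (fun t ht _ => by
      refine hasDerivWithinAt_pi.2 fun i => ?_
      refine (hasDerivAt_exp_smul_apply S t i k).hasDerivWithinAt.congr_deriv ?_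
      rw [exp_smul_mul_comm]
      simp [Matrix.mul_apply, Matrix.mulVec, dotProduct]) 0
  exact isBigO_pi.1 h j

end Exponential

/-! ### Convergence of integrals of decaying functions -/

/-- Subtracting the primitive (C/b)e^{bt} of the bound makes both f and -f nonincreasing. One of
them gives the limit, and comparison with times beyond t bounds the error by the tail. -/
theorem exists_tendsto_of_deriv_isBigO {f h : ℝ → ℝ} {b : ℝ} (hb : b < 0)
    (hf : ∀ t ∈ Ici (0 : ℝ), HasDerivWithinAt f (h t) (Ici 0) t)
    (hh : h =O[𝓟 (Ici 0)] fun t => Real.exp (b * t)) :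
    ∃ l, Tendsto f atTop (𝓝 l) ∧ (fun t => f t - l) =O[𝓟 (Ici 0)] fun t => Real.exp (b * t) := by
  obtain ⟨C, hC0, hC⟩ := isBigO_exp_iff.1 hh
  have hder : ∀ t : ℝ, HasDerivAt (fun t => C / b * Real.exp (b * t)) (C * Real.exp (b * t)) t :=
    fun t => ((hasDerivAt_exp_mul b t).const_mul (C / b)).congr_deriv (by have := hb.ne; field_simp)
  have hdown : AntitoneOn (fun t => f t - C / b * Real.exp (b * t)) (Ici 0) :=
    isTimeInterval_Ici.antitoneOn (fun t ht => (hf t ht).sub (hder t).hasDerivWithinAt)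
      fun t ht => by have := (abs_le.1 (hC t ht)).2; linarith
  have hup : AntitoneOn (fun t => -f t - C / b * Real.exp (b * t)) (Ici 0) :=
    isTimeInterval_Ici.antitoneOn (fun t ht => (hf t ht).neg.sub (hder t).hasDerivWithinAt)
      fun t ht => by have := (abs_le.1 (hC t ht)).1; linarith
  have hCb : C / b ≤ 0 := div_nonpos_of_nonneg_of_nonpos hC0 hb.le
  have hexp : Tendsto (fun t => C / b * Real.exp (b * t)) atTop (𝓝 0) := by
    have : Tendsto (fun t => Real.exp (b * t)) atTop (𝓝 0) :=
      Real.tendsto_exp_atBot.comp (tendsto_id.const_mul_atTop_of_neg hb)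
    simpa using this.const_mul (C / b)
  obtain ⟨l, hl⟩ : ∃ l, Tendsto (fun t => f t - C / b * Real.exp (b * t)) atTop (𝓝 l) := by
    have hmono : Antitone (fun t => f (max t 0) - C / b * Real.exp (b * max t 0)) :=
      fun s t hst => hdown (mem_Ici.2 (le_max_right _ _)) (mem_Ici.2 (le_max_right _ _))
        (max_le_max_right 0 hst)
    have hbdd : BddBelow (range fun t => f (max t 0) - C / b * Real.exp (b * max t 0)) := by
      refine ⟨f 0 + C / b, ?_⟩
      rintro _ ⟨t, rfl⟩
      have h1 := hup (mem_Ici.2 le_rfl) (mem_Ici.2 (le_max_right t 0)) (le_max_right t 0)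
      simp only [mul_zero, Real.exp_zero, mul_one] at h1
      have h2 := mul_nonpos_of_nonpos_of_nonneg hCb (Real.exp_pos (b * max t 0)).le
      simp only
      linarith
    refine ⟨_, (tendsto_atTop_ciInf hmono hbdd).congr' ?_⟩
    filter_upwards [eventually_ge_atTop 0] with t ht
    simp only [max_eq_left ht]
  have hlim : Tendsto f atTop (𝓝 l) := by
    simpa using hl.add hexp
  refine ⟨l, hlim, isBigO_exp_iff.2 ⟨-(C / b), by linarith, fun t ht => ?_⟩⟩
  have h1 : l ≤ f t - C / b * Real.exp (b * t) := by
    refine le_of_tendsto hl ?_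
    filter_upwards [eventually_ge_atTop t] with s hs
    exact hdown ht (ht.out.trans hs) hs
  have h2 : -l ≤ -f t - C / b * Real.exp (b * t) := by
    have : Tendsto (fun t => -f t - C / b * Real.exp (b * t)) atTop (𝓝 (-l)) := by
      simpa using hlim.neg.sub hexp
    refine le_of_tendsto this ?_
    filter_upwards [eventually_ge_atTop t] with s hs
    exact hup ht (ht.out.trans hs) hs
  rw [Real.norm_eq_abs, abs_le]
  constructor <;> linarith

/-! ### The distributed observers -/

section Observers

variable {N n : ℕ} {a : Matrix (Fin N) (Fin N) ℝ} {μ₁ μ₂ : ℝ} {J : Set ℝ}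

/-- The autonomous part of the closed loop on a time interval. -/
structure IsObserver (a : Matrix (Fin N) (Fin N) ℝ) (μ₁ μ₂ : ℝ) (J : Set ℝ)
    (S : ℝ → Fin N → Matrix (Fin n) (Fin n) ℝ) (η : ℝ → Fin N → Fin n → ℝ) : Prop where
  deriv_S : ∀ t ∈ J, ∀ i j k, HasDerivWithinAt (fun t => S t i j k)
    ((μ₁ • ∑ l, a i l • (S t l - S t i)) j k) J t
  deriv_η : ∀ t ∈ J, ∀ i, HasDerivWithinAt (fun t => η t i)
    (S t i *ᵥ η t i + μ₂ • ∑ j, a i j • (η t j - η t i)) J t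

variable {S : ℝ → Fin N → Matrix (Fin n) (Fin n) ℝ} {η : ℝ → Fin N → Fin n → ℝ}

theorem IsObserver.deriv_S_apply (h : IsObserver a μ₁ μ₂ J S η) {t : ℝ} (ht : t ∈ J) (i : Fin N)
    (j k : Fin n) : HasDerivWithinAt (fun t => S t i j k)
      (μ₁ * ∑ l, a i l * (S t l j k - S t i j k)) J t :=
  (h.deriv_S t ht i j k).congr_deriv (by simp [Matrix.sum_apply])

/-- The maximum principle, applied entrywise to S and to -S: averaging never exceeds the initial
range, whatever the gain. -/
theorem IsObserver.abs_S_le (h : IsObserver a μ₁ μ₂ J S η) (hJ : IsTimeInterval J)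
    (ha : ∀ i j, 0 ≤ a i j) (hμ₁ : 0 ≤ μ₁) {c : ℝ} (hc : ∀ i j k, |S 0 i j k| ≤ c) :
    ∀ t ∈ J, ∀ i j k, |S t i j k| ≤ c := by
  intro t ht i j k
  rw [abs_le]
  constructor
  · have := hJ.le_of_diffusion ha hμ₁ (c := c) (g := fun t i => -S t i j k)
      (fun t ht i => (h.deriv_S_apply ht i j k).neg) (fun t ht i => by
        rw [← mul_neg, ← Finset.sum_neg_distrib]
        exact le_of_eq (congrArg _ (Finset.sum_congr rfl fun l _ => by ring)))
      (fun i => by have := (abs_le.1 (hc i j k)).1; linarith) t ht i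
    linarith
  · exact hJ.le_of_diffusion ha hμ₁ (c := c) (g := fun t i => S t i j k)
      (fun t ht i => h.deriv_S_apply ht i j k) (fun t ht i => le_rfl)
      (fun i => (abs_le.1 (hc i j k)).2) t ht i

theorem sum_mul_diffusion {u : Fin N → ℝ} (hu : u ᵥ* laplacian a = 0) (x : Fin N → ℝ) :
    ∑ i, u i * ∑ j, a i j * (x j - x i) = 0 := by
  have h1 : u ⬝ᵥ (laplacian a *ᵥ x) = 0 := by
    rw [Matrix.dotProduct_mulVec, hu, zero_dotProduct]
  rw [← neg_eq_zero, ← Finset.sum_neg_distrib, ← h1]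
  refine Finset.sum_congr rfl fun i _ => ?_
  rw [laplacian_mulVec_apply, ← mul_neg, ← Finset.sum_neg_distrib]
  exact congrArg _ (Finset.sum_congr rfl fun j _ => by ring)

theorem IsTimeInterval.eq_of_deriv_zero (hJ : IsTimeInterval J) {f : ℝ → ℝ}
    (hf : ∀ t ∈ J, HasDerivWithinAt f 0 J t) : ∀ t ∈ J, f t = f 0 := by
  intro t ht
  have h1 := hJ.le_of_deriv_nonpos hf (fun _ _ => le_rfl) t ht
  have h2 := hJ.le_of_deriv_nonpos (f := fun t => -f t) (f' := fun _ => 0)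
    (fun t ht => (hf t ht).neg.congr_deriv neg_zero) (fun _ _ => le_rfl) t ht
  linarith

/-- The weighted average is conserved, because u annihilates the diffusion term. -/
theorem IsObserver.sum_S_eq (h : IsObserver a μ₁ μ₂ J S η) (hJ : IsTimeInterval J)
    {u : Fin N → ℝ} (hu : u ᵥ* laplacian a = 0) {t : ℝ} (ht : t ∈ J) (j k : Fin n) :
    ∑ i, u i * S t i j k = (∑ i, u i • S 0 i) j k := by
  rw [hJ.eq_of_deriv_zero (f := fun t => ∑ i, u i * S t i j k) (fun t ht => ?_) t ht]
  · simp [Matrix.sum_apply]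
  · refine (HasDerivWithinAt.fun_sum fun i _ =>
      (h.deriv_S_apply ht i j k).const_mul (u i)).congr_deriv ?_
    simp_rw [mul_left_comm _ μ₁, ← Finset.mul_sum,
      sum_mul_diffusion hu (fun i => S t i j k), mul_zero]

/-- Behaviour of the observers for large gains. -/
structure ObserverConverges (a : Matrix (Fin N) (Fin N) ℝ) (μ₁ μ₂ : ℝ)
    (S : ℝ → Fin N → Matrix (Fin n) (Fin n) ℝ) (η : ℝ → Fin N → Fin n → ℝ)
    (Sstar : Matrix (Fin n) (Fin n) ℝ) (χ : Fin n → ℝ) : Prop where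
  bounded_S : ∀ i j k, (fun t => S t i j k) =O[𝓟 (Ici 0)] fun _ => (1 : ℝ)
  η_sub : ∀ i, (fun t => η t i - groupTrajectory Sstar χ t)
    =O[𝓟 (Ici 0)] fun t => Real.exp (-1 * t)
  S_η_sub : ∀ i, (fun t => S t i *ᵥ η t i - Sstar *ᵥ groupTrajectory Sstar χ t)
    =O[𝓟 (Ici 0)] fun t => Real.exp (-1 * t)
  diffusion : ∀ i, (fun t => μ₂ • ∑ j, a i j • (η t j - η t i))
    =O[𝓟 (Ici 0)] fun t => Real.exp (-1 * t)
  dS_η : ∀ i, (fun t => (μ₁ • ∑ j, a i j • (S t j - S t i)) *ᵥ η t i)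
    =O[𝓟 (Ici 0)] fun t => Real.exp (-1 * t)

/-- A budget of rates in κ = cn, which bounds the growth of η_i and of e^{±tS*}. The gains make S_i
- S* decay at rate 4(κ+1), so (S_i - S*)η_i decays at rate 3κ+4, and still at rate at least 2(κ+1)
after multiplication by e^{-tS*}. Disagreement in the moving frame inherits 2(κ+1), and returning
with e^{tS*} costs κ, which leaves more than the rate 1 that is claimed. -/
theorem IsObserver.converges (h : IsObserver a μ₁ μ₂ (Ici 0) S η)
    (ha : ∀ i j, 0 ≤ a i j) (hμ₁ : 0 < μ₁) (hμ₂ : 0 < μ₂)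
    {u : Fin N → ℝ} (hu : u ᵥ* laplacian a = 0) (hu1 : ∑ i, u i = 1) {l c : ℝ}
    (hrate : ∀ (μ b : ℝ), 0 < μ → -(μ * l) ≤ b →
      ∀ x g : ℝ → Fin N → ℝ,
        (∀ t ∈ Ici (0 : ℝ), ∀ i, HasDerivWithinAt (fun t => x t i)
          (μ * ∑ j, a i j * (x t j - x t i) + g t i) (Ici 0) t) →
        (∀ t ∈ Ici (0 : ℝ), ∑ i, u i * x t i = 0) →
        g =O[𝓟 (Ici 0)] (fun t => Real.exp (b * t)) →
          x =O[𝓟 (Ici 0)] fun t => Real.exp (b * t))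
    (hc0 : 0 ≤ c) (hc : ∀ i j k, |S 0 i j k| ≤ c)
    {Sstar : Matrix (Fin n) (Fin n) ℝ} (hSstar : Sstar = ∑ i, u i • S 0 i)
    (hcs : ∀ j k, |Sstar j k| ≤ c)
    (hl₁ : 4 * (c * n + 1) ≤ μ₁ * l) (hl₂ : 4 * (c * n + 1) ≤ μ₂ * l) :
    ∃ χ, Tendsto (fun t : ℝ => NormedSpace.exp (-(t • Sstar)) *ᵥ ∑ i, u i • η t i) atTop (𝓝 χ) ∧
      ObserverConverges a μ₁ μ₂ S η Sstar χ := by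
  have hJ := isTimeInterval_Ici
  set κ := c * n with hκ
  have hκ0 : 0 ≤ κ := by positivity
  have hexp : ∀ {b b' : ℝ}, b ≤ b' → (fun t => Real.exp (b * t)) =O[𝓟 (Ici 0)]
      (fun t => Real.exp (b' * t)) := fun h => hJ.exp_isBigO_exp h
  have hmul : ∀ b b' : ℝ, (fun t => Real.exp (b * t) * Real.exp (b' * t)) =
      fun t => Real.exp ((b + b') * t) := fun b b' => by
    ext t; rw [← Real.exp_add]; ring_nf
  -- the matrices
  have hSt := h.abs_S_le hJ ha hμ₁.le hc
  have hSdiff : ∀ i j k, (fun t => S t i j k - Sstar j k) =O[𝓟 (Ici 0)]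
      fun t => Real.exp (-(4 * (κ + 1)) * t) := by
    intro i j k
    refine isBigO_pi.1 (hrate μ₁ (-(4 * (κ + 1))) hμ₁ (by linarith)
      (fun t i => S t i j k - Sstar j k) 0 (fun t ht i => ?_) (fun t ht => ?_) ?_) i
    · simpa using (h.deriv_S_apply ht i j k).sub_const (Sstar j k)
    · simp_rw [mul_sub, Finset.sum_sub_distrib, ← Finset.sum_mul, hu1, one_mul]
      rw [h.sum_S_eq hJ hu ht, hSstar, sub_self]
    · exact isBigO_zero _ _
  have hη : ∀ i, (fun t => η t i) =O[𝓟 (Ici 0)] fun t => Real.exp (κ * t) :=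
    hJ.isBigO_of_coupled ha hμ₂.le hSt h.deriv_η
  have hSη : ∀ i, (fun t => (S t i - Sstar) *ᵥ η t i) =O[𝓟 (Ici 0)]
      fun t => Real.exp ((-(4 * (κ + 1)) + κ) * t) := by
    intro i
    have := isBigO_mulVec (A := fun t => S t i - Sstar) (fun j k => hSdiff i j k) (hη i)
    rwa [hmul] at this
  -- the states in the moving frame
  set w : ℝ → Fin N → Fin n → ℝ := fun t i => NormedSpace.exp (t • -Sstar) *ᵥ η t i with hw
  set g : ℝ → Fin N → Fin n → ℝ :=
    fun t i => NormedSpace.exp (t • -Sstar) *ᵥ ((S t i - Sstar) *ᵥ η t i) with hg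
  have hgO : ∀ i k, (fun t => g t i k) =O[𝓟 (Ici 0)] fun t => Real.exp (-(2 * (κ + 1)) * t) := by
    intro i k
    have h1 := isBigO_mulVec (isBigO_exp_smul_apply (-Sstar) (by simpa using hcs) hJ) (hSη i)
    rw [hmul] at h1
    exact isBigO_pi.1 (h1.trans (hexp (by rw [← hκ]; linarith))) k
  have hwd : ∀ t ∈ Ici (0 : ℝ), ∀ i k, HasDerivWithinAt (fun t => w t i k)
      (μ₂ * ∑ j, a i j * (w t j k - w t i k) + g t i k) (Ici 0) t := by
    intro t ht i k
    have h1 := hasDerivWithinAt_mulVec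
      (fun j k => (hasDerivAt_exp_smul_apply (-Sstar) t j k).hasDerivWithinAt) (h.deriv_η t ht i)
    refine (hasDerivWithinAt_pi.1 h1 k).congr_deriv ?_
    have h2 : NormedSpace.exp (t • -Sstar) *ᵥ (μ₂ • ∑ j, a i j • (η t j - η t i)) =
        μ₂ • ∑ j, a i j • (w t j - w t i) := by
      rw [Matrix.mulVec_smul, Matrix.mulVec_sum]
      simp_rw [Matrix.mulVec_smul, Matrix.mulVec_sub, hw]
    rw [Matrix.mulVec_add, h2, hg]
    simp only [Pi.add_apply, Pi.smul_apply, Finset.sum_apply, Pi.sub_apply, smul_eq_mul,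
      Matrix.sub_mulVec, Matrix.mulVec_sub, ← Matrix.mulVec_mulVec, Matrix.neg_mulVec,
      Matrix.mulVec_neg, Pi.neg_apply]
    ring
  have hbar : ∀ t ∈ Ici (0 : ℝ), ∀ k, HasDerivWithinAt (fun t => ∑ i, u i * w t i k)
      (∑ i, u i * g t i k) (Ici 0) t := by
    intro t ht k
    refine (HasDerivWithinAt.fun_sum fun i _ => (hwd t ht i k).const_mul (u i)).congr_deriv ?_
    simp_rw [mul_add, Finset.sum_add_distrib, mul_left_comm _ μ₂, ← Finset.mul_sum]
    rw [sum_mul_diffusion hu (fun i => w t i k), mul_zero, zero_add]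
  have hgbar : ∀ k, (fun t => ∑ i, u i * g t i k) =O[𝓟 (Ici 0)]
      fun t => Real.exp (-(2 * (κ + 1)) * t) := fun k =>
    IsBigO.fun_sum fun i _ => (hgO i k).const_mul_left (u i)
  -- The weighted average of the w_i feels only the forcing, whose exponential decay makes the
  -- average converge.
  choose χ hχ hχO using fun k => exists_tendsto_of_deriv_isBigO (b := -(2 * (κ + 1)))
    (by linarith) (fun t ht => hbar t ht k) (hgbar k)
  -- The deviation from the weighted average has weighted sum zero, the condition under which the
  -- rate estimate holds.
  have hdis : ∀ i k, (fun t => w t i k - ∑ j, u j * w t j k) =O[𝓟 (Ici 0)]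
      fun t => Real.exp (-(2 * (κ + 1)) * t) := by
    intro i k
    refine isBigO_pi.1 (hrate μ₂ (-(2 * (κ + 1))) hμ₂ (by linarith)
      (fun t i => w t i k - ∑ j, u j * w t j k)
      (fun t i => g t i k - ∑ j, u j * g t j k) (fun t ht i => ?_) (fun t ht => ?_) ?_) i
    · refine ((hwd t ht i k).sub (hbar t ht k)).congr_deriv ?_
      simp only [sub_sub_sub_cancel_right]
      ring
    · simp_rw [mul_sub, Finset.sum_sub_distrib, ← Finset.sum_mul, hu1, one_mul, sub_self]
    · exact isBigO_pi.2 fun i => (hgO i k).sub (hgbar k)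
  have hwχ : ∀ i, (fun t => w t i - χ) =O[𝓟 (Ici 0)] fun t => Real.exp (-(2 * (κ + 1)) * t) :=
    fun i => isBigO_pi.2 fun k => by simpa using (hdis i k).add (hχO k)
  have hηw : ∀ t i, η t i - groupTrajectory Sstar χ t =
      NormedSpace.exp (t • Sstar) *ᵥ (w t i - χ) := by
    intro t i
    rw [Matrix.mulVec_sub, hw, groupTrajectory, Matrix.mulVec_mulVec, smul_neg,
      exp_smul_mul_exp_neg_smul, Matrix.one_mulVec]
  have hηsub : ∀ i, (fun t => η t i - groupTrajectory Sstar χ t)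
      =O[𝓟 (Ici 0)] fun t => Real.exp (-1 * t) := by
    intro i
    simp_rw [hηw]
    have h1 := isBigO_mulVec (isBigO_exp_smul_apply Sstar hcs hJ) (hwχ i)
    rw [hmul] at h1
    exact h1.trans (hexp (by rw [← hκ]; linarith))
  refine ⟨χ, tendsto_pi_nhds.2 fun k => ?_, ?_, hηsub, fun i => ?_, fun i => ?_, fun i => ?_⟩
  · refine (hχ k).congr fun t => ?_
    rw [Matrix.mulVec_sum, Finset.sum_apply]
    simp [hw, Matrix.mulVec_smul]
  · exact fun i j k => isBigO_one_iff_bound.2 ⟨c, hc0, fun t ht => hSt t ht i j k⟩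
  · have h1 := ((hSη i).trans (hexp (b' := -1) (by linarith))).add
      (isBigO_const_mulVec Sstar (hηsub i))
    refine h1.congr_left fun t => ?_
    rw [Matrix.sub_mulVec, Matrix.mulVec_sub]
    abel
  · have h1 : ∀ j, (fun t => η t j - η t i) =O[𝓟 (Ici 0)] fun t => Real.exp (-1 * t) :=
      fun j => by simpa using (hηsub j).sub (hηsub i)
    exact (IsBigO.fun_sum fun j _ => (h1 j).const_smul_left (a i j)).const_smul_left μ₂
  · have h1 : ∀ j k, (fun t => (μ₁ • ∑ l, a i l • (S t l - S t i)) j k) =O[𝓟 (Ici 0)]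
        fun t => Real.exp (-(4 * (κ + 1)) * t) := by
      intro j k
      have : (fun t => μ₁ * ∑ l, a i l * ((S t l j k - Sstar j k) - (S t i j k - Sstar j k)))
          =O[𝓟 (Ici 0)] fun t => Real.exp (-(4 * (κ + 1)) * t) :=
        (IsBigO.fun_sum fun l _ => ((hSdiff l j k).sub (hSdiff i j k)).const_mul_left _).const_mul_left _
      simpa [Matrix.sum_apply] using this
    have h2 := isBigO_mulVec h1 (hη i)
    rw [hmul] at h2
    exact h2.trans (hexp (by linarith))

end Observers

/-! ### The Sylvester equation of the internal model -/

section Sylvester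

open Polynomial

theorem eq_zero_of_vecMul_eq_zero_of_rank {r : ℕ} {A : Matrix (Fin r) (Fin r) ℝ} (hA : A.rank = r)
    {w : Fin r → ℝ} (hw : w ᵥ* A = 0) : w = 0 := by
  have hr : LinearMap.range A.mulVecLin = ⊤ :=
    Submodule.eq_top_of_finrank_eq (by simpa [Matrix.rank] using hA)
  obtain ⟨x, hx⟩ := LinearMap.range_eq_top.1 hr w
  have : w ⬝ᵥ w = 0 := by
    nth_rewrite 2 [← hx]
    rw [Matrix.mulVecLin_apply, Matrix.dotProduct_mulVec, hw, zero_dotProduct]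
  exact dotProduct_self_eq_zero.1 this

/-- The Horner scheme of `X ^ (k + 1) - ∑ c_j X ^ j`. -/
noncomputable def horner {k : ℕ} (c : Fin (k + 1) → ℝ) : ℕ → ℝ[X]
  | 0 => 1
  | m + 1 => X * horner c m - C (c (Fin.ofNat (k + 1) (k - m)))

theorem vecMul_companion {k : ℕ} (c : Fin (k + 1) → ℝ) {K : Type*} [CommRing K] [Algebra ℝ K]
    (w : Fin (k + 1) → K) (j : Fin (k + 1)) :
    (w ᵥ* (companion c).map (algebraMap ℝ K)) j =
      (if h : (j : ℕ) = 0 then 0 else w ⟨j - 1, by omega⟩) + w (Fin.last k) * algebraMap ℝ K (c j) := by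
  rw [Matrix.vecMul, dotProduct, Fin.sum_univ_castSucc]
  congr 1
  · split_ifs with h
    · refine Finset.sum_eq_zero fun i _ => ?_
      have h1 : ¬ ((i : ℕ) = k) := i.2.ne
      simp [companion, h, h1]
    · rw [Finset.sum_eq_single ⟨j - 1, by omega⟩]
      · have h1 : ¬ ((j : ℕ) - 1 = k) := by omega
        have h2 : (j : ℕ) = j - 1 + 1 := by omega
        simp only [companion, Matrix.map_apply, Matrix.of_apply, Fin.val_castSucc]
        rw [if_neg (by omega), if_pos (by omega)]
        simp
      · intro i _ hi
        have h1 : ¬ ((i : ℕ) + 1 = k + 1) := by have := i.2; omega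
        have h2 : ¬ ((j : ℕ) = i + 1) := fun h' => hi (Fin.ext (by simp only; omega))
        simp only [Matrix.map_apply, companion, Matrix.of_apply, Fin.val_castSucc, if_neg h1,
          if_neg h2, map_zero, mul_zero]
      · simp
  · simp [companion]

/-- The roots of the characteristic polynomial are eigenvalues of the companion matrix. -/
theorem mem_spectrum_companion {k : ℕ} (c : Fin (k + 1) → ℝ) {z : ℂ}
    (hz : aeval z (horner c (k + 1)) = 0) :
    z ∈ spectrum ℂ ((companion c).map (algebraMap ℝ ℂ)) := by
  set w : Fin (k + 1) → ℂ := fun j => aeval z (horner c (k - j)) with hw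
  have hlast : w (Fin.last k) = 1 := by simp [hw, horner]
  have hev : w ᵥ* (companion c).map (algebraMap ℝ ℂ) = z • w := by
    ext j
    rw [vecMul_companion, hlast, one_mul, Pi.smul_apply, smul_eq_mul]
    have hrec : z * w j - algebraMap ℝ ℂ (c j) = aeval z (horner c (k - j + 1)) := by
      have : Fin.ofNat (k + 1) (k - (k - (j : ℕ))) = j := by
        ext; simp only [Fin.val_ofNat]; rw [Nat.mod_eq_of_lt] <;> omega
      rw [horner, this]
      simp [hw]
    split_ifs with h
    · rw [h, Nat.sub_zero, hz] at hrec
      linear_combination -hrec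
    · have : k - (j : ℕ) + 1 = k - (j - 1) := by have := j.2; omega
      rw [this] at hrec
      have h2 : w ⟨j - 1, by omega⟩ = aeval z (horner c (k - (j - 1))) := rfl
      rw [h2, ← hrec]
      ring
  have h1 : ((companion c).map (algebraMap ℝ ℂ))ᵀ *ᵥ w = z • w := by
    rw [Matrix.mulVec_transpose, hev]
  have h2 := mem_spectrum_of_mulVec_eq (fun h0 => by simp [h0] at hlast) h1
  rwa [Matrix.mem_spectrum_iff_isRoot_charpoly, Matrix.charpoly_transpose,
    ← Matrix.mem_spectrum_iff_isRoot_charpoly] at h2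

/-- Spectral mapping over ℂ: 0 is an eigenvalue of p(M) only if p vanishes at an eigenvalue of M. -/
theorem isUnit_det_aeval {r : ℕ} [NeZero r] (M : Matrix (Fin r) (Fin r) ℝ) (p : ℝ[X])
    (hp : ∀ z ∈ spectrum ℂ (M.map (algebraMap ℝ ℂ)), aeval z p ≠ 0) :
    IsUnit (aeval M p).det := by
  have hne : Nonempty (Fin r) := ⟨0⟩
  have h1 : (aeval M p).map (algebraMap ℝ ℂ) =
      aeval (M.map (algebraMap ℝ ℂ)) (p.map (algebraMap ℝ ℂ)) := by
    rw [aeval_map_algebraMap]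
    exact ((aeval_algHom_apply (Algebra.ofId ℝ ℂ).mapMatrix M p)).symm
  have h2 : (0 : ℂ) ∉ spectrum ℂ ((aeval M p).map (algebraMap ℝ ℂ)) := by
    rw [h1, spectrum.map_polynomial_aeval_of_nonempty _ _
      (spectrum.nonempty_of_isAlgClosed_of_finiteDimensional ℂ _)]
    rintro ⟨z, hz, h⟩
    refine hp z hz ?_
    simpa [eval_map_algebraMap] using h
  rw [spectrum.zero_notMem_iff, Matrix.isUnit_iff_isUnit_det] at h2
  rw [isUnit_iff_ne_zero] at h2 ⊢
  intro h0
  refine h2 ?_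
  have := (algebraMap ℝ ℂ).map_det (aeval M p)
  rw [RingHom.mapMatrix_apply] at this
  rw [← this, h0, map_zero]

/-- Read column by column, the equation determines every column from the last one, g, by the Horner
scheme: column j is the polynomial `horner c (k - j)` at M applied to g. The first column leaves the
condition p(M)g = -b with p the characteristic polynomial, solvable since p has only imaginary roots
and M is Hurwitz. Controllability makes T nonsingular. -/
theorem exists_sylvester {r : ℕ} (hr : 0 < r) {M : Matrix (Fin r) (Fin r) ℝ} {b : Fin r → ℝ}
    (hM : IsHurwitz M) (hMb : IsControllable M b) (c : Fin r → ℝ)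
    (hc : ∀ z ∈ spectrum ℂ ((companion c).map (algebraMap ℝ ℂ)), z.re = 0) :
    ∃ T : Matrix (Fin r) (Fin r) ℝ, IsUnit T.det ∧
      T * companion c - M * T = Matrix.vecMulVec b (firstRow r) := by
  obtain ⟨k, rfl⟩ : ∃ k, r = k + 1 := ⟨r - 1, by omega⟩
  set p := aeval M (horner c (k + 1)) with hp
  have hpdet : IsUnit p.det := isUnit_det_aeval M _ fun z hz h0 => by
    have h1 := hM z hz
    have h2 := hc z (mem_spectrum_companion c h0)
    linarith
  set g := -(p⁻¹ *ᵥ b) with hg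
  have hpg : p *ᵥ g = -b := by
    rw [hg, Matrix.mulVec_neg, Matrix.mulVec_mulVec, Matrix.mul_nonsing_inv _ hpdet,
      Matrix.one_mulVec]
  set H : ℕ → Fin (k + 1) → ℝ := fun m => aeval M (horner c m) *ᵥ g with hH
  have hH0 : H 0 = g := by simp [hH, horner]
  have hHs : ∀ m, H (m + 1) = M *ᵥ H m - c (Fin.ofNat (k + 1) (k - m)) • g := by
    intro m
    simp [hH, horner, Matrix.sub_mulVec, ← Matrix.mulVec_mulVec, Algebra.algebraMap_eq_smul_one,
      Matrix.smul_mulVec]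
  set T : Matrix (Fin (k + 1)) (Fin (k + 1)) ℝ := Matrix.of fun i j => H (k - j) i with hT
  refine ⟨T, ?_, ?_⟩
  · rw [isUnit_iff_ne_zero]
    intro h0
    obtain ⟨w, hw, hwT⟩ := Matrix.exists_vecMul_eq_zero_iff.2 h0
    -- A row vector orthogonal to all columns H m is orthogonal to M^m g for m ≤ k, because `M *ᵥ H
    -- i` and `H (i + 1)` differ by a multiple of g = H 0.
    have hwH : ∀ m ≤ k, w ⬝ᵥ H m = 0 := by
      intro m hm
      have := congrFun hwT ⟨k - m, by omega⟩
      have e : k - (k - m) = m := by omega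
      simpa [Matrix.vecMul, hT, e, dotProduct] using this
    have hwM : ∀ m i, m + i ≤ k → w ⬝ᵥ (M ^ m *ᵥ H i) = 0 := by
      intro m
      induction m with
      | zero => intro i hi; simpa using hwH i (by omega)
      | succ m ih =>
        intro i hi
        have h1 : M *ᵥ H i = H (i + 1) + c (Fin.ofNat (k + 1) (k - i)) • H 0 := by
          rw [hHs, hH0]; abel
        rw [pow_succ, ← Matrix.mulVec_mulVec, h1, Matrix.mulVec_add, Matrix.mulVec_smul,
          dotProduct_add, dotProduct_smul, ih (i + 1) (by omega), ih 0 (by omega)]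
        simp
    have hcomm : ∀ m, M ^ m * p = p * M ^ m := fun m => by
      have : Commute M p := by
        have := (Commute.all X (horner c (k + 1))).map (aeval M : ℝ[X] →ₐ[ℝ] _)
        simpa using this
      exact (this.pow_left m).eq
    -- As p(M) commutes with M, M^m b = -p(M)M^m g. Hence w p(M)⁻¹ annihilates all Krylov vectors of
    -- b, which span the space.
    have hzero : w ᵥ* p⁻¹ = 0 := by
      refine eq_zero_of_vecMul_eq_zero_of_rank hMb (funext fun m => ?_)
      have h1 : M ^ (m : ℕ) *ᵥ b = -(p *ᵥ (M ^ (m : ℕ) *ᵥ H 0)) := by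
        rw [Matrix.mulVec_mulVec, ← hcomm, ← Matrix.mulVec_mulVec, hH0, hpg, Matrix.mulVec_neg,
          neg_neg]
      have h2 : (w ᵥ* p⁻¹) ⬝ᵥ (M ^ (m : ℕ) *ᵥ b) = 0 := by
        rw [h1, dotProduct_neg, ← Matrix.dotProduct_mulVec, Matrix.mulVec_mulVec,
          Matrix.nonsing_inv_mul _ hpdet, Matrix.one_mulVec,
          hwM m 0 (by have := m.2; omega), neg_zero]
      simpa [Matrix.vecMul, dotProduct] using h2
    apply hw
    have := congrArg (· ᵥ* p) hzero
    simpa [Matrix.vecMul_vecMul, Matrix.nonsing_inv_mul _ hpdet] using this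
  · ext i j
    have h1 : (T * companion c) i j = (T i ᵥ* (companion c).map (algebraMap ℝ ℝ)) j := by
      simp [Matrix.mul_apply, Matrix.vecMul, dotProduct]
    have h2 : (M * T) i j = (M *ᵥ H (k - j)) i := by
      simp [Matrix.mul_apply, Matrix.mulVec, dotProduct, hT]
    have h3 : T i (Fin.last k) = g i := by simp [hT, hH0]
    have h4 : Fin.ofNat (k + 1) (k - (k - (j : ℕ))) = j := by
      ext; simp only [Fin.val_ofNat]; rw [Nat.mod_eq_of_lt] <;> omega
    have h5 := congrFun (hHs (k - j)) i
    rw [h4] at h5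
    rw [Matrix.sub_apply, h1, h2, vecMul_companion, h3, Matrix.vecMulVec_apply, firstRow]
    simp only [Pi.sub_apply, Pi.smul_apply, smul_eq_mul] at h5
    simp only [Algebra.algebraMap_self, RingHom.id_apply]
    split_ifs with h
    · have h6 : H (k - j + 1) i = -b i := by
        rw [h, Nat.sub_zero]
        exact congrFun hpg i
      linarith
    · have h6 : T i ⟨j - 1, by omega⟩ = H (k - j + 1) i := by
        have : k - (j : ℕ) + 1 = k - (j - 1) := by have := j.2; omega
        rw [this]; rfl
      rw [h6]
      linarith

end Sylvester

/-! ### The exosystem -/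

section Exosystem

variable {n : ℕ} {m : Fin n → ℕ}

/-- The `k`-th derivative of the disturbance. -/
noncomputable def Disturbance.derivValue (d : Disturbance m) (s : Fin n) (k : ℕ) (t : ℝ) : ℝ :=
  (if k = 0 then d.bias s else 0) + ∑ j, d.amp s j * d.freq s j ^ k *
    Real.sin (d.freq s j * t + d.phase s j + k * (Real.pi / 2))

theorem Disturbance.hasDerivAt_derivValue (d : Disturbance m) (s : Fin n) (k : ℕ) (t : ℝ) :
    HasDerivAt (d.derivValue s k) (d.derivValue s (k + 1) t) t := by
  have h : ∀ j, HasDerivAt (fun t => d.amp s j * d.freq s j ^ k *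
      Real.sin (d.freq s j * t + d.phase s j + k * (Real.pi / 2)))
      (d.amp s j * d.freq s j ^ (k + 1) *
      Real.sin (d.freq s j * t + d.phase s j + (k + 1 : ℕ) * (Real.pi / 2))) t := by
    intro j
    refine (((((hasDerivAt_id t).const_mul (d.freq s j)).add_const (d.phase s j)).add_const
      (k * (Real.pi / 2))).sin.const_mul (d.amp s j * d.freq s j ^ k)).congr_deriv ?_
    have : d.freq s j * t + d.phase s j + (k + 1 : ℕ) * (Real.pi / 2) =
        (d.freq s j * t + d.phase s j + k * (Real.pi / 2)) + Real.pi / 2 := by push_cast; ring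
    rw [this, Real.sin_add_pi_div_two]
    simp only [id]
    ring
  refine ((HasDerivAt.fun_sum fun j _ => h j).const_add (if k = 0 then d.bias s else 0)).congr_deriv
    ?_
  simp [Disturbance.derivValue]

theorem Disturbance.iteratedDeriv_value (d : Disturbance m) (s : Fin n) (k : ℕ) :
    iteratedDeriv k (d.value s) = d.derivValue s k := by
  induction k with
  | zero =>
    ext t
    simp [Disturbance.value, Disturbance.derivValue]
  | succ k ih =>
    rw [iteratedDeriv_succ, ih]
    ext t
    exact (d.hasDerivAt_derivValue s k t).deriv

theorem Disturbance.exists_bound_derivValue (d : Disturbance m) (s : Fin n) (k : ℕ) :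
    ∃ B, ∀ t, |d.derivValue s k t| ≤ B := by
  refine ⟨|if k = 0 then d.bias s else 0| + ∑ j, |d.amp s j * d.freq s j ^ k|, fun t => ?_⟩
  refine (abs_add_le _ _).trans (add_le_add le_rfl ?_)
  refine (Finset.abs_sum_le_sum_abs _ _).trans (Finset.sum_le_sum fun j _ => ?_)
  rw [abs_mul]
  exact mul_le_of_le_one_right (abs_nonneg _) (Real.abs_sin_le_one _)

theorem blockDiagonal'_mulVec_apply {r : Fin n → ℕ} (A : ∀ s, Matrix (Fin (r s)) (Fin (r s)) ℝ)
    (x : ((s : Fin n) × Fin (r s)) → ℝ) (s : Fin n) (k : Fin (r s)) :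
    (Matrix.blockDiagonal' A *ᵥ x) ⟨s, k⟩ = (A s *ᵥ fun l => x ⟨s, l⟩) k := by
  rw [Matrix.mulVec, dotProduct, Fintype.sum_sigma, Finset.sum_eq_single s]
  · simp [Matrix.mulVec, dotProduct, Matrix.blockDiagonal'_apply_eq]
  · intro s' _ hs'
    exact Finset.sum_eq_zero fun l _ => by
      rw [Matrix.blockDiagonal'_apply_ne _ _ _ hs'.symm, zero_mul]
  · simp

namespace Design

variable {p : ℕ} {D : Design n p}

theorem bigN_mulVec_apply (x : Fin n → ℝ) (s : Fin n) (k : Fin (D.r s)) :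
    (D.bigN *ᵥ x) ⟨s, k⟩ = D.N s k * x s := by
  simp [bigN, Matrix.mulVec, dotProduct]

theorem bigΨ_mulVec_apply (x : D.Idx → ℝ) (s : Fin n) (hs : 0 < D.r s) :
    (D.bigΨ *ᵥ x) s = x ⟨s, ⟨0, hs⟩⟩ := by
  rw [Matrix.mulVec, dotProduct, Fintype.sum_sigma, Finset.sum_eq_single s]
  · rw [Finset.sum_eq_single ⟨0, hs⟩]
    · simp [bigΨ, firstRow]
    · intro k _ hk
      have : (k : ℕ) ≠ 0 := fun h => hk (Fin.ext h)
      simp [bigΨ, firstRow, this]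
    · simp
  · intro s' _ hs'
    exact Finset.sum_eq_zero fun l _ => by simp [bigΨ, hs']
  · simp

/-- The disturbance is the output of an exosystem in the coordinates of the internal model. -/
theorem Models.exists_exosystem {d : Disturbance m} (h : D.Models d) (hD : D.Admissible) :
    ∃ (θ : ℝ → D.Idx → ℝ) (B : Matrix (Fin n) D.Idx ℝ) (ϱ : Fin D.l → ℝ),
      (∀ t, HasDerivAt θ (D.bigM *ᵥ θ t + D.bigN *ᵥ fun s => d.value s t) t) ∧
      (∃ C, ∀ t, ‖θ t‖ ≤ C) ∧ (∀ t, B *ᵥ θ t = fun s => d.value s t) ∧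
      D.A - B = ∑ j, ϱ j • D.E j := by
  obtain ⟨c, hode, hspec, hT⟩ := h
  choose T hTdet hTeq using fun s =>
    exists_sylvester (hD.r_pos s) (hD.hurwitz s) (hD.controllable s) (c s) (hspec s)
  obtain ⟨ϱ, hϱ⟩ := hT T fun s => ⟨hTdet s, hTeq s⟩
  have hbig : IsUnit (Matrix.blockDiagonal' T).det := by
    refine Matrix.isUnit_det_of_right_inverse (B := Matrix.blockDiagonal' fun s => (T s)⁻¹) ?_
    rw [← Matrix.blockDiagonal'_mul]
    simp_rw [fun s => Matrix.mul_nonsing_inv (T s) (hTdet s)]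
    exact Matrix.blockDiagonal'_one
  -- The stacked derivatives satisfy e' = Φe and d = Ψe. With TΦ = MT + NΨ, the vector θ = Te
  -- satisfies θ' = Mθ + Nd and d = ΨT⁻¹θ.
  set e : ℝ → D.Idx → ℝ := fun t k => d.derivValue k.1 k.2 t with he
  refine ⟨fun t => Matrix.blockDiagonal' T *ᵥ e t, D.bigΨ * (Matrix.blockDiagonal' T)⁻¹, ϱ,
    fun t => ?_, ?_, fun t => ?_, hϱ⟩
  · have hder : HasDerivAt e (Matrix.blockDiagonal' (fun s => companion (c s)) *ᵥ e t) t := by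
      refine hasDerivAt_pi.2 fun ⟨s, k⟩ => ?_
      refine (d.hasDerivAt_derivValue s k t).congr_deriv ?_
      rw [blockDiagonal'_mulVec_apply]
      by_cases hk : (k : ℕ) + 1 = D.r s
      · have := hode s t
        simp only [d.iteratedDeriv_value] at this
        simp [Matrix.mulVec, dotProduct, companion, hk, this, he]
      · have h1 : (k : ℕ) + 1 < D.r s := by have := k.2; omega
        have h2 : ∀ l : Fin (D.r s), ((l : ℕ) = k + 1) ↔ l = ⟨k + 1, h1⟩ := fun l =>
          ⟨fun h => Fin.ext h, fun h => by rw [h]⟩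
        simp [Matrix.mulVec, dotProduct, companion, hk, he, h2]
    have h1 := hasDerivWithinAt_const_mulVec (Matrix.blockDiagonal' T) hder.hasDerivWithinAt
      (J := univ)
    rw [hasDerivWithinAt_univ] at h1
    refine h1.congr_deriv ?_
    ext ⟨s, k⟩
    have h2 := congrArg (fun A => (A *ᵥ fun l => e t ⟨s, l⟩) k) (hTeq s)
    have h3 : firstRow (D.r s) ⬝ᵥ (fun l => e t ⟨s, l⟩) = d.value s t := by
      rw [dotProduct, Finset.sum_eq_single ⟨0, hD.r_pos s⟩]
      · simp [firstRow, he, ← d.iteratedDeriv_value]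
      · intro l _ hl
        have : (l : ℕ) ≠ 0 := fun h => hl (Fin.ext h)
        simp [firstRow, this]
      · simp
    simp only [Matrix.sub_mulVec, Matrix.vecMulVec_mulVec, ← Matrix.mulVec_mulVec, h3] at h2
    rw [Pi.add_apply, bigN_mulVec_apply, bigM, blockDiagonal'_mulVec_apply,
      blockDiagonal'_mulVec_apply]
    simp only [blockDiagonal'_mulVec_apply]
    simp only [Pi.sub_apply, Pi.smul_apply, MulOpposite.smul_eq_mul_unop,
      MulOpposite.unop_op] at h2
    have h4 : (T s *ᵥ fun l => (companion (c s) *ᵥ fun l => e t ⟨s, l⟩) l) k =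
      (T s *ᵥ (companion (c s) *ᵥ fun l => e t ⟨s, l⟩)) k := rfl
    have h5 : (D.M s *ᵥ fun l => (T s *ᵥ fun l => e t ⟨s, l⟩) l) k =
      (D.M s *ᵥ (T s *ᵥ fun l => e t ⟨s, l⟩)) k := rfl
    rw [h4, h5]
    linarith
  · have h1 : ∀ k : D.Idx, ∃ B, ∀ t, |e t k| ≤ B := fun k => d.exists_bound_derivValue k.1 k.2
    choose B hB using h1
    have h2 : e =O[𝓟 univ] fun _ => (1 : ℝ) :=
      isBigO_pi.2 fun k => (isBigO_principal).2 ⟨B k, fun t _ => by simpa using hB k t⟩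
    obtain ⟨C, -, hC⟩ := isBigO_one_iff_bound.1 (isBigO_const_mulVec (Matrix.blockDiagonal' T) h2)
    exact ⟨C, fun t => hC t (mem_univ t)⟩
  · rw [Matrix.mulVec_mulVec, Matrix.mul_assoc, Matrix.nonsing_inv_mul _ hbig, Matrix.mul_one]
    ext s
    rw [bigΨ_mulVec_apply _ _ (hD.r_pos s)]
    simp [he, ← d.iteratedDeriv_value]

end Design

end Exosystem

/-! ### Quadratic forms -/

section QuadraticForms

variable {ι : Type*} [Fintype ι]

theorem dotProduct_self_nonneg_real (x : ι → ℝ) : 0 ≤ x ⬝ᵥ x :=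
  Finset.sum_nonneg fun _ _ => mul_self_nonneg _

theorem dotProduct_le_young {k : ℝ} (hk : 0 < k) (x y : ι → ℝ) :
    x ⬝ᵥ y ≤ k / 2 * (x ⬝ᵥ x) + 1 / (2 * k) * (y ⬝ᵥ y) := by
  have h := dotProduct_self_nonneg_real (k • x - y)
  simp only [sub_dotProduct, dotProduct_sub, smul_dotProduct, dotProduct_smul, smul_eq_mul,
    dotProduct_comm y x] at h
  have h2 : 0 ≤ (k * (k * x ⬝ᵥ x) - k * x ⬝ᵥ y - (k * x ⬝ᵥ y - y ⬝ᵥ y)) / (2 * k) :=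
    div_nonneg (by linarith) (by positivity)
  have e : (k * (k * x ⬝ᵥ x) - k * x ⬝ᵥ y - (k * x ⬝ᵥ y - y ⬝ᵥ y)) / (2 * k) =
    k / 2 * (x ⬝ᵥ x) + 1 / (2 * k) * (y ⬝ᵥ y) - x ⬝ᵥ y := by field_simp; ring
  linarith

theorem dotProduct_self_le_norm_sq (x : ι → ℝ) : x ⬝ᵥ x ≤ Fintype.card ι * ‖x‖ ^ 2 := by
  calc x ⬝ᵥ x ≤ ∑ _i : ι, ‖x‖ ^ 2 := Finset.sum_le_sum fun i _ => by
        have := norm_le_pi_norm x i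
        rw [← pow_two, ← sq_abs, ← Real.norm_eq_abs]
        gcongr
    _ = _ := by simp

/-- The constant is the minimum of the form on the compact Euclidean unit sphere; homogeneity
extends the bound to all vectors. -/
theorem exists_lowerBound_of_posDef {n : ℕ} {K : Matrix (Fin n) (Fin n) ℝ} (hK : K.PosDef) :
    ∃ k > 0, ∀ x : Fin n → ℝ, k * (x ⬝ᵥ x) ≤ x ⬝ᵥ (K *ᵥ x) := by
  have hcont : Continuous fun x : Fin n → ℝ => x ⬝ᵥ (K *ᵥ x) := by
    unfold dotProduct Matrix.mulVec dotProduct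
    fun_prop
  have hcont' : Continuous fun x : Fin n → ℝ => x ⬝ᵥ x := by
    unfold dotProduct
    fun_prop
  have hcomp : IsCompact {x : Fin n → ℝ | x ⬝ᵥ x = 1} := by
    refine Metric.isCompact_of_isClosed_isBounded (isClosed_eq hcont' continuous_const) ?_
    refine (Metric.isBounded_closedBall (x := (0 : Fin n → ℝ)) (r := 1)).subset fun x hx => ?_
    rw [mem_closedBall_zero_iff]
    have h1 := norm_sq_le_dotProduct x
    rw [hx.out] at h1
    exact (sq_le_one_iff₀ (norm_nonneg _)).1 h1
  rcases Set.eq_empty_or_nonempty {x : Fin n → ℝ | x ⬝ᵥ x = 1} with hemp | hne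
  -- An empty sphere leaves only the zero vector (dimension zero), so any constant works.
  · refine ⟨1, one_pos, fun x => ?_⟩
    suffices h : x = 0 by simp [h]
    by_contra hx
    have hpos : 0 < x ⬝ᵥ x :=
      lt_of_le_of_ne (dotProduct_self_nonneg_real x) fun h => hx (dotProduct_self_eq_zero.1 h.symm)
    have : (√(x ⬝ᵥ x))⁻¹ • x ∈ {x : Fin n → ℝ | x ⬝ᵥ x = 1} := by
      simp only [mem_ofPred_eq, smul_dotProduct, dotProduct_smul, smul_eq_mul]
      rw [← mul_assoc, ← mul_inv, Real.mul_self_sqrt hpos.le, inv_mul_cancel₀ hpos.ne']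
    rw [hemp] at this
    exact this
  · obtain ⟨y, hy, hmin⟩ := hcomp.exists_isMinOn hne hcont.continuousOn
    have hy0 : y ≠ 0 := fun h => by simp [h] at hy
    refine ⟨y ⬝ᵥ (K *ᵥ y), by simpa using hK.dotProduct_mulVec_pos hy0, fun x => ?_⟩
    by_cases hx : x = 0
    · simp [hx]
    have hpos : 0 < x ⬝ᵥ x :=
      lt_of_le_of_ne (dotProduct_self_nonneg_real x) fun h => hx (dotProduct_self_eq_zero.1 h.symm)
    have hmem : (√(x ⬝ᵥ x))⁻¹ • x ∈ {x : Fin n → ℝ | x ⬝ᵥ x = 1} := by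
      simp only [mem_ofPred_eq, smul_dotProduct, dotProduct_smul, smul_eq_mul]
      rw [← mul_assoc, ← mul_inv, Real.mul_self_sqrt hpos.le, inv_mul_cancel₀ hpos.ne']
    have h1 : y ⬝ᵥ (K *ᵥ y) ≤ _ := hmin hmem
    simp only [Matrix.mulVec_smul, smul_dotProduct, dotProduct_smul, smul_eq_mul] at h1
    rw [← mul_assoc, ← mul_inv, Real.mul_self_sqrt hpos.le, inv_mul_eq_div, le_div_iff₀ hpos] at h1
    exact h1

theorem dotProduct_mulVec_self_of_skew {A : Matrix ι ι ℝ} (hA : Aᵀ = -A) (x : ι → ℝ) :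
    x ⬝ᵥ (A *ᵥ x) = 0 := by
  have h : x ⬝ᵥ (A *ᵥ x) = -(x ⬝ᵥ (A *ᵥ x)) := by
    conv_lhs => rw [dotProduct_comm, ← Matrix.vecMul_transpose, hA, ← Matrix.dotProduct_mulVec]
    rw [Matrix.neg_mulVec, dotProduct_neg]
  linarith

end QuadraticForms

/-! ### One agent under its controller -/

section Agent

variable {n p : ℕ} {D : Design n p} {Pl : Plant n p} {Y : Regressor (Fin n) n p}
  {m : Fin n → ℕ} {d : Disturbance m} {α : ℝ} {J : Set ℝ} {x : ℝ → D.State}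
  {dS : ℝ → Matrix (Fin n) (Fin n) ℝ} {dη : ℝ → Fin n → ℝ}

/-- The closed-loop equations of one agent on a time interval, for given derivatives of the
observer states. -/
structure IsAgentSolution (D : Design n p) (Pl : Plant n p) (d : Disturbance m) (α : ℝ)
    (J : Set ℝ) (x : ℝ → D.State) (dS : ℝ → Matrix (Fin n) (Fin n) ℝ) (dη : ℝ → Fin n → ℝ) :
    Prop where
  position : ∀ t ∈ J, HasDerivWithinAt (fun t => (x t).q) (x t).v J t
  velocity : ∀ t ∈ J, ∃ acc : Fin n → ℝ,
    HasDerivWithinAt (fun t => (x t).v) acc J t ∧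
    Pl.inertia (x t).q *ᵥ acc + Pl.coriolis (x t).q (x t).v *ᵥ (x t).v + Pl.gravity (x t).q =
      (x t).torque α (dS t) (dη t) + fun s => d.value s t
  observer_S : ∀ t ∈ J, ∀ j k, HasDerivWithinAt (fun t => (x t).S j k) (dS t j k) J t
  observer_η : ∀ t ∈ J, HasDerivWithinAt (fun t => (x t).η) (dη t) J t
  compensator : ∀ t ∈ J, HasDerivWithinAt (fun t => (x t).ξ)
    (D.bigM *ᵥ (x t).ξ + D.bigN *ᵥ (x t).torque α (dS t) (dη t)) J t
  auxiliary : ∀ t ∈ J, ∀ j k, HasDerivWithinAt (fun t => (x t).ζ j k)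
    ((D.bigM * (x t).ζ + D.P (x t).q (x t).v ((x t).refAcc α (dS t) (dη t))
      ((x t).refVel α)) j k) J t
  estimator : ∀ t ∈ J, HasDerivWithinAt (fun t => (x t).ω)
    (fun k => (D.Λ k)⁻¹ * (((x t).rho α (dS t) (dη t))ᵀ *ᵥ (x t).slide α) k) J t

namespace IsAgentSolution

theorem deriv_refVel (h : IsAgentSolution D Pl d α J x dS dη) {t : ℝ} (ht : t ∈ J) :
    HasDerivWithinAt (fun t => (x t).refVel α) ((x t).refAcc α (dS t) (dη t)) J t :=
  (hasDerivWithinAt_mulVec (h.observer_S t ht) (h.observer_η t ht)).sub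
    (((h.position t ht).sub (h.observer_η t ht)).const_smul α)

/-- The regression identity at (q̈_r, q̇_r) is subtracted from the equation of motion; C(q, q̇) is
linear in its last argument, so only s remains next to it. -/
theorem deriv_slide (h : IsAgentSolution D Pl d α J x dS dη) (hPl : Pl.IsEulerLagrange Y)
    {t : ℝ} (ht : t ∈ J) : ∃ s' : Fin n → ℝ,
      HasDerivWithinAt (fun t => (x t).slide α) s' J t ∧
      Pl.inertia (x t).q *ᵥ s' = (x t).torque α (dS t) (dη t) + (fun s => d.value s t)
        - Pl.coriolis (x t).q (x t).v *ᵥ (x t).slide α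
        - Y (x t).q (x t).v ((x t).refAcc α (dS t) (dη t)) ((x t).refVel α) *ᵥ Pl.param := by
  obtain ⟨acc, hacc, heq⟩ := h.velocity t ht
  refine ⟨acc - (x t).refAcc α (dS t) (dη t), hacc.sub (h.deriv_refVel ht), ?_⟩
  rw [← hPl.regression, Design.State.slide, Matrix.mulVec_sub, Matrix.mulVec_sub, ← heq]
  abel

theorem deriv_inertia (h : IsAgentSolution D Pl d α J x dS dη) (hPl : Pl.IsEulerLagrange Y)
    {t : ℝ} (ht : t ∈ J) (i j : Fin n) :
    HasDerivWithinAt (fun t => Pl.inertia (x t).q i j)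
      (Pl.inertiaRate (x t).q (x t).v i j) J t :=
  HasFDerivAt.comp_hasDerivWithinAt (l := fun q => Pl.inertia q i j) (f := fun t => (x t).q) t
    (hPl.inertia_differentiable i j (x t).q).hasFDerivAt (h.position t ht)

end IsAgentSolution

/-- The part of the compensator and filter states that decays whatever the plant does. -/
noncomputable def modelError (Pl : Plant n p) (α : ℝ) (θ : ℝ → D.Idx → ℝ) (x : ℝ → D.State)
    (t : ℝ) : D.Idx → ℝ :=
  (x t).ξ + θ t - D.bigN *ᵥ (Pl.inertia (x t).q *ᵥ (x t).slide α) - (x t).ζ *ᵥ Pl.param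

/-- The value `(Θ, -ϱ ⊗ Θ, ϱ)` at which the regression is exact. -/
noncomputable def exactParam (D : Design n p) (Pl : Plant n p) (ϱ : Fin D.l → ℝ) : D.Par → ℝ :=
  Sum.elim Pl.param (Sum.elim (fun jk => -(ϱ jk.1 * Pl.param jk.2)) ϱ)

/-- Collected, the right-hand side is B(ζΘ + N M(q)s) + (A - B)ξ - YΘ. The unknown B enters through
A - B = ∑ ϱ_j E_j, and its products with Θ become linear in the enlarged parameter; this is why ρ
has three blocks. -/
theorem rho_mulVec_exactParam (hReg : D.Regresses Y Pl) (x : D.State) (α : ℝ)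
    (dS : Matrix (Fin n) (Fin n) ℝ) (dη : Fin n → ℝ) (ϱ : Fin D.l → ℝ) {B : Matrix (Fin n) D.Idx ℝ}
    (hB : D.A - B = ∑ j, ϱ j • D.E j) :
    x.rho α dS dη *ᵥ exactParam D Pl ϱ =
      D.A *ᵥ (x.ζ *ᵥ Pl.param) + D.A *ᵥ (D.bigN *ᵥ (Pl.inertia x.q *ᵥ x.slide α))
      - Y x.q x.v (x.refAcc α dS dη) (x.refVel α) *ᵥ Pl.param
      - (D.A - B) *ᵥ (x.ζ *ᵥ Pl.param + D.bigN *ᵥ (Pl.inertia x.q *ᵥ x.slide α))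
      + (D.A - B) *ᵥ x.ξ := by
  have hQ := hReg.Q_eq x.q x.v (x.refAcc α dS dη) (x.refVel α)
  have hL := hReg.L_eq x.q (x.slide α)
  have h1 : (D.A * x.ζ + D.Q x.q x.v (x.refAcc α dS dη) (x.refVel α)) *ᵥ Pl.param =
      D.A *ᵥ (x.ζ *ᵥ Pl.param) + (D.A *ᵥ (D.bigN *ᵥ (Pl.inertia x.q *ᵥ x.slide α))
      - Y x.q x.v (x.refAcc α dS dη) (x.refVel α) *ᵥ Pl.param) := by
    rw [Matrix.add_mulVec, hQ, ← Matrix.mulVec_mulVec, Design.State.slide]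
  have h2 : (Matrix.of fun (i : Fin n) (jk : Fin D.l × Fin p) =>
      (D.E jk.1 * (x.ζ + D.bigN * D.L x.q (x.slide α))) i jk.2) *ᵥ
      (fun jk => -(ϱ jk.1 * Pl.param jk.2)) =
      -((D.A - B) *ᵥ (x.ζ *ᵥ Pl.param + D.bigN *ᵥ (Pl.inertia x.q *ᵥ x.slide α))) := by
    have e : x.ζ *ᵥ Pl.param + D.bigN *ᵥ (Pl.inertia x.q *ᵥ x.slide α) =
        (x.ζ + D.bigN * D.L x.q (x.slide α)) *ᵥ Pl.param := by
      rw [Matrix.add_mulVec, ← Matrix.mulVec_mulVec, hL]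
    rw [e, hB]
    ext i
    simp only [Pi.neg_apply, Matrix.sum_mulVec, Matrix.smul_mulVec, Finset.sum_apply,
      Pi.smul_apply, smul_eq_mul]
    rw [← Finset.sum_neg_distrib]
    refine (Fintype.sum_prod_type _).trans (Finset.sum_congr rfl fun j _ => ?_)
    rw [Matrix.mulVec_mulVec, Matrix.mulVec, dotProduct, Finset.mul_sum,
      ← Finset.sum_neg_distrib]
    refine Finset.sum_congr rfl fun k _ => ?_
    change (D.E j * (x.ζ + D.bigN * D.L x.q (x.slide α))) i k * -(ϱ j * Pl.param k) = _
    ring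
  have h3 : (Matrix.of fun (i : Fin n) (j : Fin D.l) => (D.E j *ᵥ x.ξ) i) *ᵥ ϱ =
      (D.A - B) *ᵥ x.ξ := by
    rw [hB]
    ext i
    simp only [Matrix.sum_mulVec, Matrix.smul_mulVec, Finset.sum_apply, Pi.smul_apply, smul_eq_mul]
    rw [Matrix.mulVec, dotProduct]
    exact Finset.sum_congr rfl fun j _ => mul_comm _ _
  rw [Design.State.rho, exactParam, Matrix.fromCols_mulVec, Matrix.fromCols_mulVec]
  simp only [Sum.elim_comp_inl, Sum.elim_comp_inr]
  rw [h1, h2, h3]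
  abel

namespace IsAgentSolution

/-- In the derivative of ξ + θ - N M(q)s, torque and disturbance cancel and N(Cs - Ṁs + YΘ) is left
over. These are the terms of PΘ that the filter ζ subtracts, while the remaining term M N M(q)s
completes Mε. -/
theorem deriv_modelError (h : IsAgentSolution D Pl d α J x dS dη) (hPl : Pl.IsEulerLagrange Y)
    (hReg : D.Regresses Y Pl) {θ : ℝ → D.Idx → ℝ}
    (hθ : ∀ t, HasDerivAt θ (D.bigM *ᵥ θ t + D.bigN *ᵥ fun s => d.value s t) t)
    {t : ℝ} (ht : t ∈ J) :
    HasDerivWithinAt (modelError Pl α θ x) (D.bigM *ᵥ modelError Pl α θ x t) J t := by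
  obtain ⟨s', hs', heq⟩ := h.deriv_slide hPl ht
  have h1 := hasDerivWithinAt_const_mulVec D.bigN
    (hasDerivWithinAt_mulVec (h.deriv_inertia hPl ht) hs')
  have h2 := hasDerivWithinAt_mulVec (h.auxiliary t ht) (hasDerivWithinAt_const t J Pl.param)
  refine ((((h.compensator t ht).add (hθ t).hasDerivWithinAt).sub h1).sub h2).congr_deriv ?_
  have hP := hReg.P_eq (x t).q (x t).v ((x t).refAcc α (dS t) (dη t)) ((x t).refVel α)
  have hs : (x t).v - (x t).refVel α = (x t).slide α := rfl
  rw [hs] at hP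
  rw [modelError, heq]
  simp only [Matrix.add_mulVec, hP, Matrix.mulVec_zero, add_zero, Matrix.mulVec_add,
    Matrix.mulVec_sub, ← Matrix.mulVec_mulVec]
  abel

/-- Inserting the exact parameter into the torque leaves Aξ + d - YΘ - ρω* = B(ξ + θ - N M(q)s -
ζΘ): the disturbance is compensated up to the decaying model error. -/
theorem deriv_slide_eq (h : IsAgentSolution D Pl d α J x dS dη) (hPl : Pl.IsEulerLagrange Y)
    (hReg : D.Regresses Y Pl) {θ : ℝ → D.Idx → ℝ} {B : Matrix (Fin n) D.Idx ℝ} {ϱ : Fin D.l → ℝ}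
    (hθd : ∀ t, B *ᵥ θ t = fun s => d.value s t) (hB : D.A - B = ∑ j, ϱ j • D.E j)
    {t : ℝ} (ht : t ∈ J) : ∃ s' : Fin n → ℝ,
      HasDerivWithinAt (fun t => (x t).slide α) s' J t ∧
      Pl.inertia (x t).q *ᵥ s' = -(Pl.coriolis (x t).q (x t).v *ᵥ (x t).slide α)
        - D.K *ᵥ (x t).slide α
        - (x t).rho α (dS t) (dη t) *ᵥ ((x t).ω - exactParam D Pl ϱ)
        + B *ᵥ modelError Pl α θ x t := by
  obtain ⟨s', hs', heq⟩ := h.deriv_slide hPl ht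
  refine ⟨s', hs', ?_⟩
  rw [heq, Matrix.mulVec_sub, rho_mulVec_exactParam hReg (x t) α (dS t) (dη t) ϱ hB,
    Design.State.torque, modelError, ← hθd t]
  simp only [Matrix.mulVec_add, Matrix.mulVec_sub, Matrix.sub_mulVec]
  abel

theorem modelError_isBigO (h : IsAgentSolution D Pl d α J x dS dη) (hJ : IsTimeInterval J)
    (hD : D.Admissible) (hPl : Pl.IsEulerLagrange Y)
    (hReg : D.Regresses Y Pl) {θ : ℝ → D.Idx → ℝ}
    (hθ : ∀ t, HasDerivAt θ (D.bigM *ᵥ θ t + D.bigN *ᵥ fun s => d.value s t) t) :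
    ∃ b > 0, modelError Pl α θ x =O[𝓟 J] fun t => Real.exp (-b * t) := by
  -- Every small enough rate works for each of the finitely many blocks, so one rate serves all.
  have hgap := eventually_all.2 fun s => eventually_gap_of_spectrum _ (hD.hurwitz s)
  obtain ⟨b, hb, hb0⟩ := (hgap.and self_mem_nhdsWithin).exists
  refine ⟨b, hb0, isBigO_pi.2 fun ⟨s, k⟩ => ?_⟩
  refine isBigO_pi.1 (hJ.isBigO_of_spectrum (D.M s) (b := -b)
    (x := fun t k => modelError Pl α θ x t ⟨s, k⟩) (g := 0)
    (fun z hz => by simpa using hb s z hz) (fun t ht => ?_) (isBigO_zero _ _)) k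
  have h1 := hasDerivWithinAt_pi.1 (h.deriv_modelError hPl hReg hθ ht)
  refine hasDerivWithinAt_pi.2 fun k => (h1 ⟨s, k⟩).congr_deriv ?_
  rw [Design.bigM, blockDiagonal'_mulVec_apply]
  simp

/-- The Lyapunov function of the agent. -/
theorem exists_lyapunov (h : IsAgentSolution D Pl d α J x dS dη) (hJ : IsTimeInterval J)
    (hD : D.Admissible) (hPl : Pl.IsEulerLagrange Y) (hReg : D.Regresses Y Pl)
    (hd : D.Models d) :
    ∃ (W W' : ℝ → ℝ) (k : ℝ), 0 < k ∧ (∀ t ∈ J, HasDerivWithinAt W (W' t) J t) ∧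
      (∀ t ∈ J, W' t ≤ -k * ((x t).slide α ⬝ᵥ (x t).slide α)) ∧ (∀ t ∈ J, 0 ≤ W t) ∧
      (fun t => (x t).slide α) =O[𝓟 J] (fun _ => (1 : ℝ)) ∧
      (fun t => (x t).ω) =O[𝓟 J] fun _ => (1 : ℝ) := by
  obtain ⟨θ, B, ϱ, hθ, -, hθd, hB⟩ := hd.exists_exosystem hD
  obtain ⟨b, hb0, hε⟩ := h.modelError_isBigO hJ hD hPl hReg hθ
  obtain ⟨C, hC0, hC⟩ := isBigO_exp_iff.1 (isBigO_const_mulVec B hε)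
  obtain ⟨k, hk0, hk⟩ := exists_lowerBound_of_posDef hD.K_posDef
  obtain ⟨k₁, k₂, hk₁, -, hM⟩ := hPl.inertia_bounds
  choose! s' hs' hMs' using fun t (ht : t ∈ J) => h.deriv_slide_eq hPl hReg hθd hB ht
  set s := fun t => (x t).slide α with hs
  set ωs := exactParam D Pl ϱ with hωs
  -- Young's inequality bounds s·Bε by (k/2)|s|² + c e^{-2bt}. The first term costs half of the
  -- damping by K; the second is cancelled by the derivative of F below.
  set c := 1 / (2 * k) * (n * C ^ 2) with hc
  have hc0 : 0 ≤ c := by positivity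
  set V : ℝ → ℝ := fun t => 1 / 2 * (s t ⬝ᵥ (Pl.inertia (x t).q *ᵥ s t)) +
    ∑ j, 1 / 2 * (D.Λ j * ((x t).ω j - ωs j) ^ 2) with hV
  set F : ℝ → ℝ := fun t => c / (2 * b) * Real.exp (-(2 * b) * t) with hF
  have hΛ : ∀ t j, 0 ≤ 1 / 2 * (D.Λ j * ((x t).ω j - ωs j) ^ 2) := fun t j => by
    have := hD.Λ_pos j
    positivity
  have hV1 : ∀ t, k₁ / 2 * (s t ⬝ᵥ s t) ≤ 1 / 2 * (s t ⬝ᵥ (Pl.inertia (x t).q *ᵥ s t)) :=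
    fun t => by have := (hM (x t).q (s t)).1; linarith
  have hV0 : ∀ t, 0 ≤ 1 / 2 * (s t ⬝ᵥ (Pl.inertia (x t).q *ᵥ s t)) := fun t =>
    (mul_nonneg (by positivity) (dotProduct_self_nonneg_real _)).trans (hV1 t)
  have hF0 : ∀ t, 0 ≤ F t := fun t => by positivity
  have hder : ∀ t ∈ J, HasDerivWithinAt (fun t => V t + F t)
      (-(s t ⬝ᵥ (D.K *ᵥ s t)) + s t ⬝ᵥ (B *ᵥ modelError Pl α θ x t)
        - c * Real.exp (-(2 * b) * t)) J t := by
    intro t ht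
    have h1 := hasDerivWithinAt_dotProduct (hs' t ht)
      (hasDerivWithinAt_mulVec (h.deriv_inertia hPl ht) (hs' t ht))
    have h2 : ∀ j, HasDerivWithinAt (fun t => 1 / 2 * (D.Λ j * ((x t).ω j - ωs j) ^ 2))
        (((x t).ω j - ωs j) * (((x t).rho α (dS t) (dη t))ᵀ *ᵥ s t) j) J t := by
      intro j
      have h3 := hasDerivWithinAt_pi.1 (h.estimator t ht) j
      refine ((((h3.sub_const (ωs j)).pow 2).const_mul (D.Λ j)).const_mul (1 / 2)).congr_deriv ?_
      have := (hD.Λ_pos j).ne'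
      simp only [Nat.cast_ofNat, Nat.add_one_sub_one, pow_one]
      field_simp
      rfl
    have h3 : HasDerivAt F (-(c * Real.exp (-(2 * b) * t))) t :=
      ((hasDerivAt_exp_mul (-(2 * b)) t).const_mul (c / (2 * b))).congr_deriv (by field_simp)
    refine (((h1.const_mul (1 / 2)).add (HasDerivWithinAt.fun_sum fun j _ => h2 j)).add
      h3.hasDerivWithinAt).congr_deriv ?_
    -- Three cancellations: symmetry of M merges the two terms with s', skewness of Ṁ - 2C removes ½
    -- s·Ṁs - s·Cs, and the update law removes s·ρ(ω̂ - ω*).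
    have e1 : s' t ⬝ᵥ (Pl.inertia (x t).q *ᵥ s t) = s t ⬝ᵥ (Pl.inertia (x t).q *ᵥ s' t) := by
      rw [Matrix.dotProduct_mulVec, ← Matrix.mulVec_transpose, (hPl.inertia_symm _).eq,
        dotProduct_comm]
    have e2 : ∑ j, ((x t).ω j - ωs j) * (((x t).rho α (dS t) (dη t))ᵀ *ᵥ s t) j =
        s t ⬝ᵥ ((x t).rho α (dS t) (dη t) *ᵥ ((x t).ω - ωs)) := by
      rw [Matrix.dotProduct_mulVec, ← Matrix.mulVec_transpose, dotProduct_comm]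
      rfl
    have e3 := dotProduct_mulVec_self_of_skew (hPl.skew (x t).q (x t).v) (s t)
    rw [Matrix.sub_mulVec, dotProduct_sub, Matrix.smul_mulVec, dotProduct_smul, smul_eq_mul] at e3
    rw [e2, dotProduct_add, e1, hMs' t ht]
    simp only [dotProduct_add, dotProduct_sub, dotProduct_neg]
    linarith
  have hder' : ∀ t ∈ J, -(s t ⬝ᵥ (D.K *ᵥ s t)) + s t ⬝ᵥ (B *ᵥ modelError Pl α θ x t)
        - c * Real.exp (-(2 * b) * t) ≤ -(k / 2) * (s t ⬝ᵥ s t) := by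
    intro t ht
    have h1 := hk (s t)
    have h2 := dotProduct_le_young hk0 (s t) (B *ᵥ modelError Pl α θ x t)
    have h3 : B *ᵥ modelError Pl α θ x t ⬝ᵥ B *ᵥ modelError Pl α θ x t ≤
        n * C ^ 2 * Real.exp (-(2 * b) * t) := by
      refine (dotProduct_self_le_norm_sq _).trans ?_
      rw [Fintype.card_fin, mul_assoc]
      refine mul_le_mul_of_nonneg_left ?_ (Nat.cast_nonneg n)
      have e : Real.exp (-(2 * b) * t) = Real.exp (-b * t) ^ 2 := by
        rw [← Real.exp_nat_mul]; push_cast; ring_nf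
      rw [e, ← mul_pow]
      gcongr
      exact hC t ht
    have h4 : 1 / (2 * k) * (B *ᵥ modelError Pl α θ x t ⬝ᵥ B *ᵥ modelError Pl α θ x t) ≤
        c * Real.exp (-(2 * b) * t) := by
      rw [hc, mul_assoc (1 / (2 * k))]
      gcongr
    linarith
  have hle : ∀ t ∈ J, V t + F t ≤ V 0 + F 0 := hJ.le_of_deriv_nonpos hder fun t ht => by
    have h1 := hder' t ht
    have h2 := mul_nonneg (half_pos hk0).le (dotProduct_self_nonneg_real (s t))
    linarith
  refine ⟨_, _, k / 2, half_pos hk0, hder, hder', fun t ht => ?_, ?_, ?_⟩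
  · exact add_nonneg (add_nonneg (hV0 t) (Finset.sum_nonneg fun j _ => hΛ t j)) (hF0 t)
  · refine isBigO_one_iff_bound.2 ⟨√((V 0 + F 0) / (k₁ / 2)), Real.sqrt_nonneg _, fun t ht => ?_⟩
    refine Real.le_sqrt_of_sq_le ((norm_sq_le_dotProduct _).trans ?_)
    rw [le_div_iff₀ (by positivity), mul_comm]
    have h1 := hle t ht
    have h2 : 0 ≤ ∑ j, 1 / 2 * (D.Λ j * ((x t).ω j - ωs j) ^ 2) :=
      Finset.sum_nonneg fun j _ => hΛ t j
    have h3 := hV1 t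
    have h4 := hF0 t
    simp only [hV] at h1 ⊢
    linarith
  · refine isBigO_pi.2 fun j => isBigO_one_iff_bound.2
      ⟨√((V 0 + F 0) / (D.Λ j / 2)) + |ωs j|, by positivity, fun t ht => ?_⟩
    have h1 := hle t ht
    have h2 := Finset.single_le_sum (f := fun j => 1 / 2 * (D.Λ j * ((x t).ω j - ωs j) ^ 2))
      (fun j _ => hΛ t j) (Finset.mem_univ j)
    have h3 := hV0 t
    have h4 := hF0 t
    have hΛj := hD.Λ_pos j
    have h5 : |(x t).ω j - ωs j| ≤ √((V 0 + F 0) / (D.Λ j / 2)) := by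
      refine Real.le_sqrt_of_sq_le ?_
      rw [sq_abs, le_div_iff₀ (by positivity)]
      simp only [hV] at h1 h2 ⊢
      linarith
    rw [Real.norm_eq_abs]
    have h6 := abs_add_le ((x t).ω j - ωs j) (ωs j)
    rw [sub_add_cancel] at h6
    linarith

end IsAgentSolution

end Agent

/-! ### Bounded signals -/

theorem IsTimeInterval.isBigO_one_of_scalar {J : Set ℝ} (hJ : IsTimeInterval J) {y h : ℝ → ℝ}
    {α : ℝ} (hα : 0 < α) (hy : ∀ t ∈ J, HasDerivWithinAt y (-α * y t + h t) J t)
    (hh : h =O[𝓟 J] fun _ => (1 : ℝ)) : y =O[𝓟 J] fun _ => (1 : ℝ) := by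
  have := hJ.isBigO_of_scalar (y := fun t => (y t : ℂ)) (h := fun t => (h t : ℂ)) (z := (-α : ℝ))
    (b := 0) (by simpa using hα)
    (fun t ht => (hy t ht).ofReal_comp.congr_deriv (by push_cast; ring))
    (by rw [← isBigO_norm_left] at hh ⊢; simpa using hh)
  rw [← isBigO_norm_left] at this ⊢
  simpa using this

theorem isBigO_one_mulVec {ι κ : Type*} [Fintype ι] [Fintype κ] {l : Filter ℝ}
    {A : ℝ → Matrix ι κ ℝ} {x : ℝ → κ → ℝ} (hA : ∀ i j, (fun t => A t i j) =O[l] fun _ => (1 : ℝ))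
    (hx : x =O[l] fun _ => (1 : ℝ)) : (fun t => A t *ᵥ x t) =O[l] fun _ => (1 : ℝ) := by
  simpa using isBigO_mulVec hA hx

theorem isBigO_one_const_mul_apply {ι κ ν : Type*} [Fintype κ] {l : Filter ℝ} (A : Matrix ι κ ℝ)
    {B : ℝ → Matrix κ ν ℝ} (hB : ∀ i j, (fun t => B t i j) =O[l] fun _ => (1 : ℝ)) (i : ι) (j : ν) :
    (fun t => (A * B t) i j) =O[l] fun _ => (1 : ℝ) := by
  simp only [Matrix.mul_apply]
  exact IsBigO.fun_sum fun k _ => (hB k j).const_mul_left _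

theorem isBigO_one_dotProduct {ι : Type*} [Fintype ι] {l : Filter ℝ} {x y : ℝ → ι → ℝ}
    (hx : x =O[l] fun _ => (1 : ℝ)) (hy : y =O[l] fun _ => (1 : ℝ)) :
    (fun t => x t ⬝ᵥ y t) =O[l] fun _ => (1 : ℝ) := by
  rw [isBigO_pi] at hx hy
  simp only [dotProduct]
  exact IsBigO.fun_sum fun k _ => by simpa using (hx k).mul (hy k)

/-! ### Boundedness and convergence of the signals of one agent -/

section Agent

variable {n p : ℕ} {D : Design n p} {Pl : Plant n p} {Y : Regressor (Fin n) n p}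
  {m : Fin n → ℕ} {d : Disturbance m} {α : ℝ} {J : Set ℝ} {x : ℝ → D.State}
  {dS : ℝ → Matrix (Fin n) (Fin n) ℝ} {dη : ℝ → Fin n → ℝ}

namespace IsAgentSolution

/-- The reference velocity is designed for this: q - η passes through a stable filter whose input is
s plus the mismatch Sη - η' caused by the coupling. -/
theorem deriv_positionError (h : IsAgentSolution D Pl d α J x dS dη) {t : ℝ} (ht : t ∈ J)
    (j : Fin n) : HasDerivWithinAt (fun t => ((x t).q - (x t).η) j)
      (-α * ((x t).q - (x t).η) j + ((x t).slide α + ((x t).S *ᵥ (x t).η - dη t)) j) J t := by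
  refine (hasDerivWithinAt_pi.1 ((h.position t ht).sub (h.observer_η t ht)) j).congr_deriv ?_
  simp [Design.State.slide, Design.State.refVel]
  ring

theorem positionError_isBigO (h : IsAgentSolution D Pl d α J x dS dη) (hJ : IsTimeInterval J)
    (hα : 0 < α) (hs : (fun t => (x t).slide α) =O[𝓟 J] fun _ => (1 : ℝ))
    (hdη : (fun t => (x t).S *ᵥ (x t).η - dη t) =O[𝓟 J] fun _ => (1 : ℝ)) :
    (fun t => (x t).q - (x t).η) =O[𝓟 J] fun _ => (1 : ℝ) :=
  isBigO_pi.2 fun j => hJ.isBigO_one_of_scalar hα (fun _ ht => h.deriv_positionError ht j)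
    (isBigO_pi.1 (hs.add hdη) j)

theorem positionError_tendsto (h : IsAgentSolution D Pl d α (Ici 0) x dS dη)
    (hα : 0 < α) (hs : Tendsto (fun t => (x t).slide α) atTop (𝓝 0))
    (hdη : Tendsto (fun t => (x t).S *ᵥ (x t).η - dη t) atTop (𝓝 0)) :
    Tendsto (fun t => (x t).q - (x t).η) atTop (𝓝 0) := by
  refine tendsto_pi_nhds.2 fun j => tendsto_zero_of_deriv_eq hα
    (fun _ ht => h.deriv_positionError ht j) ?_
  have := tendsto_pi_nhds.1 (hs.add hdη) j
  simpa using this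

/-- The regression matrix `P` along the solution. -/
abbrev pathP (α : ℝ) (x : ℝ → D.State) (dS : ℝ → Matrix (Fin n) (Fin n) ℝ) (dη : ℝ → Fin n → ℝ)
    (t : ℝ) : Matrix D.Idx (Fin p) ℝ :=
  D.P (x t).q (x t).v ((x t).refAcc α (dS t) (dη t)) ((x t).refVel α)

/-- The regression matrix `Q` along the solution. -/
abbrev pathQ (α : ℝ) (x : ℝ → D.State) (dS : ℝ → Matrix (Fin n) (Fin n) ℝ) (dη : ℝ → Fin n → ℝ)
    (t : ℝ) : Matrix (Fin n) (Fin p) ℝ :=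
  D.Q (x t).q (x t).v ((x t).refAcc α (dS t) (dη t)) ((x t).refVel α)

theorem filter_isBigO (h : IsAgentSolution D Pl d α J x dS dη) (hJ : IsTimeInterval J)
    (hD : D.Admissible)
    (hP : ∀ i j, (fun t => pathP α x dS dη t i j) =O[𝓟 J] fun _ => (1 : ℝ)) (i : D.Idx)
    (j : Fin p) : (fun t => (x t).ζ i j) =O[𝓟 J] fun _ => (1 : ℝ) := by
  obtain ⟨s, k⟩ := i
  have := hJ.isBigO_of_spectrum (D.M s) (b := 0) (hD.hurwitz s)
    (x := fun t k => (x t).ζ ⟨s, k⟩ j) (g := fun t k => pathP α x dS dη t ⟨s, k⟩ j)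
    (fun t ht => hasDerivWithinAt_pi.2 fun k => (h.auxiliary t ht ⟨s, k⟩ j).congr_deriv (by
      rw [Matrix.add_apply, Pi.add_apply]
      congr 1
      exact blockDiagonal'_mulVec_apply D.M (fun i => (x t).ζ i j) s k))
    (isBigO_pi.2 fun k => by simpa using hP ⟨s, k⟩ j)
  simpa using isBigO_pi.1 this k

/-- The equation of ξ is of no direct use, since the torque contains Aξ and ρω̂. Instead ξ is
recovered algebraically from the model error, θ, N M(q)s and ζΘ, all of which are bounded. -/
theorem compensator_isBigO (h : IsAgentSolution D Pl d α J x dS dη) (hJ : IsTimeInterval J)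
    (hD : D.Admissible) (hPl : Pl.IsEulerLagrange Y) (hReg : D.Regresses Y Pl)
    (hd : D.Models d)
    (hζ : ∀ i j, (fun t => (x t).ζ i j) =O[𝓟 J] fun _ => (1 : ℝ))
    (hL : ∀ i j, (fun t => D.L (x t).q ((x t).slide α) i j) =O[𝓟 J] fun _ => (1 : ℝ)) :
    (fun t => (x t).ξ) =O[𝓟 J] fun _ => (1 : ℝ) := by
  obtain ⟨θ, B, ϱ, hθ, ⟨C, hC⟩, hθd, hB⟩ := hd.exists_exosystem hD
  obtain ⟨b, hb0, hε⟩ := h.modelError_isBigO hJ hD hPl hReg hθ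
  have hε1 : modelError Pl α θ x =O[𝓟 J] fun _ => (1 : ℝ) := by
    simpa using hε.trans (hJ.exp_isBigO_exp (c := 0) (by linarith))
  have hθ1 : θ =O[𝓟 J] fun _ => (1 : ℝ) :=
    isBigO_principal.2 ⟨C, fun t _ => by simpa using hC t⟩
  have hMs : (fun t => Pl.inertia (x t).q *ᵥ (x t).slide α) =O[𝓟 J] fun _ => (1 : ℝ) := by
    simp_rw [← hReg.L_eq]
    exact isBigO_one_mulVec hL (isBigO_const_const _ one_ne_zero _)
  have hζΘ := isBigO_one_mulVec hζ (isBigO_const_const Pl.param (one_ne_zero (α := ℝ)) (𝓟 J))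
  have := (((hε1.sub hθ1).add (isBigO_const_mulVec D.bigN hMs)).add hζΘ)
  refine this.congr_left fun t => ?_
  simp only [modelError]
  abel

theorem rho_isBigO
    (hζ : ∀ i j, (fun t => (x t).ζ i j) =O[𝓟 J] fun _ => (1 : ℝ))
    (hξ : (fun t => (x t).ξ) =O[𝓟 J] fun _ => (1 : ℝ))
    (hQ : ∀ i j, (fun t => pathQ α x dS dη t i j) =O[𝓟 J] fun _ => (1 : ℝ))
    (hL : ∀ i j, (fun t => D.L (x t).q ((x t).slide α) i j) =O[𝓟 J] fun _ => (1 : ℝ))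
    (i : Fin n) (j : D.Par) :
    (fun t => (x t).rho α (dS t) (dη t) i j) =O[𝓟 J] fun _ => (1 : ℝ) := by
  rcases j with j | ⟨j, k⟩ | j
  · exact (isBigO_one_const_mul_apply D.A hζ i j).add (hQ i j)
  · exact isBigO_one_const_mul_apply (D.E j) (B := fun t => (x t).ζ + D.bigN * D.L (x t).q
      ((x t).slide α)) (fun i j => (hζ i j).add (isBigO_one_const_mul_apply D.bigN hL i j)) i k
  · exact isBigO_pi.1 (isBigO_const_mulVec (D.E j) hξ) i

/-- Barbalat for |s|²: the Lyapunov function dissipates a multiple of it, and its derivative is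
bounded once s' is. The position enters only through the values of P, Q and L, so q itself may be
unbounded. -/
theorem slide_tendsto (h : IsAgentSolution D Pl d α (Ici 0) x dS dη)
    (hD : D.Admissible) (hPl : Pl.IsEulerLagrange Y) (hReg : D.Regresses Y Pl)
    (hd : D.Models d)
    (hv : (fun t => (x t).v) =O[𝓟 (Ici 0)] fun _ => (1 : ℝ))
    (hP : ∀ i j, (fun t => pathP α x dS dη t i j) =O[𝓟 (Ici 0)] fun _ => (1 : ℝ))
    (hQ : ∀ i j, (fun t => pathQ α x dS dη t i j) =O[𝓟 (Ici 0)] fun _ => (1 : ℝ))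
    (hL : ∀ i j, (fun t => D.L (x t).q ((x t).slide α) i j) =O[𝓟 (Ici 0)] fun _ => (1 : ℝ)) :
    Tendsto (fun t => (x t).slide α) atTop (𝓝 0) := by
  have hJ := isTimeInterval_Ici
  obtain ⟨W, W', k, hk, hW, hW', hW0, hs, hω⟩ := h.exists_lyapunov hJ hD hPl hReg hd
  have hζ := h.filter_isBigO hJ hD hP
  have hξ := h.compensator_isBigO hJ hD hPl hReg hd hζ hL
  have hρ := rho_isBigO (α := α) (dS := dS) (dη := dη) hζ hξ hQ hL
  obtain ⟨θ, B, ϱ, hθ, -, hθd, hB⟩ := hd.exists_exosystem hD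
  obtain ⟨b, hb0, hε⟩ := h.modelError_isBigO hJ hD hPl hReg hθ
  have hε1 : modelError Pl α θ x =O[𝓟 (Ici 0)] fun _ => (1 : ℝ) := by
    simpa using hε.trans (hJ.exp_isBigO_exp (c := 0) (by linarith))
  obtain ⟨kc, hkc, hC⟩ := hPl.coriolis_bound
  obtain ⟨k₁, k₂, hk₁, -, hM⟩ := hPl.inertia_bounds
  choose! s' hs' hMs' using fun t (ht : t ∈ Ici (0 : ℝ)) => h.deriv_slide_eq hPl hReg hθd hB ht
  set f := fun t => Pl.inertia (x t).q *ᵥ s' t with hf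
  have hCs : (fun t => Pl.coriolis (x t).q (x t).v *ᵥ (x t).slide α)
      =O[𝓟 (Ici 0)] fun _ => (1 : ℝ) := by
    have h1 := (hv.norm_left.const_mul_left kc).mul hs.norm_left
    simp only [mul_one] at h1
    refine IsBigO.trans (IsBigO.of_bound 1 (Eventually.of_forall fun t => ?_)) h1
    rw [one_mul, Real.norm_eq_abs]
    exact (hC _ _ _).trans (le_abs_self _)
  have hfO : f =O[𝓟 (Ici 0)] fun _ => (1 : ℝ) := by
    have h1 := ((hCs.neg_left.sub (isBigO_const_mulVec D.K hs)).sub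
      (isBigO_one_mulVec hρ (hω.sub (isBigO_const_const (exactParam D Pl ϱ) (one_ne_zero (α := ℝ))
        (𝓟 (Ici 0)))))).add (isBigO_const_mulVec B hε1)
    exact h1.congr' (Filter.eventually_principal.2 fun t ht => (hMs' t ht).symm) EventuallyEq.rfl
  obtain ⟨F, -, hF⟩ := isBigO_one_iff_bound.1 (isBigO_one_dotProduct hfO hfO)
  obtain ⟨G, -, hG⟩ := isBigO_one_iff_bound.1 (isBigO_one_dotProduct hs hs)
  -- Coercivity of M with Young: k₁|s'|² ≤ s'·Ms' = s'·f ≤ (k₁/2)|s'|² + |f|²/(2k₁).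
  have hs'b : ∀ t ∈ Ici (0 : ℝ), s' t ⬝ᵥ s' t ≤ F / k₁ ^ 2 := by
    intro t ht
    have h1 := (hM (x t).q (s' t)).1
    have h2 := dotProduct_le_young hk₁ (s' t) (f t)
    have h3 := (le_abs_self _).trans (hF t ht)
    have h4 : 1 / (2 * k₁) * (f t ⬝ᵥ f t) ≤ 1 / (2 * k₁) * F := by gcongr
    rw [le_div_iff₀ (by positivity)]
    have h5 : k₁ / 2 * (s' t ⬝ᵥ s' t) ≤ 1 / (2 * k₁) * F := by
      simp only [hf] at h2 h4
      linarith
    have h6 := mul_le_mul_of_nonneg_left h5 (by positivity : 0 ≤ 2 * k₁)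
    have e : 2 * k₁ * (1 / (2 * k₁) * F) = F := by field_simp
    nlinarith
  have hlim := tendsto_zero_of_lyapunov hk hW hW' hW0
    (f := fun t => (x t).slide α ⬝ᵥ (x t).slide α) (B := G + F / k₁ ^ 2)
    (fun t _ => dotProduct_self_nonneg_real _)
    (fun t ht => hasDerivWithinAt_dotProduct (hs' t ht) (hs' t ht)) (fun t ht => by
      have h1 := dotProduct_le_young one_pos ((x t).slide α) (s' t)
      have h2 := (le_abs_self _).trans (hG t ht)
      have h3 := hs'b t ht
      rw [dotProduct_comm (s' t)]
      linarith)
  have hn : Tendsto (fun t => ‖(x t).slide α‖ ^ 2) atTop (𝓝 0) :=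
    squeeze_zero (fun t => sq_nonneg _) (fun t => norm_sq_le_dotProduct _) hlim
  have := hn.sqrt
  simp only [Real.sqrt_sq (norm_nonneg _), Real.sqrt_zero] at this
  exact tendsto_zero_iff_norm_tendsto_zero.2 this

end IsAgentSolution

end Agent

/-! ### Global solutions of autonomous differential equations -/

section GlobalSolutions

variable {E : Type*} [NormedAddCommGroup E] [NormedSpace ℝ E] [FiniteDimensional ℝ E] {f : E → E}

theorem exists_lipschitz_bound_on_closedBall (hf : LocallyLipschitz f) (R : ℝ) :
    ∃ K L : NNReal, LipschitzOnWith K f (Metric.closedBall 0 R) ∧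
      ∀ x ∈ Metric.closedBall (0 : E) R, ‖f x‖ ≤ L := by
  have := FiniteDimensional.proper ℝ E
  have hc : IsCompact (Metric.closedBall (0 : E) R) := isCompact_closedBall _ _
  obtain ⟨K, hK⟩ := (hf.locallyLipschitzOn (s := Metric.closedBall 0 R)).exists_lipschitzOnWith_of_compact hc
  obtain ⟨L, hL⟩ := hc.exists_bound_of_continuousOn hf.continuous.continuousOn
  exact ⟨K, L.toNNReal, hK, fun x hx => (hL x hx).trans (Real.le_coe_toNNReal L)⟩

/-- Solutions starting in a ball exist on a common time span. -/
theorem exists_uniform_local_solution (hf : LocallyLipschitz f) (R : ℝ) :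
    ∃ ε > 0, ∀ x₁ : E, ‖x₁‖ ≤ R → ∀ t₀ : ℝ, ∃ y : ℝ → E, y t₀ = x₁ ∧
      ∀ t ∈ Icc t₀ (t₀ + ε), HasDerivWithinAt y (f (y t)) (Icc t₀ (t₀ + ε)) t := by
  have := FiniteDimensional.complete ℝ E
  -- Starting in the ball of radius R, a solution with speed at most L stays within distance 1 of
  -- its start for the time 1/(L + 1). The summand 1 keeps the denominator positive.
  obtain ⟨K, L, hK, hL⟩ := exists_lipschitz_bound_on_closedBall hf (R + 1)
  have hL1 : (0 : ℝ) < L + 1 := by positivity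
  refine ⟨1 / (L + 1), by positivity, fun x₁ hx₁ t₀ => ?_⟩
  have hε : t₀ ≤ t₀ + 1 / ((L : ℝ) + 1) := by have := one_div_pos.2 hL1; linarith
  have hsub : Metric.closedBall x₁ ((1 : NNReal) : ℝ) ⊆ Metric.closedBall 0 (R + 1) := by
    refine Metric.closedBall_subset_closedBall' ?_
    rw [dist_zero_right]
    simp only [NNReal.coe_one]
    linarith
  have hp : IsPicardLindelof (fun _ => f) (⟨t₀, left_mem_Icc.2 hε⟩ : Icc t₀ (t₀ + 1 / ((L : ℝ) + 1)))
      x₁ 1 0 L K := by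
    refine IsPicardLindelof.of_time_independent (fun x hx => hL x (hsub hx)) (hK.mono hsub) ?_
    simp only [add_sub_cancel_left, sub_self, NNReal.coe_one, NNReal.coe_zero, sub_zero]
    rw [max_eq_left (by positivity), mul_one_div, div_le_one hL1]
    linarith
  exact hp.exists_eq_forall_mem_Icc_hasDerivWithinAt₀

theorem solution_eqOn (hf : LocallyLipschitz f) {T : ℝ} {x y : ℝ → E} (h0 : x 0 = y 0)
    (hx : ∀ t ∈ Icc 0 T, HasDerivWithinAt x (f (x t)) (Icc 0 T) t)
    (hy : ∀ t ∈ Icc 0 T, HasDerivWithinAt y (f (y t)) (Icc 0 T) t) : EqOn x y (Icc 0 T) := by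
  have hxc : ContinuousOn x (Icc 0 T) := fun t ht => (hx t ht).continuousWithinAt
  have hyc : ContinuousOn y (Icc 0 T) := fun t ht => (hy t ht).continuousWithinAt
  obtain ⟨R₁, hR₁⟩ := isCompact_Icc.exists_bound_of_continuousOn hxc
  obtain ⟨R₂, hR₂⟩ := isCompact_Icc.exists_bound_of_continuousOn hyc
  obtain ⟨K, -, hK, -⟩ := exists_lipschitz_bound_on_closedBall hf (max R₁ R₂)
  have hnhds : ∀ t ∈ Ico 0 T, Icc 0 T ∈ 𝓝[Ici t] t := fun t ht =>
    mem_of_superset (Icc_mem_nhdsGE ht.2) (Icc_subset_Icc_left ht.1)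
  exact ODE_solution_unique_of_mem_Icc_right (v := fun _ => f)
    (s := fun _ => Metric.closedBall 0 (max R₁ R₂)) (fun _ _ => hK) hxc
    (fun t ht => (hx t (Ico_subset_Icc_self ht)).mono_of_mem_nhdsWithin (hnhds t ht))
    (fun t ht => mem_closedBall_zero_iff.2
      ((hR₁ t (Ico_subset_Icc_self ht)).trans (le_max_left _ _))) hyc
    (fun t ht => (hy t (Ico_subset_Icc_self ht)).mono_of_mem_nhdsWithin (hnhds t ht))
    (fun t ht => mem_closedBall_zero_iff.2
      ((hR₂ t (Ico_subset_Icc_self ht)).trans (le_max_right _ _))) h0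

/-- Solutions on longer and longer intervals fit together. -/
theorem exists_glued_solution (hf : LocallyLipschitz f) {x₀ : E} {J : Set ℝ} (hJ : J ⊆ Ici 0)
    (h : ∀ t ∈ J, ∃ T > t, ∃ x : ℝ → E, x 0 = x₀ ∧
      ∀ t ∈ Icc 0 T, HasDerivWithinAt x (f (x t)) (Icc 0 T) t) (h0 : 0 ∈ J) :
    ∃ y : ℝ → E, y 0 = x₀ ∧ ∀ t ∈ J, HasDerivWithinAt y (f (y t)) J t := by
  choose! T hT X hX0 hX using h
  refine ⟨fun t => X t t, hX0 0 h0, fun t ht => ?_⟩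
  -- Uniqueness makes the chosen solutions agree on overlaps. Near t the diagonal t ↦ X t t is
  -- therefore the single solution X t, and T t > t leaves room to differentiate.
  have heq : ∀ s ∈ Icc 0 (T t) ∩ J, X s s = X t s := by
    rintro s ⟨hs, hsJ⟩
    have h1 : Icc 0 (min (T s) (T t)) ⊆ Icc 0 (T s) := Icc_subset_Icc_right (min_le_left _ _)
    have h2 : Icc 0 (min (T s) (T t)) ⊆ Icc 0 (T t) := Icc_subset_Icc_right (min_le_right _ _)
    exact solution_eqOn hf ((hX0 s hsJ).trans (hX0 t ht).symm)
      (fun u hu => (hX s hsJ u (h1 hu)).mono h1) (fun u hu => (hX t ht u (h2 hu)).mono h2)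
      ⟨hs.1, le_min (hT s hsJ).le hs.2⟩
  have htm : t ∈ Icc 0 (T t) ∩ J := ⟨⟨hJ ht, (hT t ht).le⟩, ht⟩
  have h1 := ((hX t ht t htm.1).mono (inter_subset_left (t := J))).congr heq rfl
  refine h1.mono_of_mem_nhdsWithin ?_
  have h2 : Iic (T t) ∈ 𝓝[J] t := mem_nhdsWithin_of_mem_nhds (Iic_mem_nhds (hT t ht))
  filter_upwards [h2, self_mem_nhdsWithin] with s hs hsJ
  exact ⟨⟨hJ hsJ, hs⟩, hsJ⟩

/-- If the solutions on bounded time intervals are bounded, there is a global solution. -/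
theorem exists_global_solution (hf : LocallyLipschitz f) (x₀ : E)
    (hb : ∀ T > 0, ∀ x : ℝ → E, x 0 = x₀ →
      (∀ t ∈ Ico 0 T, HasDerivWithinAt x (f (x t)) (Ico 0 T) t) → ∃ B, ∀ t ∈ Ico 0 T, ‖x t‖ ≤ B) :
    ∃ x : ℝ → E, x 0 = x₀ ∧ ∀ t ∈ Ici 0, HasDerivWithinAt x (f (x t)) (Ici 0) t := by
  set A : Set ℝ := {T | 0 < T ∧ ∃ x : ℝ → E, x 0 = x₀ ∧
    ∀ t ∈ Icc 0 T, HasDerivWithinAt x (f (x t)) (Icc 0 T) t} with hA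
  by_cases hbdd : BddAbove A
  swap
  · refine exists_glued_solution hf subset_rfl (fun t _ => ?_) self_mem_Ici
    obtain ⟨T, hT, ht⟩ := not_bddAbove_iff.1 hbdd t
    exact ⟨T, ht, hT.2⟩
  exfalso
  have hne : A.Nonempty := by
    obtain ⟨ε, hε, h⟩ := exists_uniform_local_solution hf ‖x₀‖
    obtain ⟨y, hy0, hy⟩ := h x₀ le_rfl 0
    rw [zero_add] at hy
    exact ⟨ε, hε, y, hy0, hy⟩
  set S := sSup A with hS
  have hS0 : 0 < S := by
    obtain ⟨T, hT⟩ := hne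
    exact lt_of_lt_of_le hT.1 (le_csSup hbdd hT)
  obtain ⟨y, hy0, hy⟩ := exists_glued_solution hf (x₀ := x₀) (J := Ico 0 S) (fun t ht => ht.1)
    (fun t ht => by
      obtain ⟨T, hT, h⟩ := exists_lt_of_lt_csSup hne ht.2
      exact ⟨T, h, hT.2⟩) ⟨le_rfl, hS0⟩
  obtain ⟨B, hB⟩ := hb S hS0 y hy0 hy
  obtain ⟨ε, hε, h⟩ := exists_uniform_local_solution hf B
  -- A restart less than ε before the supremum S, from a state in the ball of radius B, reaches
  -- beyond S. The term S / 2 keeps t₀ positive.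
  set t₀ := max (S / 2) (S - ε / 2) with ht₀
  have ht₀S : t₀ < S := max_lt (by linarith) (by linarith)
  have ht₀0 : 0 < t₀ := lt_of_lt_of_le (half_pos hS0) (le_max_left _ _)
  obtain ⟨w, hw0, hw⟩ := h (y t₀) (hB t₀ ⟨ht₀0.le, ht₀S⟩) t₀
  have hlt : S < t₀ + ε := by have := le_max_right (S / 2) (S - ε / 2); linarith
  set z : ℝ → E := fun t => if t ≤ t₀ then y t else w t with hz
  have hzy : ∀ t ∈ Icc 0 t₀, z t = y t := fun t ht => if_pos ht.2
  have hzw : ∀ t ∈ Icc t₀ (t₀ + ε), z t = w t := by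
    intro t ht
    rcases eq_or_lt_of_le ht.1 with h | h
    · simp only [hz, ← h, le_refl, if_true, hw0]
    · exact if_neg (not_le.2 h)
  have hmem : t₀ + ε ∈ A := by
    refine ⟨by linarith, z, (hzy 0 ⟨le_rfl, ht₀0.le⟩).trans hy0, fun t ht => ?_⟩
    rw [← Icc_union_Icc_eq_Icc ht₀0.le (by linarith : t₀ ≤ t₀ + ε)]
    refine HasDerivWithinAt.union ?_ ?_
    · by_cases h1 : t ≤ t₀
      · have h2 : t ∈ Icc 0 t₀ := ⟨ht.1, h1⟩
        have h3 : Icc 0 t₀ ⊆ Ico 0 S := fun s hs => ⟨hs.1, hs.2.trans_lt ht₀S⟩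
        rw [hzy t h2]
        exact ((hy t (h3 h2)).mono h3).congr hzy (hzy t h2)
      -- Outside the closure of a piece, differentiability within it is vacuous.
      · refine HasFDerivWithinAt.of_notMem_closure ?_
        rw [isClosed_Icc.closure_eq]
        exact fun h2 => h1 h2.2
    · by_cases h1 : t₀ ≤ t
      · have h2 : t ∈ Icc t₀ (t₀ + ε) := ⟨h1, ht.2⟩
        rw [hzw t h2]
        exact (hw t h2).congr hzw (hzw t h2)
      · refine HasFDerivWithinAt.of_notMem_closure ?_
        rw [isClosed_Icc.closure_eq]
        exact fun h2 => h1 h2.1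
  exact absurd (le_csSup hbdd hmem) (not_le.2 hlt)

end GlobalSolutions

/-! ### Locally Lipschitz functions -/

section LocallyLipschitz

variable {X : Type*} [PseudoMetricSpace X]

theorem _root_.LocallyLipschitz.mul_real {f g : X → ℝ} (hf : LocallyLipschitz f)
    (hg : LocallyLipschitz g) : LocallyLipschitz fun x => f x * g x := by
  have h : LocallyLipschitz fun z : ℝ × ℝ => z.1 * z.2 :=
    ContDiff.locallyLipschitz (𝕂 := ℝ) (contDiff_fst.mul contDiff_snd)
  exact h.comp (hf.prodMk hg)

theorem _root_.LocallyLipschitz.inv_real {f : X → ℝ} (hf : LocallyLipschitz f)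
    (h0 : ∀ x, f x ≠ 0) : LocallyLipschitz fun x => (f x)⁻¹ := by
  intro x
  obtain ⟨K, s, hs, hK⟩ := hf x
  have hpos : 0 < |f x| / 2 := by have := abs_pos.2 (h0 x); positivity
  have hev : ∀ᶠ y in 𝓝 x, |f x| / 2 < |f y| :=
    (hf.continuous.abs.tendsto x).eventually (lt_mem_nhds (by linarith))
  set c : NNReal := ⟨|f x| / 2, hpos.le⟩ with hc
  refine ⟨K / c ^ 2, s ∩ {y | |f x| / 2 < |f y|}, inter_mem hs hev, ?_⟩
  refine LipschitzOnWith.of_dist_le_mul fun y hy z hz => ?_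
  have h1 := hK.dist_le_mul y hy.1 z hz.1
  have hy2 : |f x| / 2 < |f y| := hy.2
  have hz2 : |f x| / 2 < |f z| := hz.2
  rw [Real.dist_eq] at h1 ⊢
  have e : (f y)⁻¹ - (f z)⁻¹ = (f z - f y) / (f y * f z) := by
    have := h0 y; have := h0 z; field_simp
  rw [e, abs_div, abs_mul, abs_sub_comm]
  have hcc : ((K / c ^ 2 : NNReal) : ℝ) = K / (|f x| / 2) ^ 2 := by
    rw [NNReal.coe_div, NNReal.coe_pow]
    rfl
  rw [hcc, div_mul_eq_mul_div]
  gcongr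
  rw [pow_two]
  gcongr

theorem _root_.LocallyLipschitz.sum_real {ι : Type*} (s : Finset ι) {f : ι → X → ℝ}
    (hf : ∀ i ∈ s, LocallyLipschitz (f i)) : LocallyLipschitz fun x => ∑ i ∈ s, f i x := by
  induction s using Finset.cons_induction with
  | empty => simpa using LocallyLipschitz.const (0 : ℝ)
  | cons i s hi ih =>
    simp only [Finset.sum_cons]
    exact (hf i (Finset.mem_cons_self i s)).add
      (ih fun j hj => hf j (Finset.mem_cons_of_mem hj))

theorem _root_.LocallyLipschitz.prod_real {ι : Type*} (s : Finset ι) {f : ι → X → ℝ}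
    (hf : ∀ i ∈ s, LocallyLipschitz (f i)) : LocallyLipschitz fun x => ∏ i ∈ s, f i x := by
  induction s using Finset.cons_induction with
  | empty => simpa using LocallyLipschitz.const (1 : ℝ)
  | cons i s hi ih =>
    simp only [Finset.prod_cons]
    exact (hf i (Finset.mem_cons_self i s)).mul_real
      (ih fun j hj => hf j (Finset.mem_cons_of_mem hj))

theorem locallyLipschitz_pi {ι : Type*} [Fintype ι] {Y : ι → Type*} [∀ i, PseudoMetricSpace (Y i)]
    {f : X → ∀ i, Y i} (hf : ∀ i, LocallyLipschitz fun x => f x i) : LocallyLipschitz f := by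
  intro x
  choose K s hs hK using fun i => hf i x
  refine ⟨∑ i, K i, ⋂ i, s i, Filter.iInter_mem.2 hs, ?_⟩
  refine LipschitzOnWith.of_dist_le_mul fun y hy z hz => ?_
  refine (dist_pi_le_iff (by positivity)).2 fun i => ?_
  refine ((hK i).dist_le_mul y (mem_iInter.1 hy i) z (mem_iInter.1 hz i)).trans ?_
  gcongr
  exact Finset.single_le_sum (f := K) (fun _ _ => zero_le) (Finset.mem_univ i)

theorem locallyLipschitz_apply {ι : Type*} [Fintype ι] {Y : ι → Type*}
    [∀ i, PseudoMetricSpace (Y i)] (i : ι) :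
    LocallyLipschitz fun x : ∀ i, Y i => x i :=
  (LipschitzWith.eval i).locallyLipschitz

theorem _root_.LocallyLipschitz.apply {ι : Type*} [Fintype ι] {Y : ι → Type*}
    [∀ i, PseudoMetricSpace (Y i)] {f : X → ∀ i, Y i} (hf : LocallyLipschitz f) (i : ι) :
    LocallyLipschitz fun x => f x i :=
  (locallyLipschitz_apply i).comp hf

theorem _root_.LocallyLipschitz.mulVec {ι κ : Type*} [Fintype ι] [Fintype κ] {A : X → Matrix ι κ ℝ}
    {x : X → κ → ℝ} (hA : ∀ i j, LocallyLipschitz fun z => A z i j) (hx : LocallyLipschitz x) :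
    LocallyLipschitz fun z => A z *ᵥ x z :=
  locallyLipschitz_pi fun i => LocallyLipschitz.sum_real _ fun j _ =>
    (hA i j).mul_real (hx.apply j)

theorem _root_.LocallyLipschitz.const_mulVec {ι κ : Type*} [Fintype ι] [Fintype κ] (A : Matrix ι κ ℝ)
    {x : X → κ → ℝ} (hx : LocallyLipschitz x) : LocallyLipschitz fun z => A *ᵥ x z :=
  LocallyLipschitz.mulVec (fun i j => LocallyLipschitz.const (A i j)) hx

theorem _root_.LocallyLipschitz.mul_apply {ι κ ν : Type*} [Fintype κ] {A : X → Matrix ι κ ℝ}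
    {B : X → Matrix κ ν ℝ} (hA : ∀ i j, LocallyLipschitz fun z => A z i j)
    (hB : ∀ i j, LocallyLipschitz fun z => B z i j) (i : ι) (j : ν) :
    LocallyLipschitz fun z => (A z * B z) i j := by
  simp only [Matrix.mul_apply]
  exact LocallyLipschitz.sum_real _ fun k _ => (hA i k).mul_real (hB k j)

theorem _root_.LocallyLipschitz.const_smul_pi {ι : Type*} [Fintype ι] (c : ℝ)
    {f : X → ι → ℝ} (hf : LocallyLipschitz f) : LocallyLipschitz fun x => c • f x :=
  locallyLipschitz_pi fun i => (LocallyLipschitz.const c).mul_real (hf.apply i)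

theorem _root_.LocallyLipschitz.det {ι : Type*} [Fintype ι] [DecidableEq ι] {A : X → Matrix ι ι ℝ}
    (hA : ∀ i j, LocallyLipschitz fun z => A z i j) : LocallyLipschitz fun z => (A z).det := by
  simp only [Matrix.det_apply']
  exact LocallyLipschitz.sum_real _ fun σ _ => (LocallyLipschitz.const _).mul_real
    (LocallyLipschitz.prod_real _ fun i _ => hA _ _)

/-- Cramer's rule: the entries of the inverse are determinants divided by a nonvanishing
determinant. -/
theorem _root_.LocallyLipschitz.inv_apply {ι : Type*} [Fintype ι] [DecidableEq ι] {A : X → Matrix ι ι ℝ}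
    (hA : ∀ i j, LocallyLipschitz fun z => A z i j) (h0 : ∀ z, (A z).det ≠ 0) (i j : ι) :
    LocallyLipschitz fun z => (A z)⁻¹ i j := by
  simp only [Matrix.inv_def, Matrix.smul_apply, Ring.inverse_eq_inv', smul_eq_mul,
    Matrix.adjugate_apply]
  refine ((LocallyLipschitz.det hA).inv_real h0).mul_real (LocallyLipschitz.det fun k l => ?_)
  simp only [Matrix.updateRow_apply]
  split_ifs
  · exact LocallyLipschitz.const _
  · exact hA k l

end LocallyLipschitz

/-! ### The vector field of the closed loop is locally Lipschitz -/

section LipschitzField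

variable {n p : ℕ} {D : Design n p} {Pl : Plant n p} {Y : Regressor (Fin n) n p}
  {m : Fin n → ℕ} {d : Disturbance m} {α : ℝ} {X : Type*} [PseudoMetricSpace X] {x : X → D.State}
  {dS : X → Matrix (Fin n) (Fin n) ℝ} {dη : X → Fin n → ℝ}

theorem Regressor.IsLocLipschitz.comp {ι : Type} {R : Regressor ι n p} (hR : R.IsLocLipschitz)
    {q v y z : X → Fin n → ℝ} (hq : LocallyLipschitz q) (hv : LocallyLipschitz v)
    (hy : LocallyLipschitz y) (hz : LocallyLipschitz z) (i : ι) (j : Fin p) :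
    LocallyLipschitz fun t => R (q t) (v t) (y t) (z t) i j :=
  LocallyLipschitz.comp (f := fun z : (Fin n → ℝ) × (Fin n → ℝ) × (Fin n → ℝ) × (Fin n → ℝ) =>
      R z.1 z.2.1 z.2.2.1 z.2.2.2 i j) (hR i j) (hq.prodMk (hv.prodMk (hy.prodMk hz)))

theorem Disturbance.locallyLipschitz_value (d : Disturbance m) :
    LocallyLipschitz fun t : ℝ => fun s => d.value s t := by
  refine ContDiff.locallyLipschitz (𝕂 := ℝ) ?_
  unfold Disturbance.value
  fun_prop

namespace Plant.IsEulerLagrange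

theorem det_inertia_ne_zero (hPl : Pl.IsEulerLagrange Y) (q : Fin n → ℝ) :
    (Pl.inertia q).det ≠ 0 := by
  obtain ⟨k₁, k₂, hk₁, -, hM⟩ := hPl.inertia_bounds
  intro h0
  obtain ⟨v, hv0, hv⟩ := Matrix.exists_mulVec_eq_zero_iff.2 h0
  have h1 := (hM q v).1
  rw [hv, dotProduct_zero] at h1
  have h2 := dotProduct_self_nonneg_real v
  exact hv0 (dotProduct_self_eq_zero.1 (by nlinarith))

theorem inertia_mulVec (hPl : Pl.IsEulerLagrange Y) (q v y : Fin n → ℝ) :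
    Pl.inertia q *ᵥ y = Y q v y 0 *ᵥ Pl.param - Y q v 0 0 *ᵥ Pl.param := by
  simp only [← hPl.regression]
  simp

theorem coriolis_mulVec (hPl : Pl.IsEulerLagrange Y) (q v y : Fin n → ℝ) :
    Pl.coriolis q v *ᵥ y = Y q v 0 y *ᵥ Pl.param - Y q v 0 0 *ᵥ Pl.param := by
  simp only [← hPl.regression]
  simp

/-- The columns of M are differences of values of YΘ, so M inherits the regularity of Y, which mere
differentiability would not give. -/
theorem locallyLipschitz_inertia (hPl : Pl.IsEulerLagrange Y) (hY : Y.IsLocLipschitz)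
    (i j : Fin n) : LocallyLipschitz fun q => Pl.inertia q i j := by
  have h : ∀ q, Pl.inertia q i j =
      (Y q 0 (Pi.single j 1) 0 *ᵥ Pl.param) i + -(Y q 0 0 0 *ᵥ Pl.param) i := fun q => by
    have := congrFun (hPl.inertia_mulVec q 0 (Pi.single j 1)) i
    rw [Matrix.mulVec_single_one] at this
    exact this.trans (sub_eq_add_neg _ _)
  simp_rw [h]
  have hc := fun c : Fin n → ℝ => LocallyLipschitz.const (α := Fin n → ℝ) c
  have hΘ := LocallyLipschitz.const (α := Fin n → ℝ) Pl.param
  exact ((LocallyLipschitz.mulVec (hY.comp .id (hc 0) (hc _) (hc 0)) hΘ).apply i).add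
    ((LocallyLipschitz.mulVec (hY.comp .id (hc 0) (hc 0) (hc 0)) hΘ).apply i).neg

end Plant.IsEulerLagrange

/-- The acceleration of the plant whose regression matrix is `Y` under the total force `f`. -/
noncomputable def Plant.acceleration (Pl : Plant n p) (Y : Regressor (Fin n) n p)
    (q v f : Fin n → ℝ) : Fin n → ℝ :=
  (Pl.inertia q)⁻¹ *ᵥ (f - Y q v 0 v *ᵥ Pl.param)

theorem Plant.IsEulerLagrange.acceleration_spec (hPl : Pl.IsEulerLagrange Y)
    (q v f : Fin n → ℝ) :
    Pl.inertia q *ᵥ Pl.acceleration Y q v f + Pl.coriolis q v *ᵥ v + Pl.gravity q = f := by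
  have h := hPl.regression q v 0 v
  rw [Matrix.mulVec_zero, zero_add] at h
  rw [add_assoc, h, Plant.acceleration, Matrix.mulVec_mulVec,
    Matrix.mul_nonsing_inv _ (isUnit_iff_ne_zero.2 (hPl.det_inertia_ne_zero q)), Matrix.one_mulVec,
    sub_add_cancel]

/-- C and G occur only in the combination YΘ taken at (q, v, 0, v), so no regularity of either is
needed separately. -/
theorem Plant.IsEulerLagrange.locallyLipschitz_acceleration (hPl : Pl.IsEulerLagrange Y)
    (hY : Y.IsLocLipschitz) {q v f : X → Fin n → ℝ} (hq : LocallyLipschitz q)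
    (hv : LocallyLipschitz v) (hf : LocallyLipschitz f) :
    LocallyLipschitz fun t => Pl.acceleration Y (q t) (v t) (f t) := by
  refine LocallyLipschitz.mulVec (LocallyLipschitz.inv_apply
    (fun i j => LocallyLipschitz.comp (f := fun q => Pl.inertia q i j)
      (hPl.locallyLipschitz_inertia hY i j) hq)
    fun t => hPl.det_inertia_ne_zero _) ?_
  exact hf.sub (LocallyLipschitz.mulVec (hY.comp hq hv (.const 0) hv) (.const _))

/-- All components of a state depending on a parameter are locally Lipschitz. -/
structure IsLipschitzState (x : X → D.State) : Prop where
  q : LocallyLipschitz fun z => (x z).q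
  v : LocallyLipschitz fun z => (x z).v
  S : ∀ i j, LocallyLipschitz fun z => (x z).S i j
  η : LocallyLipschitz fun z => (x z).η
  ξ : LocallyLipschitz fun z => (x z).ξ
  ζ : ∀ i j, LocallyLipschitz fun z => (x z).ζ i j
  ω : LocallyLipschitz fun z => (x z).ω

namespace IsLipschitzState

theorem refVel (h : IsLipschitzState x) : LocallyLipschitz fun z => (x z).refVel α :=
  (LocallyLipschitz.mulVec h.S h.η).sub ((h.q.sub h.η).const_smul_pi α)

theorem slide (h : IsLipschitzState x) : LocallyLipschitz fun z => (x z).slide α :=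
  h.v.sub h.refVel

theorem refAcc (h : IsLipschitzState x) (hdS : ∀ i j, LocallyLipschitz fun z => dS z i j)
    (hdη : LocallyLipschitz dη) : LocallyLipschitz fun z => (x z).refAcc α (dS z) (dη z) :=
  ((LocallyLipschitz.mulVec hdS h.η).add (LocallyLipschitz.mulVec h.S hdη)).sub
    ((h.v.sub hdη).const_smul_pi α)

theorem rho (h : IsLipschitzState x) (hD : D.Admissible)
    (hdS : ∀ i j, LocallyLipschitz fun z => dS z i j)
    (hdη : LocallyLipschitz dη) (i : Fin n) (j : D.Par) :
    LocallyLipschitz fun z => (x z).rho α (dS z) (dη z) i j := by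
  have hc : ∀ {ι κ : Type} (A : Matrix ι κ ℝ) (i j), LocallyLipschitz fun _ : X => A i j :=
    fun A i j => LocallyLipschitz.const _
  have hL : ∀ i j, LocallyLipschitz fun z => D.L (x z).q ((x z).slide α) i j := fun i j =>
    LocallyLipschitz.comp (f := fun z : (Fin n → ℝ) × (Fin n → ℝ) => D.L z.1 z.2 i j)
      (hD.L_lip i j) (h.q.prodMk h.slide)
  rcases j with j | ⟨j, k⟩ | j
  · exact (LocallyLipschitz.mul_apply (hc D.A) h.ζ i j).add
      (hD.Q_lip.comp h.q h.v (h.refAcc hdS hdη) h.refVel i j)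
  · exact LocallyLipschitz.mul_apply (B := fun z => (x z).ζ + D.bigN * D.L (x z).q
      ((x z).slide α)) (hc (D.E j))
      (fun i j => (h.ζ i j).add (LocallyLipschitz.mul_apply (hc D.bigN) hL i j)) i k
  · exact (LocallyLipschitz.const_mulVec (D.E j) h.ξ).apply i

theorem torque (h : IsLipschitzState x) (hD : D.Admissible)
    (hdS : ∀ i j, LocallyLipschitz fun z => dS z i j)
    (hdη : LocallyLipschitz dη) :
    LocallyLipschitz fun z => (x z).torque α (dS z) (dη z) :=
  ((LocallyLipschitz.const_mulVec D.K h.slide).neg.sub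
    (LocallyLipschitz.mulVec (h.rho hD hdS hdη) h.ω)).add (LocallyLipschitz.const_mulVec D.A h.ξ)

end IsLipschitzState

end LipschitzField

/-! ### The closed loop as an autonomous differential equation -/

section Code

variable {n p : ℕ} (D : Design n p)

/-- The vector space in which the state of one agent is encoded. -/
abbrev Design.Code : Type :=
  (Fin n → ℝ) × (Fin n → ℝ) × (Fin n → Fin n → ℝ) × (Fin n → ℝ) × (D.Idx → ℝ) ×
    (D.Idx → Fin p → ℝ) × (D.Par → ℝ)

variable {D}

/-- The state that a vector encodes. -/
def Design.decode (z : D.Code) : D.State where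
  q := z.1
  v := z.2.1
  S := Matrix.of z.2.2.1
  η := z.2.2.2.1
  ξ := z.2.2.2.2.1
  ζ := Matrix.of z.2.2.2.2.2.1
  ω := z.2.2.2.2.2.2

/-- The state of an agent as a vector. -/
def Design.State.encode (x : D.State) : D.Code :=
  (x.q, x.v, fun i j => x.S i j, x.η, x.ξ, fun i j => x.ζ i j, x.ω)

theorem Design.decode_encode (x : D.State) : Design.decode x.encode = x := rfl

theorem Design.isLipschitzState_decode {X : Type*} [PseudoMetricSpace X] {z : X → D.Code}
    (hz : LocallyLipschitz z) : IsLipschitzState fun t => Design.decode (z t) := by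
  have h1 := LipschitzWith.prod_fst.locallyLipschitz.comp hz
  have h1' := LipschitzWith.prod_snd.locallyLipschitz.comp hz
  have h2 := LipschitzWith.prod_fst.locallyLipschitz.comp h1'
  have h2' := LipschitzWith.prod_snd.locallyLipschitz.comp h1'
  have h3 := LipschitzWith.prod_fst.locallyLipschitz.comp h2'
  have h3' := LipschitzWith.prod_snd.locallyLipschitz.comp h2'
  have h4 := LipschitzWith.prod_fst.locallyLipschitz.comp h3'
  have h4' := LipschitzWith.prod_snd.locallyLipschitz.comp h3'
  have h5 := LipschitzWith.prod_fst.locallyLipschitz.comp h4'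
  have h5' := LipschitzWith.prod_snd.locallyLipschitz.comp h4'
  have h6 := LipschitzWith.prod_fst.locallyLipschitz.comp h5'
  have h6' := LipschitzWith.prod_snd.locallyLipschitz.comp h5'
  exact ⟨h1, h2, fun i j => (LocallyLipschitz.apply (X := X) h3 i).apply j, h4, h5,
    fun i j => (LocallyLipschitz.apply (X := X) h6 i).apply j, h6'⟩

end Code

section Network

variable {N n p : ℕ} (a : Matrix (Fin N) (Fin N) ℝ) (μ₁ μ₂ α : ℝ) {D : Fin N → Design n p}
  (Pl : Fin N → Plant n p) (Y : Fin N → Regressor (Fin n) n p) {m : Fin N → Fin n → ℕ}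
  (d : ∀ i, Disturbance (m i))

/-- Right-hand side of the equations of agent `i` at time `τ`. -/
noncomputable def agentField (τ : ℝ) (x : ∀ i, (D i).State) (i : Fin N) : (D i).Code :=
  ((x i).v,
   (Pl i).acceleration (Y i) (x i).q (x i).v
    (torque a μ₁ μ₂ α x i + fun s => (d i).value s τ),
   fun j k => dS a μ₁ x i j k,
   dη a μ₂ x i,
   (D i).bigM *ᵥ (x i).ξ + (D i).bigN *ᵥ torque a μ₁ μ₂ α x i,
   fun j k => ((D i).bigM * (x i).ζ + (D i).P (x i).q (x i).v
      ((x i).refAcc α (dS a μ₁ x i) (dη a μ₂ x i)) ((x i).refVel α)) j k,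
   fun k => ((D i).Λ k)⁻¹ * (((x i).rho α (dS a μ₁ x i) (dη a μ₂ x i))ᵀ *ᵥ (x i).slide α) k)

/-- The vector field of the closed loop, with time as an additional state. -/
noncomputable def networkField (z : ℝ × ∀ i, (D i).Code) : ℝ × ∀ i, (D i).Code :=
  (1, agentField a μ₁ μ₂ α Pl Y d z.1 fun i => Design.decode (z.2 i))

variable {Pl Y d}

theorem locallyLipschitz_networkField (hD : ∀ i, (D i).Admissible)
    (hPl : ∀ i, (Pl i).IsEulerLagrange (Y i)) (hY : ∀ i, (Y i).IsLocLipschitz) :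
    LocallyLipschitz (networkField (D := D) a μ₁ μ₂ α Pl Y d) := by
  set x : (ℝ × ∀ i, (D i).Code) → ∀ i, (D i).State := fun z i => Design.decode (z.2 i) with hx
  have hL : ∀ i, IsLipschitzState fun z => x z i := fun i => Design.isLipschitzState_decode
    (LocallyLipschitz.apply LipschitzWith.prod_snd.locallyLipschitz i)
  have hdS : ∀ i j k, LocallyLipschitz fun z => dS a μ₁ (x z) i j k := by
    intro i j k
    simp only [dS, Matrix.smul_apply, Matrix.sum_apply, Matrix.sub_apply, smul_eq_mul]
    exact (LocallyLipschitz.const _).mul_real (LocallyLipschitz.sum_real _ fun l _ =>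
      (LocallyLipschitz.const _).mul_real (((hL l).S j k).sub ((hL i).S j k)))
  have hdη : ∀ i, LocallyLipschitz fun z => dη a μ₂ (x z) i := by
    intro i
    refine (LocallyLipschitz.mulVec (hL i).S (hL i).η).add (LocallyLipschitz.const_smul_pi _ ?_)
    refine locallyLipschitz_pi fun k => ?_
    simp only [Finset.sum_apply, Pi.smul_apply, Pi.sub_apply, smul_eq_mul]
    exact LocallyLipschitz.sum_real _ fun l _ =>
      (LocallyLipschitz.const _).mul_real (((hL l).η.apply k).sub ((hL i).η.apply k))
  have hτ : ∀ i, LocallyLipschitz fun z => torque a μ₁ μ₂ α (x z) i := fun i =>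
    (hL i).torque (hD i) (hdS i) (hdη i)
  have hd : ∀ i, LocallyLipschitz fun z : ℝ × ∀ i, (D i).Code => fun s => (d i).value s z.1 :=
    fun i => (d i).locallyLipschitz_value.comp LipschitzWith.prod_fst.locallyLipschitz
  have hc : ∀ {ι κ : Type} (A : Matrix ι κ ℝ) (i j),
      LocallyLipschitz fun _ : ℝ × ∀ i, (D i).Code => A i j :=
    fun A i j => LocallyLipschitz.const _
  refine (LocallyLipschitz.const _).prodMk (locallyLipschitz_pi fun i => ?_)
  refine (hL i).v.prodMk (((hPl i).locallyLipschitz_acceleration (hY i) (hL i).q (hL i).v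
    ((hτ i).add (hd i))).prodMk ((locallyLipschitz_pi fun j => locallyLipschitz_pi fun k =>
    hdS i j k).prodMk ((hdη i).prodMk (LocallyLipschitz.prodMk ?_ (LocallyLipschitz.prodMk ?_ ?_)))))
  · exact (LocallyLipschitz.const_mulVec _ (hL i).ξ).add (LocallyLipschitz.const_mulVec _ (hτ i))
  · exact locallyLipschitz_pi fun j => locallyLipschitz_pi fun k =>
      (LocallyLipschitz.mul_apply (hc _) (hL i).ζ j k).add
        ((hD i).P_lip.comp (hL i).q (hL i).v ((hL i).refAcc (hdS i) (hdη i)) (hL i).refVel j k)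
  · exact locallyLipschitz_pi fun k => (LocallyLipschitz.const _).mul_real
      ((LocallyLipschitz.mulVec (fun j k => (hL i).rho (hD i) (hdS i) (hdη i) k j)
        (hL i).slide).apply k)

end Network

/-- A continuous function is bounded along a bounded path. -/
theorem isBigO_one_comp_of_continuous {E : Type*} [NormedAddCommGroup E] [NormedSpace ℝ E]
    [FiniteDimensional ℝ E] {f : E → ℝ} (hf : Continuous f) {J : Set ℝ} {g : ℝ → E}
    (hg : g =O[𝓟 J] fun _ => (1 : ℝ)) : (fun t => f (g t)) =O[𝓟 J] fun _ => (1 : ℝ) := by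
  have := FiniteDimensional.proper ℝ E
  obtain ⟨C, -, hC⟩ := isBigO_one_iff_bound.1 hg
  obtain ⟨B, hB⟩ := (isCompact_closedBall (0 : E) C).exists_bound_of_continuousOn hf.continuousOn
  exact isBigO_principal.2 ⟨B, fun t ht => by
    simpa using hB (g t) (mem_closedBall_zero_iff.2 (hC t ht))⟩

/-! ### Bounds on the arguments of the regression matrices -/

section Agent

variable {n p : ℕ} {D : Design n p} {Pl : Plant n p} {Y : Regressor (Fin n) n p}
  {m : Fin n → ℕ} {d : Disturbance m} {α : ℝ} {J : Set ℝ} {x : ℝ → D.State}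
  {dS : ℝ → Matrix (Fin n) (Fin n) ℝ} {dη : ℝ → Fin n → ℝ}

theorem Regressor.IsLocLipschitz.isBigO_one {ι : Type} {R : Regressor ι n p}
    (hR : R.IsLocLipschitz) {q v y z : ℝ → Fin n → ℝ} (hq : q =O[𝓟 J] fun _ => (1 : ℝ))
    (hv : v =O[𝓟 J] fun _ => (1 : ℝ)) (hy : y =O[𝓟 J] fun _ => (1 : ℝ))
    (hz : z =O[𝓟 J] fun _ => (1 : ℝ)) (i : ι) (j : Fin p) :
    (fun t => R (q t) (v t) (y t) (z t) i j) =O[𝓟 J] fun _ => (1 : ℝ) :=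
  isBigO_one_comp_of_continuous (hR i j).continuous
    (hq.prod_left (hv.prod_left (hy.prod_left hz)))

theorem Design.Admissible.L_isBigO_one (hD : D.Admissible) {q s : ℝ → Fin n → ℝ}
    (hq : q =O[𝓟 J] fun _ => (1 : ℝ)) (hs : s =O[𝓟 J] fun _ => (1 : ℝ)) (i : Fin n) (j : Fin p) :
    (fun t => D.L (q t) (s t) i j) =O[𝓟 J] fun _ => (1 : ℝ) :=
  isBigO_one_comp_of_continuous (f := fun z : (Fin n → ℝ) × (Fin n → ℝ) => D.L z.1 z.2 i j)
    (hD.L_lip i j).continuous (hq.prod_left hs)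

/-- Boundedness of the position error and of all arguments but `q` of the regression matrices. -/
structure HasBoundedArguments (α : ℝ) (J : Set ℝ) (x : ℝ → D.State)
    (dS : ℝ → Matrix (Fin n) (Fin n) ℝ) (dη : ℝ → Fin n → ℝ) : Prop where
  positionError : (fun t => (x t).q - (x t).η) =O[𝓟 J] fun _ => (1 : ℝ)
  slide : (fun t => (x t).slide α) =O[𝓟 J] fun _ => (1 : ℝ)
  v : (fun t => (x t).v) =O[𝓟 J] fun _ => (1 : ℝ)
  refVel : (fun t => (x t).refVel α) =O[𝓟 J] fun _ => (1 : ℝ)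
  refAcc : (fun t => (x t).refAcc α (dS t) (dη t)) =O[𝓟 J] fun _ => (1 : ℝ)

/-- A chain that never needs η or q bounded: the Lyapunov function bounds s, the stable filter
bounds q - η, and then q̇_r, q̇ = s + q̇_r and q̈_r involve η only through Sη, η' and S'η. -/
theorem IsAgentSolution.hasBoundedArguments (h : IsAgentSolution D Pl d α J x dS dη)
    (hJ : IsTimeInterval J) (hα : 0 < α) (hD : D.Admissible) (hPl : Pl.IsEulerLagrange Y)
    (hReg : D.Regresses Y Pl) (hd : D.Models d)
    (hS : ∀ i j, (fun t => (x t).S i j) =O[𝓟 J] fun _ => (1 : ℝ))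
    (hSη : (fun t => (x t).S *ᵥ (x t).η) =O[𝓟 J] fun _ => (1 : ℝ))
    (hdη : dη =O[𝓟 J] fun _ => (1 : ℝ))
    (hdSη : (fun t => dS t *ᵥ (x t).η) =O[𝓟 J] fun _ => (1 : ℝ)) :
    HasBoundedArguments α J x dS dη := by
  obtain ⟨-, -, -, -, -, -, -, hs, -⟩ := h.exists_lyapunov hJ hD hPl hReg hd
  have he := h.positionError_isBigO hJ hα hs (hSη.sub hdη)
  have hr : (fun t => (x t).refVel α) =O[𝓟 J] fun _ => (1 : ℝ) :=
    hSη.sub (he.const_smul_left α)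
  have hv : (fun t => (x t).v) =O[𝓟 J] fun _ => (1 : ℝ) :=
    (hs.add hr).congr_left fun t => by simp [Design.State.slide]
  exact ⟨he, hs, hv, hr, (hdSη.add (isBigO_one_mulVec hS hdη)).sub
    ((hv.sub hdη).const_smul_left α)⟩

end Agent

/-! ### Global existence for the closed loop -/

section Network

variable {N n p : ℕ} {a : Matrix (Fin N) (Fin N) ℝ} {μ₁ μ₂ α : ℝ} {D : Fin N → Design n p}
  {Pl : Fin N → Plant n p} {Y : Fin N → Regressor (Fin n) n p} {m : Fin N → Fin n → ℕ}
  {d : ∀ i, Disturbance (m i)} {J : Set ℝ} {x : ℝ → ∀ i, (D i).State}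

/-- The closed-loop equations on a time interval. -/
def IsSolutionOn (a : Matrix (Fin N) (Fin N) ℝ) (μ₁ μ₂ α : ℝ) (Pl : Fin N → Plant n p)
    (d : ∀ i, Disturbance (m i)) (J : Set ℝ) (x : ℝ → ∀ i, (D i).State) : Prop :=
  ∀ i, IsAgentSolution (D i) (Pl i) (d i) α J (fun t => x t i) (fun t => dS a μ₁ (x t) i)
    fun t => dη a μ₂ (x t) i

theorem isSolutionOn_Ici : IsSolutionOn a μ₁ μ₂ α Pl d (Ici 0) x ↔
    IsSolution a μ₁ μ₂ α Pl d x :=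
  ⟨fun h => ⟨fun i => (h i).position, fun i => (h i).velocity, fun i => (h i).observer_S,
    fun i => (h i).observer_η, fun i => (h i).compensator, fun i => (h i).auxiliary,
    fun i => (h i).estimator⟩,
   fun h i => ⟨h.position i, h.velocity i, h.observer_S i, h.observer_η i, h.compensator i,
    h.auxiliary i, h.estimator i⟩⟩

theorem IsSolutionOn.isObserver (h : IsSolutionOn a μ₁ μ₂ α Pl d J x) :
    IsObserver a μ₁ μ₂ J (fun t i => (x t i).S) fun t i => (x t i).η :=
  ⟨fun t ht i j k => (h i).observer_S t ht j k, fun t ht i => (h i).observer_η t ht⟩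

/-- The additional state has derivative one and starts at zero, so it is the time; substituting it
makes the autonomous system the original one. -/
theorem isSolutionOn_of_networkField {z : ℝ → ℝ × ∀ i, (D i).Code} (hJ : IsTimeInterval J)
    (hPl : ∀ i, (Pl i).IsEulerLagrange (Y i)) (h0 : (z 0).1 = 0)
    (hz : ∀ t ∈ J, HasDerivWithinAt z (networkField (D := D) a μ₁ μ₂ α Pl Y d (z t)) J t) :
    (∀ t ∈ J, (z t).1 = t) ∧
      IsSolutionOn a μ₁ μ₂ α Pl d J fun t i => Design.decode ((z t).2 i) := by
  have hfst : ∀ t ∈ J, HasDerivWithinAt (fun t => (z t).1) 1 J t := fun t ht => (hz t ht).fst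
  have htime : ∀ t ∈ J, (z t).1 = t := by
    intro t ht
    have h1 := hJ.le_of_deriv_nonpos (fun t ht => (hfst t ht).sub (hasDerivWithinAt_id t J))
      (fun t _ => by simp) t ht
    have h2 := hJ.le_of_deriv_nonpos (fun t ht => (hasDerivWithinAt_id t J).sub (hfst t ht))
      (fun t _ => by simp) t ht
    simp only [Pi.sub_apply, id_eq, h0] at h1 h2
    linarith
  refine ⟨htime, fun i => ?_⟩
  have hi : ∀ t ∈ J, HasDerivWithinAt (fun t => (z t).2 i)
      (agentField a μ₁ μ₂ α Pl Y d t (fun i => Design.decode ((z t).2 i)) i) J t := by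
    intro t ht
    refine (hasDerivWithinAt_pi.1 (hz t ht).snd i).congr_deriv ?_
    simp only [networkField, htime t ht]
  have h1 := fun t ht => (hi t ht).snd
  have h2 := fun t ht => (h1 t ht).snd
  have h3 := fun t ht => (h2 t ht).snd
  have h4 := fun t ht => (h3 t ht).snd
  have h5 := fun t ht => (h4 t ht).snd
  exact ⟨fun t ht => (hi t ht).fst,
    fun t ht => ⟨_, (h1 t ht).fst, (hPl i).acceleration_spec _ _ _⟩,
    fun t ht j k => hasDerivWithinAt_pi.1 (hasDerivWithinAt_pi.1 (h2 t ht).fst j) k,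
    fun t ht => (h3 t ht).fst, fun t ht => (h4 t ht).fst,
    fun t ht j k => hasDerivWithinAt_pi.1 (hasDerivWithinAt_pi.1 (h5 t ht).fst j) k,
    fun t ht => (h5 t ht).snd⟩

theorem isBigO_one_of_bounded_interval {c T : ℝ} :
    (fun t => Real.exp (c * t)) =O[𝓟 (Ico 0 T)] fun _ => (1 : ℝ) :=
  isBigO_principal.2 ⟨Real.exp (|c| * T), fun t ht => by
    rw [Real.norm_eq_abs, Real.abs_exp, norm_one, mul_one, Real.exp_le_exp]
    exact (mul_le_mul_of_nonneg_right (le_abs_self c) ht.1).trans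
      (mul_le_mul_of_nonneg_left ht.2.le (abs_nonneg c))⟩

/-- The closed loop has no finite escape time. -/
theorem IsSolutionOn.isBigO_one_Ico {T : ℝ} (hT : 0 < T)
    (h : IsSolutionOn a μ₁ μ₂ α Pl d (Ico 0 T) x)
    (ha : ∀ i j, 0 ≤ a i j) (hμ₁ : 0 ≤ μ₁) (hμ₂ : 0 ≤ μ₂) (hα : 0 < α)
    (hD : ∀ i, (D i).Admissible) (hPl : ∀ i, (Pl i).IsEulerLagrange (Y i))
    (hReg : ∀ i, (D i).Regresses (Y i) (Pl i)) (hd : ∀ i, (D i).Models (d i)) (i : Fin N) :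
    (fun t => (x t i).encode) =O[𝓟 (Ico 0 T)] fun _ => (1 : ℝ) := by
  have hJ := isTimeInterval_Ico hT
  set c := ∑ i, ∑ j, ∑ k, |(x 0 i).S j k| with hc
  have hc0 : ∀ i j k, |(x 0 i).S j k| ≤ c := fun i j k =>
    calc |(x 0 i).S j k| ≤ ∑ k, |(x 0 i).S j k| :=
          Finset.single_le_sum (f := fun k => |(x 0 i).S j k|) (fun _ _ => abs_nonneg _)
            (Finset.mem_univ k)
      _ ≤ ∑ j, ∑ k, |(x 0 i).S j k| :=
          Finset.single_le_sum (f := fun j => ∑ k, |(x 0 i).S j k|)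
            (fun _ _ => Finset.sum_nonneg fun _ _ => abs_nonneg _) (Finset.mem_univ j)
      _ ≤ c := Finset.single_le_sum (f := fun i => ∑ j, ∑ k, |(x 0 i).S j k|)
            (fun _ _ => Finset.sum_nonneg fun _ _ => Finset.sum_nonneg fun _ _ => abs_nonneg _)
            (Finset.mem_univ i)
  have hS' := h.isObserver.abs_S_le hJ ha hμ₁ hc0
  have hS : ∀ i j k, (fun t => (x t i).S j k) =O[𝓟 (Ico 0 T)] fun _ => (1 : ℝ) := fun i j k =>
    isBigO_principal.2 ⟨c, fun t ht => by simpa using hS' t ht i j k⟩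
  have hη : ∀ i, (fun t => (x t i).η) =O[𝓟 (Ico 0 T)] fun _ => (1 : ℝ) := fun i =>
    (hJ.isBigO_of_coupled ha hμ₂ hS' h.isObserver.deriv_η i).trans isBigO_one_of_bounded_interval
  have hdS : ∀ j k, (fun t => dS a μ₁ (x t) i j k) =O[𝓟 (Ico 0 T)] fun _ => (1 : ℝ) := by
    intro j k
    simp only [dS, Matrix.smul_apply, Matrix.sum_apply, Matrix.sub_apply, smul_eq_mul]
    exact (IsBigO.fun_sum fun l _ =>
      ((hS l j k).sub (hS i j k)).const_mul_left _).const_mul_left _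
  have hSη := isBigO_one_mulVec (hS i) (hη i)
  have hdη : (fun t => dη a μ₂ (x t) i) =O[𝓟 (Ico 0 T)] fun _ => (1 : ℝ) :=
    hSη.add ((IsBigO.fun_sum fun l _ =>
      ((hη l).sub (hη i)).const_smul_left (a i l)).const_smul_left μ₂)
  obtain ⟨-, -, -, -, -, -, -, -, hω⟩ :=
    (h i).exists_lyapunov hJ (hD i) (hPl i) (hReg i) (hd i)
  have hb := (h i).hasBoundedArguments hJ hα (hD i) (hPl i) (hReg i) (hd i) (hS i) hSη hdη
    (isBigO_one_mulVec hdS (hη i))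
  have hq : (fun t => (x t i).q) =O[𝓟 (Ico 0 T)] fun _ => (1 : ℝ) :=
    (hb.positionError.add (hη i)).congr_left fun t => by simp
  have hζ := (h i).filter_isBigO hJ (hD i)
    ((hD i).P_lip.isBigO_one hq hb.v hb.refAcc hb.refVel)
  have hξ := (h i).compensator_isBigO hJ (hD i) (hPl i) (hReg i) (hd i) hζ
    ((hD i).L_isBigO_one hq hb.slide)
  exact hq.prod_left (hb.v.prod_left ((isBigO_pi.2 fun j => isBigO_pi.2 fun k =>
    hS i j k).prod_left ((hη i).prod_left (hξ.prod_left ((isBigO_pi.2 fun j => isBigO_pi.2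
      fun k => hζ j k).prod_left hω)))))

theorem exists_isSolution (ha : ∀ i j, 0 ≤ a i j) (hμ₁ : 0 ≤ μ₁) (hμ₂ : 0 ≤ μ₂) (hα : 0 < α)
    (hY : ∀ i, (Y i).IsLocLipschitz)
    (hD : ∀ i, (D i).Admissible) (hPl : ∀ i, (Pl i).IsEulerLagrange (Y i))
    (hReg : ∀ i, (D i).Regresses (Y i) (Pl i)) (hd : ∀ i, (D i).Models (d i))
    (x₀ : ∀ i, (D i).State) :
    ∃ x : ℝ → ∀ i, (D i).State, IsSolution a μ₁ μ₂ α Pl d x ∧ x 0 = x₀ := by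
  obtain ⟨z, hz0, hz⟩ := exists_global_solution
    (locallyLipschitz_networkField (D := D) a μ₁ μ₂ α (d := d) hD hPl hY)
    ((0 : ℝ), fun i => (x₀ i).encode) fun T hT z hz0 hz => by
      obtain ⟨ht, h⟩ := isSolutionOn_of_networkField (isTimeInterval_Ico hT) hPl (by rw [hz0]) hz
      have h1 : (fun t => (z t).1) =O[𝓟 (Ico 0 T)] fun _ => (1 : ℝ) :=
        isBigO_principal.2 ⟨T, fun t htT => by
          rw [ht t htT, Real.norm_eq_abs, abs_of_nonneg htT.1, norm_one, mul_one]
          exact htT.2.le⟩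
      have h2 : (fun t => (z t).2) =O[𝓟 (Ico 0 T)] fun _ => (1 : ℝ) := isBigO_pi.2 fun i =>
        h.isBigO_one_Ico hT ha hμ₁ hμ₂ hα hD hPl hReg hd i
      obtain ⟨B, -, hB⟩ := isBigO_one_iff_bound.1 (h1.prod_left h2)
      exact ⟨B, hB⟩
  refine ⟨fun t i => Design.decode ((z t).2 i), isSolutionOn_Ici.1
    (isSolutionOn_of_networkField isTimeInterval_Ici hPl (by rw [hz0]) hz).2, ?_⟩
  simp only [hz0, Design.decode_encode]

end Network

/-! ### Boundedness and consensus of the network -/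

theorem boundedForward_iff {n : ℕ} {f : ℝ → Fin n → ℝ} :
    BoundedForward f ↔ f =O[𝓟 (Ici 0)] fun _ => (1 : ℝ) := by
  rw [isBigO_principal]
  simp only [norm_one, mul_one]
  rfl

theorem tendsto_zero_of_isBigO_exp_neg {n : ℕ} {f : ℝ → Fin n → ℝ}
    (hf : f =O[𝓟 (Ici 0)] fun t => Real.exp (-1 * t)) : Tendsto f atTop (𝓝 0) := by
  refine (hf.mono (le_principal_iff.2 (Ici_mem_atTop 0))).trans_tendsto ?_
  simpa using Real.tendsto_exp_neg_atTop_nhds_zero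

section Network

variable {N n p : ℕ} {a : Matrix (Fin N) (Fin N) ℝ} {μ₁ μ₂ α : ℝ} {D : Fin N → Design n p}
  {Pl : Fin N → Plant n p} {Y : Fin N → Regressor (Fin n) n p} {m : Fin N → Fin n → ℕ}
  {d : ∀ i, Disturbance (m i)} {x : ℝ → ∀ i, (D i).State}
  {Sstar : Matrix (Fin n) (Fin n) ℝ} {χ : Fin n → ℝ}

namespace IsSolutionOn

/-- The data available about an agent once the derivative of the consensus trajectory is bounded. -/
theorem hasBoundedArguments (h : IsSolutionOn a μ₁ μ₂ α Pl d (Ici 0) x) (hα : 0 < α)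
    (hD : ∀ i, (D i).Admissible) (hPl : ∀ i, (Pl i).IsEulerLagrange (Y i))
    (hReg : ∀ i, (D i).Regresses (Y i) (Pl i)) (hd : ∀ i, (D i).Models (d i))
    (hobs : ObserverConverges a μ₁ μ₂ (fun t i => (x t i).S) (fun t i => (x t i).η) Sstar χ)
    (hder : BoundedForward fun t => Sstar *ᵥ groupTrajectory Sstar χ t) (i : Fin N) :
    HasBoundedArguments α (Ici 0) (fun t => x t i) (fun t => dS a μ₁ (x t) i)
      fun t => dη a μ₂ (x t) i := by
  have hexp : (fun t => Real.exp (-1 * t)) =O[𝓟 (Ici 0)] fun _ => (1 : ℝ) := by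
    simpa using isTimeInterval_Ici.exp_isBigO_exp (b := -1) (c := 0) (by norm_num)
  have hSη : (fun t => (x t i).S *ᵥ (x t i).η) =O[𝓟 (Ici 0)] fun _ => (1 : ℝ) :=
    (((hobs.S_η_sub i).trans hexp).add (boundedForward_iff.1 hder)).congr_left fun t => by simp
  exact (h i).hasBoundedArguments isTimeInterval_Ici hα (hD i) (hPl i) (hReg i) (hd i)
    (hobs.bounded_S i) hSη (hSη.add ((hobs.diffusion i).trans hexp)) ((hobs.dS_η i).trans hexp)

/-- With s_i → 0 the filters give q_i - η_i → 0, and q̇_i - S_iη_i = s_i - α(q_i - η_i) → 0. Both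
are compared with the common trajectory and its derivative, which cancel in differences and need not
be bounded here. -/
theorem consensus (h : IsSolutionOn a μ₁ μ₂ α Pl d (Ici 0) x) (hα : 0 < α)
    (hD : ∀ i, (D i).Admissible) (hPl : ∀ i, (Pl i).IsEulerLagrange (Y i))
    (hReg : ∀ i, (D i).Regresses (Y i) (Pl i)) (hd : ∀ i, (D i).Models (d i))
    (hobs : ObserverConverges a μ₁ μ₂ (fun t i => (x t i).S) (fun t i => (x t i).η) Sstar χ)
    (harg : ∀ i, HasBoundedArguments α (Ici 0) (fun t => x t i) (fun t => dS a μ₁ (x t) i)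
      fun t => dη a μ₂ (x t) i)
    (hP : ∀ i j k, (fun t => IsAgentSolution.pathP α (fun t => x t i) (fun t => dS a μ₁ (x t) i)
      (fun t => dη a μ₂ (x t) i) t j k) =O[𝓟 (Ici 0)] fun _ => (1 : ℝ))
    (hQ : ∀ i j k, (fun t => IsAgentSolution.pathQ α (fun t => x t i) (fun t => dS a μ₁ (x t) i)
      (fun t => dη a μ₂ (x t) i) t j k) =O[𝓟 (Ici 0)] fun _ => (1 : ℝ))
    (hL : ∀ i j k, (fun t => (D i).L (x t i).q ((x t i).slide α) j k)
      =O[𝓟 (Ici 0)] fun _ => (1 : ℝ)) :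
    ReachesConsensus x := by
  have hs : ∀ i, Tendsto (fun t => (x t i).slide α) atTop (𝓝 0) := fun i =>
    (h i).slide_tendsto (hD i) (hPl i) (hReg i) (hd i) (harg i).v (hP i) (hQ i) (hL i)
  have hη : ∀ i, Tendsto (fun t => (x t i).η - groupTrajectory Sstar χ t) atTop (𝓝 0) :=
    fun i => tendsto_zero_of_isBigO_exp_neg (hobs.η_sub i)
  have hSη : ∀ i, Tendsto (fun t => (x t i).S *ᵥ (x t i).η -
      Sstar *ᵥ groupTrajectory Sstar χ t) atTop (𝓝 0) :=
    fun i => tendsto_zero_of_isBigO_exp_neg (hobs.S_η_sub i)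
  have he : ∀ i, Tendsto (fun t => (x t i).q - (x t i).η) atTop (𝓝 0) := fun i =>
    (h i).positionError_tendsto hα (hs i)
      (tendsto_zero_of_isBigO_exp_neg ((hobs.diffusion i).neg_left.congr_left fun t => by
        simp [dη]))
  intro i j
  constructor
  · have := ((he i).add (hη i)).sub ((he j).add (hη j))
    simp only [add_zero, sub_zero] at this
    refine this.congr fun t => ?_
    abel
  · have := (((hs i).add (hSη i)).sub ((he i).const_smul α)).sub
      (((hs j).add (hSη j)).sub ((he j).const_smul α))
    simp only [add_zero, sub_zero, smul_zero] at this
    refine this.congr fun t => ?_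
    simp only [Design.State.slide, Design.State.refVel]
    abel

end IsSolutionOn

theorem groupTrajectory_bounded_deriv (h : BoundedForward (groupTrajectory Sstar χ)) :
    BoundedForward fun t => Sstar *ᵥ groupTrajectory Sstar χ t :=
  boundedForward_iff.2 (isBigO_const_mulVec Sstar (boundedForward_iff.1 h))

/-- Here q is bounded along with the trajectory, so continuity bounds the regression matrices. -/
theorem IsSolutionOn.bounded_of_bounded_trajectory
    (h : IsSolutionOn a μ₁ μ₂ α Pl d (Ici 0) x) (hα : 0 < α)
    (hD : ∀ i, (D i).Admissible) (hPl : ∀ i, (Pl i).IsEulerLagrange (Y i))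
    (hReg : ∀ i, (D i).Regresses (Y i) (Pl i)) (hd : ∀ i, (D i).Models (d i))
    (hobs : ObserverConverges a μ₁ μ₂ (fun t i => (x t i).S) (fun t i => (x t i).η) Sstar χ)
    (htraj : BoundedForward (groupTrajectory Sstar χ)) :
    (∀ i, BoundedForward (fun t => (x t i).q) ∧ BoundedForward (fun t => (x t i).v)) ∧
      ReachesConsensus x := by
  have harg := h.hasBoundedArguments hα hD hPl hReg hd hobs (groupTrajectory_bounded_deriv htraj)
  have hexp : (fun t => Real.exp (-1 * t)) =O[𝓟 (Ici 0)] fun _ => (1 : ℝ) := by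
    simpa using isTimeInterval_Ici.exp_isBigO_exp (b := -1) (c := 0) (by norm_num)
  have hq : ∀ i, (fun t => (x t i).q) =O[𝓟 (Ici 0)] fun _ => (1 : ℝ) := fun i =>
    (((harg i).positionError.add ((hobs.η_sub i).trans hexp)).add
      (boundedForward_iff.1 htraj)).congr_left fun t => by simp
  exact ⟨fun i => ⟨boundedForward_iff.2 (hq i), boundedForward_iff.2 (harg i).v⟩,
    h.consensus hα hD hPl hReg hd hobs harg
      (fun i => (hD i).P_lip.isBigO_one (hq i) (harg i).v (harg i).refAcc (harg i).refVel)
      (fun i => (hD i).Q_lip.isBigO_one (hq i) (harg i).v (harg i).refAcc (harg i).refVel)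
      fun i => (hD i).L_isBigO_one (hq i) (harg i).slide⟩

/-- Here q may drift away, and uniformity in q replaces continuity on a compact set. -/
theorem IsSolutionOn.bounded_of_bounded_velocity
    (h : IsSolutionOn a μ₁ μ₂ α Pl d (Ici 0) x) (hα : 0 < α)
    (hD : ∀ i, (D i).Admissible) (hPl : ∀ i, (Pl i).IsEulerLagrange (Y i))
    (hReg : ∀ i, (D i).Regresses (Y i) (Pl i)) (hd : ∀ i, (D i).Models (d i))
    (hobs : ObserverConverges a μ₁ μ₂ (fun t i => (x t i).S) (fun t i => (x t i).η) Sstar χ)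
    (hder : BoundedForward fun t => Sstar *ᵥ groupTrajectory Sstar χ t)
    (hU : ∀ i, (D i).UniformlyBounded) :
    (∀ i, BoundedForward (fun t => (x t i).q - groupTrajectory Sstar χ t) ∧
      BoundedForward (fun t => (x t i).v)) ∧ ReachesConsensus x := by
  have harg := h.hasBoundedArguments hα hD hPl hReg hd hobs hder
  have hexp : (fun t => Real.exp (-1 * t)) =O[𝓟 (Ici 0)] fun _ => (1 : ℝ) := by
    simpa using isTimeInterval_Ici.exp_isBigO_exp (b := -1) (c := 0) (by norm_num)
  have hPQ : ∀ i, ∃ B, ∀ t ∈ Ici (0 : ℝ),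
      (∀ j k, |IsAgentSolution.pathP α (fun t => x t i) (fun t => dS a μ₁ (x t) i)
        (fun t => dη a μ₂ (x t) i) t j k| ≤ B) ∧
      (∀ j k, |IsAgentSolution.pathQ α (fun t => x t i) (fun t => dS a μ₁ (x t) i)
        (fun t => dη a μ₂ (x t) i) t j k| ≤ B) ∧
      ∀ j k, |(D i).L (x t i).q ((x t i).slide α) j k| ≤ B := by
    intro i
    obtain ⟨C₁, hC₁, h₁⟩ := isBigO_one_iff_bound.1 (harg i).v
    obtain ⟨C₂, hC₂, h₂⟩ := isBigO_one_iff_bound.1 (harg i).refAcc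
    obtain ⟨C₃, hC₃, h₃⟩ := isBigO_one_iff_bound.1 (harg i).refVel
    obtain ⟨C₄, hC₄, h₄⟩ := isBigO_one_iff_bound.1 (harg i).slide
    set R := C₁ + C₂ + C₃ + C₄
    obtain ⟨B, hB⟩ := hU i R
    refine ⟨B, fun t ht => ?_⟩
    have g₁ := (h₁ t ht).trans (by simp only [R]; linarith : C₁ ≤ R)
    have g₂ := (h₂ t ht).trans (by simp only [R]; linarith : C₂ ≤ R)
    have g₃ := (h₃ t ht).trans (by simp only [R]; linarith : C₃ ≤ R)
    have g₄ := (h₄ t ht).trans (by simp only [R]; linarith : C₄ ≤ R)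
    have hb := hB (x t i).q _ _ _ g₁ g₂ g₃
    -- `UniformlyBounded` evaluates L at its velocity argument, so it is used a second time with s
    -- in that place.
    exact ⟨hb.1, hb.2.1, (hB (x t i).q _ _ _ g₄ g₂ g₃).2.2⟩
  choose B hB using hPQ
  exact ⟨fun i => ⟨boundedForward_iff.2 (((harg i).positionError.add
      ((hobs.η_sub i).trans hexp)).congr_left fun t => by simp),
    boundedForward_iff.2 (harg i).v⟩,
    h.consensus hα hD hPl hReg hd hobs harg
      (fun i j k => isBigO_principal.2 ⟨B i, fun t ht => by simpa using (hB i t ht).1 j k⟩)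
      (fun i j k => isBigO_principal.2 ⟨B i, fun t ht => by simpa using (hB i t ht).2.1 j k⟩)
      (fun i j k => isBigO_principal.2 ⟨B i, fun t ht => by simpa using (hB i t ht).2.2 j k⟩)⟩

end Network

/-- Observer gains beyond which the observers of a network with given initial matrices agree. -/
theorem HasSpanningTree.exists_observer_gain {N n : ℕ} {a : Matrix (Fin N) (Fin N) ℝ}
    (htree : HasSpanningTree a) (ha : ∀ i j, 0 ≤ a i j)
    (S₀ : Fin N → Matrix (Fin n) (Fin n) ℝ) {u : Fin N → ℝ} (hu : u ᵥ* laplacian a = 0)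
    (hu1 : ∑ i, u i = 1) :
    ∃ μ₀ > 0, ∀ μ₁ ≥ μ₀, ∀ μ₂ ≥ μ₀, ∀ (S : ℝ → Fin N → Matrix (Fin n) (Fin n) ℝ)
      (η : ℝ → Fin N → Fin n → ℝ), IsObserver a μ₁ μ₂ (Ici 0) S η → S 0 = S₀ →
      ∃ χ, Tendsto (fun t : ℝ => NormedSpace.exp (-(t • ∑ i, u i • S₀ i)) *ᵥ ∑ i, u i • η t i)
          atTop (𝓝 χ) ∧
        ObserverConverges a μ₁ μ₂ S η (∑ i, u i • S₀ i) χ := by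
  obtain ⟨l, hl, hrate⟩ := htree.exists_rate ha hu hu1
  obtain ⟨c₁, hc₁⟩ := (Set.finite_range fun z : Fin N × Fin n × Fin n =>
    |S₀ z.1 z.2.1 z.2.2|).bddAbove
  obtain ⟨c₂, hc₂⟩ := (Set.finite_range fun z : Fin n × Fin n =>
    |(∑ i, u i • S₀ i) z.1 z.2|).bddAbove
  -- Nonnegativity of u is not at hand, so the weighted average needs an entry bound of its own.
  set c := max 0 (max c₁ c₂) with hc
  have hc0 : 0 ≤ c := le_max_left _ _
  have h1 : ∀ i j k, |S₀ i j k| ≤ c := fun i j k =>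
    (hc₁ ⟨(i, j, k), rfl⟩).trans ((le_max_left _ _).trans (le_max_right _ _))
  have h2 : ∀ j k, |(∑ i, u i • S₀ i) j k| ≤ c := fun j k =>
    (hc₂ ⟨(j, k), rfl⟩).trans ((le_max_right _ _).trans (le_max_right _ _))
  -- The decay rate μl must reach 4(cn + 1), the rate budgeted in `IsObserver.converges`.
  have hμ₀ : 0 < 4 * (c * n + 1) / l := by positivity
  refine ⟨4 * (c * n + 1) / l, hμ₀, fun μ₁ hμ₁ μ₂ hμ₂ S η h hS => ?_⟩
  subst hS
  exact h.converges ha (hμ₀.trans_le hμ₁) (hμ₀.trans_le hμ₂) hu hu1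
    (fun μ b hμ hb x g => hrate _ isTimeInterval_Ici μ b hμ hb x g) hc0 h1 rfl h2
    ((div_le_iff₀ hl).1 hμ₁) ((div_le_iff₀ hl).1 hμ₂)

/-! ### The exosystem polynomial of a disturbance -/

section ExosystemPolynomial

open Polynomial

variable {n : ℕ} {m : Fin n → ℕ}

/-- The eigenvectors of a companion matrix are geometric progressions. -/
theorem eq_sum_of_mem_spectrum_companion {k : ℕ} {c : Fin (k + 1) → ℝ} {z : ℂ}
    (hz : z ∈ spectrum ℂ ((companion c).map (algebraMap ℝ ℂ))) :
    z ^ (k + 1) = ∑ j, (c j : ℂ) * z ^ (j : ℕ) := by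
  obtain ⟨v, hv, hvz⟩ := exists_eigenvector_of_mem_spectrum hz
  have hrow : ∀ i (hi : i + 1 < k + 1), v ⟨i + 1, hi⟩ = z * v ⟨i, by omega⟩ := by
    intro i hi
    have h := congrFun hvz ⟨i, by omega⟩
    rw [Pi.smul_apply, smul_eq_mul] at h
    rw [← h, Matrix.mulVec, dotProduct, Finset.sum_eq_single ⟨i + 1, hi⟩]
    · have : ¬ i = k := by omega
      simp [companion, this]
    · intro j _ hj
      have h1 : ¬ i = k := by omega
      have h2 : ¬ (j : ℕ) = i + 1 := fun h => hj (Fin.ext h)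
      simp [companion, h1, h2]
    · simp
  have hpow : ∀ i (hi : i < k + 1), v ⟨i, hi⟩ = z ^ i * v 0 := by
    intro i
    induction i with
    | zero => intro _; simp
    | succ i ih => intro hi; rw [hrow i hi, ih, pow_succ']; ring
  have hpow' : ∀ j : Fin (k + 1), v j = z ^ (j : ℕ) * v 0 := fun j => hpow j j.2
  have hv0 : v 0 ≠ 0 := fun h => hv (funext fun j => by simp [hpow' j, h])
  have hlast := congrFun hvz (Fin.last k)
  rw [Pi.smul_apply, smul_eq_mul, hpow' (Fin.last k)] at hlast
  refine mul_right_cancel₀ hv0 ?_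
  rw [Finset.sum_mul, pow_succ', mul_assoc]
  simp only [Fin.val_last] at hlast
  rw [← hlast, Matrix.mulVec, dotProduct]
  refine Finset.sum_congr rfl fun j _ => ?_
  rw [hpow' j]
  simp [companion, mul_assoc]

/-- The polynomial whose roots are `0` and `± i σ` for the frequencies `σ` of a component. -/
noncomputable def Disturbance.poly (d : Disturbance m) (s : Fin n) : ℝ[X] :=
  X * ∏ k, (X ^ 2 + C (d.freq s k ^ 2))

theorem Disturbance.poly_monic (d : Disturbance m) (s : Fin n) : (d.poly s).Monic :=
  monic_X.mul (monic_prod_of_monic _ _ fun _ _ => monic_X_pow_add_C _ two_ne_zero)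

theorem Disturbance.poly_natDegree (d : Disturbance m) (s : Fin n) :
    (d.poly s).natDegree = 2 * m s + 1 := by
  have h : ∀ k ∈ Finset.univ, (X ^ 2 + C (d.freq s k ^ 2)).Monic :=
    fun k _ => monic_X_pow_add_C _ two_ne_zero
  rw [poly, monic_X.natDegree_mul (monic_prod_of_monic _ _ h), natDegree_prod_of_monic _ _ h]
  simp only [natDegree_X_pow_add_C]
  simp
  ring

theorem Disturbance.aeval_poly (d : Disturbance m) (s : Fin n) (z : ℂ) :
    aeval z (d.poly s) = z ^ (2 * m s + 1) +
      ∑ k : Fin (2 * m s + 1), ((d.poly s).coeff k : ℂ) * z ^ (k : ℕ) := by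
  rw [aeval_eq_sum_range, poly_natDegree, Finset.sum_range_succ, ← poly_natDegree,
    coeff_natDegree, d.poly_monic, one_smul, poly_natDegree, add_comm, Finset.sum_range]
  simp [Algebra.smul_def]

theorem Disturbance.aeval_poly_eq_zero_iff (d : Disturbance m) (s : Fin n) (z : ℂ) :
    aeval z (d.poly s) = 0 ↔ z = 0 ∨ ∃ k, z ^ 2 = -(d.freq s k : ℂ) ^ 2 := by
  simp [poly, Finset.prod_eq_zero_iff, ← eq_neg_iff_add_eq_zero]

theorem Disturbance.re_eq_zero_of_aeval_poly (d : Disturbance m) (s : Fin n) {z : ℂ}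
    (hz : aeval z (d.poly s) = 0) : z.re = 0 := by
  rcases (d.aeval_poly_eq_zero_iff s z).1 hz with h | ⟨k, hk⟩
  · simp [h]
  · have hσ := d.freq_pos s k
    have h1 := congrArg Complex.re hk
    have h2 := congrArg Complex.im hk
    rw [← Complex.ofReal_pow] at h1 h2
    simp only [pow_two, Complex.mul_re, Complex.mul_im, Complex.neg_re, Complex.neg_im,
      Complex.ofReal_re, Complex.ofReal_im, neg_zero] at h1 h2
    by_contra h0
    have h3 : z.im = 0 := by
      have : z.re * z.im = 0 := by linarith
      exact (mul_eq_zero.1 this).resolve_left h0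
    rw [h3] at h1
    nlinarith [mul_self_nonneg z.re]

/-- In complex form, differentiation multiplies each mode by its characteristic exponent iσ, or 0
for the bias, so a differential equation becomes the evaluation of a polynomial. -/
theorem Disturbance.derivValue_eq (d : Disturbance m) (s : Fin n) (k : ℕ) (t : ℝ) :
    d.derivValue s k t = d.bias s * ((0 : ℂ) ^ k).re + ∑ j, d.amp s j *
      ((d.freq s j * Complex.I) ^ k *
        Complex.exp ((d.freq s j * t + d.phase s j : ℝ) * Complex.I)).im := by
  rw [derivValue]
  congr 1
  · rcases eq_or_ne k 0 with rfl | h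
    · simp
    · simp [h]
  · refine Finset.sum_congr rfl fun j _ => ?_
    have h1 : Complex.I ^ k = Complex.exp ((k * (Real.pi / 2) : ℝ) * Complex.I) := by
      have : Complex.I = Complex.exp ((Real.pi / 2 : ℝ) * Complex.I) := by
        push_cast
        exact (Complex.exp_pi_div_two_mul_I).symm
      conv_lhs => rw [this]
      rw [← Complex.exp_nat_mul]
      congr 1
      push_cast
      ring
    rw [mul_pow, h1, mul_assoc, mul_assoc, ← Complex.exp_add, ← add_mul, ← Complex.ofReal_add,
      ← Complex.ofReal_pow, Complex.im_ofReal_mul, Complex.exp_ofReal_mul_I_im,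
      add_comm (k * (Real.pi / 2))]

/-- Each mode is annihilated separately, since its exponent is a root of `d.poly s`; coinciding
frequencies do no harm. -/
theorem Disturbance.derivValue_recursion (d : Disturbance m) (s : Fin n) (t : ℝ) :
    d.derivValue s (2 * m s + 1) t +
      ∑ k : Fin (2 * m s + 1), (d.poly s).coeff k * d.derivValue s k t = 0 := by
  have hroot : ∀ j, aeval ((d.freq s j : ℂ) * Complex.I) (d.poly s) = 0 := fun j =>
    (d.aeval_poly_eq_zero_iff s _).2 (Or.inr ⟨j, by rw [mul_pow, Complex.I_sq]; ring⟩)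
  have hzero : aeval (0 : ℂ) (d.poly s) = 0 := (d.aeval_poly_eq_zero_iff s _).2 (Or.inl rfl)
  have h0 : ((0 : ℂ) ^ (2 * m s + 1)).re +
      ∑ k : Fin (2 * m s + 1), (d.poly s).coeff k * ((0 : ℂ) ^ (k : ℕ)).re = 0 := by
    rw [d.aeval_poly] at hzero
    simpa [-ne_eq, -map_zero] using congrArg Complex.re hzero
  have hj : ∀ j, ((d.freq s j * Complex.I) ^ (2 * m s + 1) *
        Complex.exp ((d.freq s j * t + d.phase s j : ℝ) * Complex.I)).im +
      ∑ k : Fin (2 * m s + 1), (d.poly s).coeff k * ((d.freq s j * Complex.I) ^ (k : ℕ) *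
        Complex.exp ((d.freq s j * t + d.phase s j : ℝ) * Complex.I)).im = 0 := by
    intro j
    have h := congrArg (fun w => (w * Complex.exp
      ((d.freq s j * t + d.phase s j : ℝ) * Complex.I)).im) (hroot j)
    simp only [d.aeval_poly, zero_mul, Complex.zero_im, add_mul, Finset.sum_mul, Complex.add_im,
      Complex.im_sum, mul_assoc, Complex.im_ofReal_mul] at h
    simpa only [mul_assoc] using h
  simp only [derivValue_eq, mul_add, Finset.sum_add_distrib, Finset.mul_sum]
  rw [Finset.sum_comm]
  have e1 : ∑ k : Fin (2 * m s + 1), (d.poly s).coeff k * (d.bias s * ((0 : ℂ) ^ (k : ℕ)).re) =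
      d.bias s * ∑ k : Fin (2 * m s + 1), (d.poly s).coeff k * ((0 : ℂ) ^ (k : ℕ)).re := by
    rw [Finset.mul_sum]
    exact Finset.sum_congr rfl fun k _ => by ring
  have e2 : ∀ A B C D : ℝ, A + B + (C + D) = (A + C) + (B + D) := fun _ _ _ _ => by ring
  rw [e1, e2, ← mul_add, h0, mul_zero, zero_add, ← Finset.sum_add_distrib]
  refine Finset.sum_eq_zero fun j _ => ?_
  have := congrArg (d.amp s j * ·) (hj j)
  simp only [mul_add, Finset.mul_sum, mul_zero] at this
  rw [← this]
  congr 1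
  exact Finset.sum_congr rfl fun k _ => by ring

end ExosystemPolynomial

/-! ### A design that works for all plants and disturbances -/

section StandardDesign

variable {n p : ℕ} (Y : Regressor (Fin n) n p) (m : Fin n → ℕ)

/-- The part of the standard design that does not involve the regression matrices. -/
noncomputable def standardModel (n p : ℕ) (m : Fin n → ℕ) : Design n p where
  -- One dimension for the bias and two for each sinusoid.
  r s := 2 * m s + 1
  l := Fintype.card (Fin n × ((s : Fin n) × Fin (2 * m s + 1)))
  M _ := Matrix.diagonal fun k => -((k : ℝ) + 1)
  N _ _ := 1
  T₀ := 1
  -- All matrix units: whatever T is, A - ΨT⁻¹ lies in their span, so the choice of `T₀` is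
  -- immaterial for the fit.
  E j := Matrix.single ((Fintype.equivFin _).symm j).1 ((Fintype.equivFin _).symm j).2 1
  -- Placeholders: `standardDesign` replaces them, using `bigM`, `bigN` and `A`, which do not depend
  -- on them.
  P _ _ _ _ := 0
  Q _ _ _ _ := 0
  L _ _ := 0
  K := 1
  Λ _ := 1

/-- A regression matrix for `M(q) s`. -/
noncomputable def inertiaRegressor (q s : Fin n → ℝ) : Matrix (Fin n) (Fin p) ℝ :=
  Y q 0 s 0 - Y q 0 0 0

/-- A regression matrix for `C(q, v)ᵀ s`. -/
noncomputable def coriolisRegressor (q v s : Fin n → ℝ) : Matrix (Fin n) (Fin p) ℝ :=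
  Matrix.of fun i k => ∑ j, s j * (Y q v 0 (Pi.single i 1) j k - Y q v 0 0 j k)

/-- A design built from the regression matrix and the numbers of sinusoids alone. -/
noncomputable def standardDesign : Design n p :=
  { standardModel n p m with
    P := fun q v x y => (standardModel n p m).bigM * ((standardModel n p m).bigN *
        inertiaRegressor Y q (v - y)) - (standardModel n p m).bigN *
        coriolisRegressor Y q v (v - y) + (standardModel n p m).bigN * Y q v x y
    Q := fun q v x y => (standardModel n p m).A * ((standardModel n p m).bigN *
        inertiaRegressor Y q (v - y)) - Y q v x y
    L := inertiaRegressor Y }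

theorem isHurwitz_diagonal (r : ℕ) :
    IsHurwitz (Matrix.diagonal fun k : Fin r => -((k : ℝ) + 1)) := by
  intro z hz
  rw [Matrix.diagonal_map (map_zero _), spectrum_diagonal] at hz
  obtain ⟨k, rfl⟩ := hz
  have : (0 : ℝ) ≤ k := Nat.cast_nonneg _
  simp only [Complex.coe_algebraMap, Complex.ofReal_re]
  linarith

/-- The Krylov matrix of a diagonal matrix and the all-ones vector is the Vandermonde matrix of the
distinct diagonal entries. -/
theorem isControllable_diagonal (r : ℕ) :
    IsControllable (Matrix.diagonal fun k : Fin r => -((k : ℝ) + 1)) fun _ => 1 := by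
  have h : (Matrix.of fun i k : Fin r =>
      ((Matrix.diagonal fun k : Fin r => -((k : ℝ) + 1)) ^ (k : ℕ) *ᵥ fun _ => (1 : ℝ)) i) =
      Matrix.vandermonde fun k : Fin r => -((k : ℝ) + 1) := by
    ext i k
    rw [Matrix.of_apply, Matrix.diagonal_pow, Matrix.mulVec_diagonal, Matrix.vandermonde_apply]
    simp
  rw [IsControllable, h, Matrix.rank_of_isUnit, Fintype.card_fin]
  rw [Matrix.isUnit_iff_isUnit_det, isUnit_iff_ne_zero, Matrix.det_vandermonde_ne_zero_iff]
  intro i j hij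
  simpa [Fin.val_inj] using hij

variable {Y}

theorem locallyLipschitz_inertiaRegressor (hY : Y.IsLocLipschitz) {X : Type*}
    [PseudoMetricSpace X] {q s : X → Fin n → ℝ} (hq : LocallyLipschitz q)
    (hs : LocallyLipschitz s) (i : Fin n) (j : Fin p) :
    LocallyLipschitz fun z => inertiaRegressor Y (q z) (s z) i j :=
  (hY.comp hq (.const 0) hs (.const 0) i j).sub (hY.comp hq (.const 0) (.const 0) (.const 0) i j)

theorem locallyLipschitz_coriolisRegressor (hY : Y.IsLocLipschitz) {X : Type*}
    [PseudoMetricSpace X] {q v s : X → Fin n → ℝ} (hq : LocallyLipschitz q)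
    (hv : LocallyLipschitz v) (hs : LocallyLipschitz s) (i : Fin n) (j : Fin p) :
    LocallyLipschitz fun z => coriolisRegressor Y (q z) (v z) (s z) i j :=
  LocallyLipschitz.sum_real Finset.univ fun k _ => (hs.apply k).mul_real
    ((hY.comp hq hv (.const 0) (.const _) k j).sub (hY.comp hq hv (.const 0) (.const 0) k j))

theorem standardDesign_admissible (hY : Y.IsLocLipschitz) : (standardDesign Y m).Admissible where
  r_pos _ := Nat.succ_pos _
  hurwitz s := isHurwitz_diagonal _
  controllable s := isControllable_diagonal _
  T₀_nonsing := by
    change IsUnit (1 : Matrix (standardModel n p m).Idx (standardModel n p m).Idx ℝ).det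
    rw [Matrix.det_one]
    exact isUnit_one
  K_posDef := Matrix.PosDef.one
  Λ_pos _ := one_pos
  P_lip i j := by
    have h1 := LipschitzWith.prod_fst (α := Fin n → ℝ)
      (β := (Fin n → ℝ) × (Fin n → ℝ) × (Fin n → ℝ)) |>.locallyLipschitz
    have h1' := LipschitzWith.prod_snd (α := Fin n → ℝ)
      (β := (Fin n → ℝ) × (Fin n → ℝ) × (Fin n → ℝ)) |>.locallyLipschitz
    have h2 := LipschitzWith.prod_fst.locallyLipschitz.comp h1'
    have h2' := LipschitzWith.prod_snd.locallyLipschitz.comp h1'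
    have h4 := LipschitzWith.prod_snd.locallyLipschitz.comp h2'
    have hc : ∀ {ι κ : Type} (A : Matrix ι κ ℝ) (i j), LocallyLipschitz
      fun _ : (Fin n → ℝ) × (Fin n → ℝ) × (Fin n → ℝ) × (Fin n → ℝ) => A i j :=
        fun A i j => LocallyLipschitz.const _
    exact ((LocallyLipschitz.mul_apply (hc _) (LocallyLipschitz.mul_apply (hc _)
      (locallyLipschitz_inertiaRegressor hY h1 (h2.sub h4))) i j).sub
      (LocallyLipschitz.mul_apply (hc _)
        (locallyLipschitz_coriolisRegressor hY h1 h2 (h2.sub h4)) i j)).add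
      (LocallyLipschitz.mul_apply (hc _) hY i j)
  Q_lip i j := by
    have h1 := LipschitzWith.prod_fst (α := Fin n → ℝ)
      (β := (Fin n → ℝ) × (Fin n → ℝ) × (Fin n → ℝ)) |>.locallyLipschitz
    have h1' := LipschitzWith.prod_snd (α := Fin n → ℝ)
      (β := (Fin n → ℝ) × (Fin n → ℝ) × (Fin n → ℝ)) |>.locallyLipschitz
    have h2 := LipschitzWith.prod_fst.locallyLipschitz.comp h1'
    have h2' := LipschitzWith.prod_snd.locallyLipschitz.comp h1'
    have h4 := LipschitzWith.prod_snd.locallyLipschitz.comp h2'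
    have hc : ∀ {ι κ : Type} (A : Matrix ι κ ℝ) (i j), LocallyLipschitz
      fun _ : (Fin n → ℝ) × (Fin n → ℝ) × (Fin n → ℝ) × (Fin n → ℝ) => A i j :=
        fun A i j => LocallyLipschitz.const _
    exact (LocallyLipschitz.mul_apply (hc _) (LocallyLipschitz.mul_apply (hc _)
      (locallyLipschitz_inertiaRegressor hY h1 (h2.sub h4))) i j).sub (hY i j)
  L_lip i j := locallyLipschitz_inertiaRegressor hY LipschitzWith.prod_fst.locallyLipschitz
    LipschitzWith.prod_snd.locallyLipschitz i j

/-- Since Ṁ is symmetric, skewness of Ṁ - 2C identifies Ṁ with twice the symmetric part of C.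
Consequently Cs - Ṁs = -Cᵀs, and P needs no derivative of the regression matrix. -/
theorem Plant.IsEulerLagrange.inertiaRate_eq {Pl : Plant n p} (hPl : Pl.IsEulerLagrange Y)
    (q v : Fin n → ℝ) : Pl.inertiaRate q v = Pl.coriolis q v + (Pl.coriolis q v)ᵀ := by
  have hsymm : (Pl.inertiaRate q v)ᵀ = Pl.inertiaRate q v := by
    ext i j
    have : (fun z => Pl.inertia z j i) = fun z => Pl.inertia z i j :=
      funext fun z => (hPl.inertia_symm z).apply i j
    simp [Plant.inertiaRate, this]
  have h := hPl.skew q v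
  rw [Matrix.transpose_sub, Matrix.transpose_smul, hsymm] at h
  ext i j
  have h1 := congrFun (congrFun h i) j
  simp only [Matrix.sub_apply, Matrix.smul_apply, Matrix.transpose_apply, Matrix.neg_apply,
    smul_eq_mul] at h1
  simp only [Matrix.add_apply, Matrix.transpose_apply]
  linarith

theorem inertiaRegressor_mulVec {Pl : Plant n p} (hPl : Pl.IsEulerLagrange Y)
    (q s : Fin n → ℝ) : inertiaRegressor Y q s *ᵥ Pl.param = Pl.inertia q *ᵥ s := by
  rw [hPl.inertia_mulVec q 0 s, inertiaRegressor, Matrix.sub_mulVec]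

theorem coriolisRegressor_mulVec {Pl : Plant n p} (hPl : Pl.IsEulerLagrange Y)
    (q v s : Fin n → ℝ) :
    coriolisRegressor Y q v s *ᵥ Pl.param = (Pl.coriolis q v)ᵀ *ᵥ s := by
  ext i
  have h : ∀ j, Pl.coriolis q v j i =
      ∑ k, (Y q v 0 (Pi.single i 1) j k - Y q v 0 0 j k) * Pl.param k := by
    intro j
    have := congrFun (hPl.coriolis_mulVec q v (Pi.single i 1)) j
    rw [Matrix.mulVec_single_one, ← Matrix.sub_mulVec] at this
    exact this
  simp only [Matrix.mulVec, dotProduct, coriolisRegressor, Matrix.of_apply, Matrix.transpose_apply,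
    h, Finset.sum_mul]
  rw [Finset.sum_comm]
  exact Finset.sum_congr rfl fun j _ => Finset.sum_congr rfl fun k _ => by ring

theorem Plant.IsEulerLagrange.mul_regressor_mulVec {Pl : Plant n p} (hPl : Pl.IsEulerLagrange Y)
    {ι κ : Type} [Fintype ι] [Fintype κ] (B : Matrix ι κ ℝ) (N : Matrix κ (Fin n) ℝ)
    (q s : Fin n → ℝ) :
    (B * (N * inertiaRegressor Y q s)) *ᵥ Pl.param = B *ᵥ (N *ᵥ (Pl.inertia q *ᵥ s)) := by
  rw [← Matrix.mulVec_mulVec, ← Matrix.mulVec_mulVec, inertiaRegressor_mulVec hPl]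

theorem Plant.IsEulerLagrange.filter_regressor_mulVec {Pl : Plant n p}
    (hPl : Pl.IsEulerLagrange Y) {ι : Type} [Fintype ι] (M : Matrix ι ι ℝ)
    (N : Matrix ι (Fin n) ℝ) (q v s : Fin n → ℝ) (W : Matrix (Fin n) (Fin p) ℝ) :
    (M * (N * inertiaRegressor Y q s) - N * coriolisRegressor Y q v s + N * W) *ᵥ Pl.param =
      M *ᵥ (N *ᵥ (Pl.inertia q *ᵥ s)) + N *ᵥ (Pl.coriolis q v *ᵥ s)
        - N *ᵥ (Pl.inertiaRate q v *ᵥ s) + N *ᵥ (W *ᵥ Pl.param) := by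
  rw [Matrix.add_mulVec, Matrix.sub_mulVec, hPl.mul_regressor_mulVec, ← Matrix.mulVec_mulVec,
    ← Matrix.mulVec_mulVec, coriolisRegressor_mulVec hPl, hPl.inertiaRate_eq, Matrix.add_mulVec,
    Matrix.mulVec_add]
  abel

theorem standardDesign_regresses {Pl : Plant n p} (hPl : Pl.IsEulerLagrange Y) :
    (standardDesign Y m).Regresses Y Pl where
  P_eq q v x y := hPl.filter_regressor_mulVec (standardModel n p m).bigM
    (standardModel n p m).bigN q v (v - y) (Y q v x y)
  Q_eq q v x y := (Matrix.sub_mulVec _ _ _).trans (congrArg (· - Y q v x y *ᵥ Pl.param)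
    (hPl.mul_regressor_mulVec (standardModel n p m).A (standardModel n p m).bigN q (v - y)))
  L_eq q s := inertiaRegressor_mulVec hPl q s

/-- The coefficients are read off `d.poly s`, whose roots 0 and ±iσ are imaginary; the span
condition holds by expansion in matrix units. -/
theorem standardDesign_models (d : Disturbance m) : (standardDesign Y m).Models d := by
  refine ⟨fun s k => -(d.poly s).coeff k, fun s t => ?_, fun s z hz => ?_, fun T _ => ?_⟩
  · have h := d.derivValue_recursion s t
    simp only [d.iteratedDeriv_value, neg_mul, Finset.sum_neg_distrib]
    exact eq_neg_of_add_eq_zero_left h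
  · refine d.re_eq_zero_of_aeval_poly s ?_
    have h := eq_sum_of_mem_spectrum_companion (k := 2 * m s) hz
    rw [d.aeval_poly, h]
    simp
  · set B := (standardDesign Y m).A - (standardDesign Y m).bigΨ * (Matrix.blockDiagonal' T)⁻¹
      with hB
    refine ⟨fun j => B ((Fintype.equivFin (Fin n × ((s : Fin n) × Fin (2 * m s + 1)))).symm j).1
      ((Fintype.equivFin _).symm j).2, ?_⟩
    have h1 : B = ∑ z : Fin n × ((s : Fin n) × Fin (2 * m s + 1)),
        B z.1 z.2 • Matrix.single z.1 z.2 (1 : ℝ) := by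
      conv_lhs => rw [Matrix.matrix_eq_sum_single B]
      rw [Fintype.sum_prod_type]
      exact Finset.sum_congr rfl fun i _ => Finset.sum_congr rfl fun j _ => by
        rw [Matrix.smul_single, smul_eq_mul, mul_one]
        rfl
    refine h1.trans ?_
    exact ((Fintype.equivFin (Fin n × ((s : Fin n) × Fin (2 * m s + 1)))).symm.sum_comp
      fun z => B z.1 z.2 • Matrix.single z.1 z.2 (1 : ℝ)).symm

end StandardDesign

end EulerLagrangeConsensus

/-! ### The main theorem -/

open EulerLagrangeConsensus in
theorem theorem1 {N n p : ℕ} (a : Matrix (Fin N) (Fin N) ℝ) (ha : ∀ i j, 0 ≤ a i j)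
    (htree : HasSpanningTree a) (Y : Fin N → Regressor (Fin n) n p)
    (hY : ∀ i, (Y i).IsLocLipschitz) (m : Fin N → Fin n → ℕ) :
    -- the design can be carried out without knowing the plants and the disturbances
    (∃ D : Fin N → Design n p, ∀ i, (D i).Admissible ∧
      (∀ Pl : Plant n p, Pl.IsEulerLagrange (Y i) → (D i).Regresses (Y i) Pl) ∧
      ∀ d : Disturbance (m i), (D i).Models d) ∧
    -- every such design solves the problem, for all large observer gains
    ∀ S₀ : Fin N → Matrix (Fin n) (Fin n) ℝ, ∃ μ₀ > 0, ∀ μ₁ ≥ μ₀, ∀ μ₂ ≥ μ₀, ∀ α > 0,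
      ∀ D : Fin N → Design n p, (∀ i, (D i).Admissible) →
      ∀ Pl : Fin N → Plant n p, (∀ i, (Pl i).IsEulerLagrange (Y i)) →
        (∀ i, (D i).Regresses (Y i) (Pl i)) →
      ∀ d : ∀ i, Disturbance (m i), (∀ i, (D i).Models (d i)) →
        (∀ x₀ : ∀ i, (D i).State, (∀ i, (x₀ i).S = S₀ i) →
          ∃ x : ℝ → ∀ i, (D i).State, IsSolution a μ₁ μ₂ α Pl d x ∧ x 0 = x₀) ∧
        ∀ x : ℝ → ∀ i, (D i).State, IsSolution a μ₁ μ₂ α Pl d x → (∀ i, (x 0 i).S = S₀ i) →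
          (∃ Sstar χ, IsGroupModel a x Sstar χ) ∧
          ∀ Sstar χ, IsGroupModel a x Sstar χ →
            (BoundedForward (groupTrajectory Sstar χ) →
              (∀ i, BoundedForward (fun t => (x t i).q) ∧ BoundedForward (fun t => (x t i).v)) ∧
              ReachesConsensus x) ∧
            (BoundedForward (fun t => Sstar *ᵥ groupTrajectory Sstar χ t) →
              (∀ i, (D i).UniformlyBounded) →
              (∀ i, BoundedForward (fun t => (x t i).q - groupTrajectory Sstar χ t) ∧
                BoundedForward (fun t => (x t i).v)) ∧
              ReachesConsensus x) := by
  obtain ⟨u, ⟨hu, hu1⟩, huniq⟩ := htree.existsUnique_leftNull ha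
  refine ⟨⟨fun i => standardDesign (Y i) (m i), fun i => ⟨standardDesign_admissible _ (hY i),
    fun _ hPl => standardDesign_regresses _ hPl, standardDesign_models _⟩⟩, fun S₀ => ?_⟩
  obtain ⟨μ₀, hμ₀, hgain⟩ := htree.exists_observer_gain ha S₀ hu hu1
  refine ⟨μ₀, hμ₀, fun μ₁ hμ₁ μ₂ hμ₂ α hα D hD Pl hPl hReg d hd => ⟨fun x₀ _ =>
    exists_isSolution ha (hμ₀.trans_le hμ₁).le (hμ₀.trans_le hμ₂).le hα hY hD hPl hReg hd x₀,
    fun x hx hx0 => ?_⟩⟩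
  have hsol := isSolutionOn_Ici.2 hx
  obtain ⟨χ₀, hχ₀, hobs⟩ := hgain μ₁ hμ₁ μ₂ hμ₂ _ _ hsol.isObserver (funext hx0)
  refine ⟨⟨_, χ₀, u, hu, hu1, rfl, by simpa only [hx0] using hχ₀⟩, ?_⟩
  rintro Sstar χ ⟨w, hw, hw1, hSstar, hχ⟩
  -- The group model is unique: u by its normalization, χ as a limit. What is known for the pair
  -- supplied by the observers therefore holds for every pair.
  obtain rfl := huniq w hw hw1
  obtain rfl : Sstar = ∑ i, w i • S₀ i := by simpa only [hx0] using hSstar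
  obtain rfl := tendsto_nhds_unique hχ hχ₀
  exact ⟨hsol.bounded_of_bounded_trajectory hα hD hPl hReg hd hobs,
    hsol.bounded_of_bounded_velocity hα hD hPl hReg hd hobs⟩
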